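/- Let $K=\mathbb R$ or $\mathbb C$. For $P_2,P_3\in K[x,y]$ with homogeneous components $P_2=a_0+a_1+a_2$, $P_3=b_0+b_1+b_2+b_3$ consider the relations $$a_2^3=b_3^2,\qquad 3a_2^2a_1=2b_3b_2 .\qquad (*)$$ Put $H=P_2^3/P_3^2$, and let $X_{P_2,P_3}=P\partial_x+Q\partial_y$ be the vector field defined by $P\,dy-Q\,dx=3P_3\,dP_2-2P_2\,dP_3$. Call $(P_2,P_3)$ special if $\deg P_2=2$, $\deg P_3=3$ and $(*)$ holds. A polynomial vector field $V$ has the rational first integral $F/G$ ($G\ne0$) if $F/G$ is nonconstant and $G\,V(F)=F\,V(G)$. Let $\mathcal A_2\cong\mathbb C^{12}$ be the space of complex plane polynomial vector fields of degree at most two, and let $\mathcal C_2\subset\mathcal A_2$ be the Zariski closure of the set of those having a Morse center, that is, a non-degenerate singular point near which there is a holomorphic first integral with a non-degenerate critical point at that point. Let $\mathcal L(2,3)$ be the set of vector fields $cX_{f_2,f_3}$ with $c\in\mathbb C^*$, $f_2,f_3\in\mathbb C[x,y]$, $\deg f_2=2$, $\deg f_3=3$, and let $\mathcal Q_4$ be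 the Zariski closure of $\mathcal L(2,3)\cap\mathcal A_2$ in $\mathcal A_2$. Then: 1. If $\deg P_2\le2$, $\deg P_3\le3$ and $(*)$ holds, then $X_{P_2,P_3}$ has degree at most two, and so has every polynomial vector field with relatively prime components having the rational first integral $H$. If $(P_2,P_3)$ is special and $P_2$ is irreducible over the algebraic closure of $K$, then $X_{P_2,P_3}$ has degree exactly two; if moreover $P_3$ is irreducible over the algebraic closure of $K$, then the polynomial vector fields $V$ with the rational first integral $H$ (the zero field included) are exactly the polynomial multiples of $X_{P_2,P_3}$. 2. Over $\mathbb C$, the set of vector fields $cX_{P_2,P_3}$ with $c\in\mathbb C^*$ and $(P_2,P_3)$ special is equal to $\mathcal L(2,3)\cap\mathcal A_2$; its Zariski closure is $\mathcal Q_4$, and $\mathcal Q_4$ is an irreducible component of $\mathcal C_2$. 3. Let $(P_2,P_3)$ be special. There are $\alpha\in K$ and an invertible affine change of the variables $x,y$ over $K$ transforming $H$ into $$H_\alpha=\frac{(x^2+2y+\alpha)^3}{(x^3+3xy+1)^2}$$ if and only if $P_2$ and $P_3$ are irreducible over the algebraic closure of $K$. For every $\alpha\in K$ the pair $(x^2+2y+\alpha,\;x^3+3xy+1)$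 is special. Over $\mathbb C$, the vector fields $cX_{P_2,P_3}$, $c\in\mathbb C^*$, with $(P_2,P_3)$ special and $P_2,P_3$ irreducible form a Zariski dense subset of $\mathcal Q_4$. -/

import Mathlib

open Topology

noncomputable section

namespace QuadCenter

open MvPolynomial

/-! ### Polynomial vector fields on the plane and rational first integrals -/

/-- Polynomials in the two variables `x = X 0`, `y = X 1`. -/
abbrev Poly (K : Type*) [Field K] := MvPolynomial (Fin 2) K

/-- A plane polynomial vector field `x' = V 0`, `y' = V 1`. -/
abbrev VField (K : Type*) [Field K] := Fin 2 → Poly K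

/-- The degree of a polynomial vector field. -/
def VField.degree {K : Type*} [Field K] (V : VField K) : ℕ :=
  max (V 0).totalDegree (V 1).totalDegree

/-- `𝒜_n`: the polynomial vector fields of degree at most `n`. -/
def fieldsOfDegreeLE (K : Type*) [Field K] (n : ℕ) : Set (VField K) :=
  {V | VField.degree V ≤ n}

/-- The derivative `V(F) = P F_x + Q F_y` of `F` along `V = (P, Q)`. -/
def lieDeriv {K : Type*} [Field K] (V : VField K) (F : Poly K) : Poly K :=
  V 0 * pderiv 0 F + V 1 * pderiv 1 F

/-- `F / G` is a (nonconstant) rational first integral of `V`: the numerator of the derivative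
of the quotient `F / G` along `V` vanishes. -/
def HasRationalFirstIntegral {K : Type*} [Field K] (V : VField K) (F G : Poly K) : Prop :=
  G ≠ 0 ∧ (¬ ∃ c : K, F = C c * G) ∧ G * lieDeriv V F = F * lieDeriv V G

/-- The vector field `(P, Q)` of the affine foliation `3 P₃ dP₂ - 2 P₂ dP₃ = 0` with first
integral `P₂³ / P₃²`; it is determined by `P dy - Q dx = 3 P₃ dP₂ - 2 P₂ dP₃`. -/
def inducedField {K : Type*} [Field K] (P₂ P₃ : Poly K) : VField K :=
  ![3 * P₃ * pderiv 1 P₂ - 2 * P₂ * pderiv 1 P₃,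
    -(3 * P₃ * pderiv 0 P₂ - 2 * P₂ * pderiv 0 P₃)]

/-- With `a_i`, `b_j` the homogeneous components of `P₂`, `P₃`:
`a₂³ = b₃²` and `3 a₂² a₁ = 2 b₃ b₂`. -/
def TopRelations {K : Type*} [Field K] (P₂ P₃ : Poly K) : Prop :=
  homogeneousComponent 2 P₂ ^ 3 = homogeneousComponent 3 P₃ ^ 2 ∧
  3 * homogeneousComponent 2 P₂ ^ 2 * homogeneousComponent 1 P₂ =
    2 * homogeneousComponent 3 P₃ * homogeneousComponent 2 P₃

/-- Pairs `P₂ = a₀ + a₁ + a₂`, `P₃ = b₀ + b₁ + b₂ + b₃` of polynomials of degrees two and three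
subject to `a₂³ = b₃²` and `3 a₂² a₁ = 2 b₃ b₂`. -/
def IsSpecialPair {K : Type*} [Field K] (P₂ P₃ : Poly K) : Prop :=
  P₂.totalDegree = 2 ∧ P₃.totalDegree = 3 ∧ TopRelations P₂ P₃

/-- Irreducibility over an algebraic closure of the base field. -/
def AbsolutelyIrreducible {K : Type*} [Field K] (F : Poly K) : Prop :=
  Irreducible (MvPolynomial.map (algebraMap K (AlgebraicClosure K)) F)

/-! ### The rational function `H` and affine changes of variables -/

/-- `H = P₂³ / P₃²` as an element of the field of rational functions `K(x, y)`. -/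
def ratioH {K : Type*} [Field K] (P₂ P₃ : Poly K) : FractionRing (Poly K) :=
  algebraMap (Poly K) (FractionRing (Poly K)) P₂ ^ 3 /
    algebraMap (Poly K) (FractionRing (Poly K)) P₃ ^ 2

/-- The substitution `F ↦ F (M v + t)`, `v = (x, y)`. -/
def affineSubst {K : Type*} [Field K] (M : Matrix (Fin 2) (Fin 2) K) (t : Fin 2 → K) :
    Poly K →ₐ[K] Poly K :=
  aeval fun i => C (M i 0) * X 0 + C (M i 1) * X 1 + C (t i)

/-- `x² + 2 y + α`. -/
def normalP₂ {K : Type*} [Field K] (α : K) : Poly K := X 0 ^ 2 + 2 * X 1 + C α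

/-- `x³ + 3 x y + 1`. -/
def normalP₃ (K : Type*) [Field K] : Poly K := X 0 ^ 3 + 3 * X 0 * X 1 + 1

/-! ### Affine varieties in the space of coefficients -/

/-- The index set of the coefficients of a vector field of degree at most `n`: a component of
the field and a monomial of degree at most `n`. -/
abbrev CoeffIndex (n : ℕ) := Fin 2 × {m : Fin 2 →₀ ℕ // m.degree ≤ n}

/-- The coefficients; this identifies `𝒜_n` with the affine space of dimension
`(n + 1) (n + 2)`. -/
def coeffs {K : Type*} [Field K] (n : ℕ) (V : VField K) : CoeffIndex n → K :=
  fun k => coeff k.2.1 (V k.1)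

/-- Affine algebraic varieties: common zero loci of polynomials. -/
def IsVariety {σ : Type*} (Z : Set (σ → ℂ)) : Prop :=
  ∃ I : Ideal (MvPolynomial σ ℂ), Z = zeroLocus ℂ I

/-- The smallest affine algebraic variety containing `S`. -/
def zariskiClosure {σ : Type*} (S : Set (σ → ℂ)) : Set (σ → ℂ) :=
  zeroLocus ℂ (vanishingIdeal ℂ S)

def IsIrreducibleVariety {σ : Type*} (Z : Set (σ → ℂ)) : Prop :=
  IsVariety Z ∧ Z.Nonempty ∧
    ∀ Z₁ Z₂ : Set (σ → ℂ), IsVariety Z₁ → IsVariety Z₂ → Z = Z₁ ∪ Z₂ → Z₁ = Z ∨ Z₂ = Z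

/-- `Z` is an irreducible component of `W`: a maximal irreducible variety contained in `W`. -/
def IsIrreducibleComponent {σ : Type*} (Z W : Set (σ → ℂ)) : Prop :=
  IsIrreducibleVariety Z ∧ Z ⊆ W ∧
    ∀ Z' : Set (σ → ℂ), IsIrreducibleVariety Z' → Z ⊆ Z' → Z' ⊆ W → Z' = Z

/-! ### The center set -/

/-- The value of the vector field at a point. -/
def VField.evalAt (V : VField ℂ) (p : Fin 2 → ℂ) : Fin 2 → ℂ := fun i => eval p (V i)

/-- `p` is a Morse center of `V`: a singular point, non-degenerate, near which `V` has a
holomorphic first integral with a Morse (non-degenerate) critical point at `p`. -/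
def IsMorseCenter (V : VField ℂ) (p : Fin 2 → ℂ) : Prop :=
  V.evalAt p = 0 ∧
  (Matrix.of fun i j : Fin 2 => eval p (pderiv j (V i))).det ≠ 0 ∧
  ∃ f : (Fin 2 → ℂ) → ℂ, AnalyticAt ℂ f p ∧
    (∀ᶠ q in 𝓝 p, fderiv ℂ f q (V.evalAt q) = 0) ∧
    fderiv ℂ f p = 0 ∧ Function.Injective (fderiv ℂ (fderiv ℂ f) p)

/-- The center set `𝒞_n`: the variety of vector fields of degree at most `n` with a Morse center
(the Zariski closure, in the space of coefficients, of the set of these fields). -/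
def centerSet (n : ℕ) : Set (CoeffIndex n → ℂ) :=
  zariskiClosure (coeffs n '' {V | V ∈ fieldsOfDegreeLE ℂ n ∧ ∃ p, IsMorseCenter V p})

/-- `ℒ(2,3)`: the polynomial vector fields (up to a constant factor, those induced by
`3 f₃ df₂ - 2 f₂ df₃`) with a first integral `f₂³ / f₃²`, `deg f₂ = 2`, `deg f₃ = 3`. -/
def logFields23 : Set (VField ℂ) :=
  {V | ∃ f₂ f₃ : Poly ℂ, f₂.totalDegree = 2 ∧ f₃.totalDegree = 3 ∧
    ∃ c : ℂ, c ≠ 0 ∧ V = fun i => C c * inducedField f₂ f₃ i}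

/-- `𝒬₄`: the variety defined by `ℒ(2,3) ∩ 𝒜₂` in the space of coefficients of quadratic
vector fields. -/
def Q₄ : Set (CoeffIndex 2 → ℂ) :=
  zariskiClosure (coeffs 2 '' (logFields23 ∩ fieldsOfDegreeLE ℂ 2))

/-- The vector fields, up to a constant factor, induced by `P₂³ / P₃²` for pairs
`a₀ + a₁ + a₂`, `b₀ + b₁ + b₂ + b₃` with `a₂³ = b₃²` and `3 a₂² a₁ = 2 b₃ b₂`. -/
def specialFields : Set (VField ℂ) :=
  {V | ∃ P₂ P₃ : Poly ℂ, IsSpecialPair P₂ P₃ ∧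
    ∃ c : ℂ, c ≠ 0 ∧ V = fun i => C c * inducedField P₂ P₃ i}

/-- Those special vector fields for which `P₂` and `P₃` are irreducible. -/
def generalSpecialFields : Set (VField ℂ) :=
  {V | ∃ P₂ P₃ : Poly ℂ, IsSpecialPair P₂ P₃ ∧ Irreducible P₂ ∧ Irreducible P₃ ∧
    ∃ c : ℂ, c ≠ 0 ∧ V = fun i => C c * inducedField P₂ P₃ i}

end QuadCenter

end

open Topology

noncomputable section

namespace QuadCenter

open MvPolynomial

/-! ### Affine-linear and quadratic polynomials in two variables, by coefficients. -/

section Polynomials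

variable {R : Type*} [CommRing R]

/-! The relations say that `P₂³` and `P₃²` agree in degrees six and five. For a special pair, D =
P₂³ - P₃² therefore has degree at most four, and P₂² P₃ (3 P₃ dP₂ - 2 P₂ dP₃) = P₃² dD - D d(P₃²)
has degree at most nine; dividing by P₂² P₃, of degree seven, leaves degree at most two. Concretely,
unique factorization turns a₂³ = b₃² into a₂ = l², b₃ = l³, and special pairs are P₂ = l² + 2m + a,
P₃ = l³ + 3lm + n with l, m, n of degree at most one (`IsSpecialPair.exists_eq`). Conversely, if a
field of ℒ(2,3) is quadratic, the vanishing of the degree-four part of its form makes a₂³ / b₃²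
constant, and that of the degree-three part gives the second relation by Euler's identity
(`specialFields_eq`).

When P₂ is absolutely irreducible, l and m are affine coordinates, and translating them reduces n to
a constant δ (`exists_normal_eq`). Then P₃ is irreducible exactly if δ ≠ 0, and the weighted scaling
(x, y) ↦ (c x, c² y) with c³ = δ, which respects H, gives the normal form. In these coordinates the
components of the field are explicit quadratics, from which its degree and the coprimality are read
off.

𝒬₄ is the closure of the image of an affine space under a polynomial map, hence irreducible; its
general member has an explicit Morse center (`Q₄_subset_centerSet`). For maximality, a field with a
Morse center is brought to x' = x + a x² + b x y + c y², y' = -(y + a' y² + b' x y + c' x²). The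
Taylor coefficients of the first integral obey a recurrence whose resonant equations in degrees
four, six and eight yield three saddle quantities. Away from the Hamiltonian, reversible and
Lotka–Volterra strata they force a = -2b', a' = -2b, bb' = cc', and then a first integral of the
type f₂³ / f₃² can be written down (`inducedField_saddle`).

The exceptional strata are cut out by two affine semi-invariants at the center, `detForm` and
`traceForm`. The center can be eliminated from their product, up to a factor, giving a polynomial
`sepMvPoly` in the coefficients alone. Hence 𝒞₂ ⊆ 𝒬₄ ∪ {`sepMvPoly` = 0} (`centerSet_subset`), and
as `sepMvPoly` does not vanish identically on 𝒬₄, no larger irreducible variety fits between 𝒬₄ and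
𝒞₂. -/

/-- The polynomial `p x + q y + t`. -/
def lin (p q t : R) : MvPolynomial (Fin 2) R := C p * X 0 + C q * X 1 + C t

/-- The polynomial `a + b x + c y + d x² + e x y + f y²`. -/
def quad (a b c d e f : R) : MvPolynomial (Fin 2) R :=
  C a + C b * X 0 + C c * X 1 + C d * X 0 ^ 2 + C e * (X 0 * X 1) + C f * X 1 ^ 2

/-- The exponent of the monomial `x ^ i y ^ j`. -/
def expo (i j : ℕ) : Fin 2 →₀ ℕ := Finsupp.single 0 i + Finsupp.single 1 j

@[simp] lemma expo_apply_zero (i j : ℕ) : expo i j 0 = i := by simp [expo]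

@[simp] lemma expo_apply_one (i j : ℕ) : expo i j 1 = j := by simp [expo]

lemma expo_inj {i j k l : ℕ} : expo i j = expo k l ↔ i = k ∧ j = l := by
  constructor
  · intro h
    exact ⟨by simpa using DFunLike.congr_fun h 0, by simpa using DFunLike.congr_fun h 1⟩
  · rintro ⟨rfl, rfl⟩; rfl

lemma eq_expo (m : Fin 2 →₀ ℕ) : m = expo (m 0) (m 1) := by
  ext i; fin_cases i <;> simp

lemma degree_expo (i j : ℕ) : (expo i j).degree = i + j := by
  simp [expo, Finsupp.degree_single]

lemma X_pow_mul_X_pow (i j : ℕ) :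
    (X 0 ^ i * X 1 ^ j : MvPolynomial (Fin 2) R) = monomial (expo i j) 1 := by
  rw [X_pow_eq_monomial, X_pow_eq_monomial, monomial_mul, one_mul, expo]

lemma coeff_expo_C_mul_monomial (i j k l : ℕ) (a : R) :
    coeff (expo i j) (C a * (X 0 ^ k * X 1 ^ l : MvPolynomial (Fin 2) R)) =
      if k = i ∧ l = j then a else 0 := by
  rw [X_pow_mul_X_pow, coeff_C_mul, coeff_monomial]
  simp [expo_inj]

lemma quad_eq_monomials (a b c d e f : R) : quad a b c d e f =
    C a * (X 0 ^ 0 * X 1 ^ 0) + C b * (X 0 ^ 1 * X 1 ^ 0) + C c * (X 0 ^ 0 * X 1 ^ 1) +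
      C d * (X 0 ^ 2 * X 1 ^ 0) + C e * (X 0 ^ 1 * X 1 ^ 1) + C f * (X 0 ^ 0 * X 1 ^ 2) := by
  simp [quad]

lemma coeff_quad (i j : ℕ) (a b c d e f : R) : coeff (expo i j) (quad a b c d e f) =
    (if 0 = i ∧ 0 = j then a else 0) + (if 1 = i ∧ 0 = j then b else 0) +
    (if 0 = i ∧ 1 = j then c else 0) + (if 2 = i ∧ 0 = j then d else 0) +
    (if 1 = i ∧ 1 = j then e else 0) + (if 0 = i ∧ 2 = j then f else 0) := by
  simp only [quad_eq_monomials, coeff_add, coeff_expo_C_mul_monomial]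

lemma totalDegree_le_iff {F : MvPolynomial (Fin 2) R} {n : ℕ} :
    F.totalDegree ≤ n ↔ ∀ i j, n < i + j → coeff (expo i j) F = 0 := by
  constructor
  · intro h i j hij
    refine coeff_eq_zero_of_totalDegree_lt (lt_of_le_of_lt h ?_)
    change n < (expo i j).degree
    rwa [degree_expo]
  · intro h
    refine Finset.sup_le fun m hm => ?_
    by_contra hlt
    push Not at hlt
    refine mem_support_iff.1 hm ?_
    rw [eq_expo m]
    refine h _ _ (lt_of_lt_of_eq hlt ?_)
    rw [← degree_expo, ← eq_expo]
    rfl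

lemma totalDegree_quad_le (a b c d e f : R) : (quad a b c d e f).totalDegree ≤ 2 := by
  rw [totalDegree_le_iff]
  intro i j hij
  rw [coeff_quad]
  repeat rw [if_neg (by omega)]
  simp

lemma eq_quad {F : MvPolynomial (Fin 2) R} (h : F.totalDegree ≤ 2) :
    F = quad (coeff (expo 0 0) F) (coeff (expo 1 0) F) (coeff (expo 0 1) F)
      (coeff (expo 2 0) F) (coeff (expo 1 1) F) (coeff (expo 0 2) F) := by
  ext m
  rw [eq_expo m, coeff_quad]
  generalize m 0 = i
  generalize m 1 = j
  rcases lt_or_ge 2 (i + j) with hij | hij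
  · rw [totalDegree_le_iff.1 h i j hij]
    repeat rw [if_neg (by omega)]
    simp
  · have hi : i ≤ 2 := by omega
    have hj : j ≤ 2 := by omega
    interval_cases i <;> interval_cases j <;> first | omega | simp

lemma lin_eq_quad (p q t : R) : lin p q t = quad t p q 0 0 0 := by
  simp [lin, quad]; ring

lemma totalDegree_lin_le (p q t : R) : (lin p q t).totalDegree ≤ 1 := by
  rw [totalDegree_le_iff]
  intro i j hij
  rw [lin_eq_quad, coeff_quad]
  simp
  grind

lemma eq_lin {F : MvPolynomial (Fin 2) R} (h : F.totalDegree ≤ 1) :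
    F = lin (coeff (expo 1 0) F) (coeff (expo 0 1) F) (coeff (expo 0 0) F) := by
  have h' := totalDegree_le_iff.1 h
  conv_lhs => rw [eq_quad (h.trans one_le_two), h' 2 0 (by omega), h' 1 1 (by omega),
    h' 0 2 (by omega)]
  rw [lin_eq_quad]

lemma eq_lin_of_isHomogeneous {F : MvPolynomial (Fin 2) R} (h : F.IsHomogeneous 1) :
    F = lin (coeff (expo 1 0) F) (coeff (expo 0 1) F) 0 := by
  have h0 : coeff (expo 0 0) F = 0 := h.coeff_eq_zero (by simp [degree_expo])
  conv_lhs => rw [eq_lin h.totalDegree_le, h0]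

lemma isHomogeneous_lin (p q : R) : (lin p q 0).IsHomogeneous 1 := by
  have := ((isHomogeneous_X R (0 : Fin 2)).C_mul p).add ((isHomogeneous_X R (1 : Fin 2)).C_mul q)
  simpa [lin] using this

@[simp] lemma pderiv_zero_lin (p q t : R) : pderiv 0 (lin p q t) = C p := by
  simp [lin, pderiv_X_of_ne (show (1 : Fin 2) ≠ 0 by decide)]

@[simp] lemma pderiv_one_lin (p q t : R) : pderiv 1 (lin p q t) = C q := by
  simp [lin, pderiv_X_of_ne (show (0 : Fin 2) ≠ 1 by decide)]

lemma pderiv_zero_quad (a b c d e f : R) :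
    pderiv 0 (quad a b c d e f) = lin (2 * d) e b := by
  simp [quad, lin, pderiv_X_of_ne (show (1 : Fin 2) ≠ 0 by decide),
    show (C 2 : MvPolynomial (Fin 2) R) = 2 from map_ofNat C 2]
  ring

lemma pderiv_one_quad (a b c d e f : R) :
    pderiv 1 (quad a b c d e f) = lin e (2 * f) c := by
  simp [quad, lin, pderiv_X_of_ne (show (0 : Fin 2) ≠ 1 by decide),
    show (C 2 : MvPolynomial (Fin 2) R) = 2 from map_ofNat C 2]
  ring

lemma lin_inj {p q t p' q' t' : R} : lin p q t = lin p' q' t' ↔ p = p' ∧ q = q' ∧ t = t' := by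
  constructor
  · intro h
    rw [lin_eq_quad, lin_eq_quad] at h
    refine ⟨?_, ?_, ?_⟩
    · simpa [coeff_quad] using congrArg (coeff (expo 1 0)) h
    · simpa [coeff_quad] using congrArg (coeff (expo 0 1)) h
    · simpa [coeff_quad] using congrArg (coeff (expo 0 0)) h
  · rintro ⟨rfl, rfl, rfl⟩; rfl

end Polynomials

/-! ### Fields with a given rational first integral. -/

section FirstIntegrals

variable {K : Type*} [Field K]

lemma totalDegree_pderiv_lt {F : Poly K} (i : Fin 2) (h : pderiv i F ≠ 0) :
    (pderiv i F).totalDegree < F.totalDegree := by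
  have key : ∀ m ∈ (pderiv i F).support, m.degree < F.totalDegree := by
    intro m hm
    rw [mem_support_iff, coeff_pderiv] at hm
    have := le_totalDegree (mem_support_iff.2 (left_ne_zero_of_mul hm))
    change Finsupp.degree (m + Finsupp.single i 1) ≤ _ at this
    rw [map_add, Finsupp.degree_single] at this
    omega
  obtain ⟨m, hm⟩ := Finset.nonempty_iff_ne_empty.2 (mt support_eq_empty.1 h)
  exact (Finset.sup_lt_iff (lt_of_le_of_lt (Nat.zero_le _) (key m hm))).2 key

/-- Two fields with a common first integral are parallel at every point; coprimality makes the
factor of proportionality a polynomial. -/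
lemma exists_mul_eq_of_isRelPrime {V W : VField K} (hV : IsRelPrime (V 0) (V 1))
    (h : V 0 * W 1 = V 1 * W 0) : ∃ g : Poly K, ∀ i, W i = g * V i := by
  obtain ⟨g, hg⟩ : V 0 ∣ W 0 := hV.dvd_of_dvd_mul_left (Dvd.intro _ h)
  obtain ⟨g', hg'⟩ : V 1 ∣ W 1 := hV.symm.dvd_of_dvd_mul_left (Dvd.intro _ h.symm)
  rcases eq_or_ne (V 0) 0 with h0 | h0
  · refine ⟨g', fun i => ?_⟩
    fin_cases i
    · simpa [h0] using hg
    · simp [hg', mul_comm]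
  · refine ⟨g, fun i => ?_⟩
    fin_cases i
    · simp [hg, mul_comm]
    · refine mul_left_cancel₀ h0 ?_
      simp only [Fin.mk_one]
      rw [h, hg]; ring

variable [CharZero K]

lemma eq_C_of_pderiv_eq_zero {F : Poly K} (h : ∀ i, pderiv i F = 0) : ∃ c, F = C c := by
  refine ⟨coeff 0 F, ?_⟩
  ext m
  rw [coeff_C]
  split_ifs with hm
  · rw [hm]
  · obtain ⟨i, hi⟩ : ∃ i, m i ≠ 0 := by
      by_contra! hm'
      exact hm (Finsupp.ext fun i => (hm' i).symm)
    have h1 := congrArg (coeff (m - Finsupp.single i 1)) (h i)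
    have hle : Finsupp.single i 1 ≤ m := by
      rw [Finsupp.single_le_iff]; omega
    rw [coeff_pderiv, tsub_add_cancel_of_le hle, coeff_zero] at h1
    exact (mul_eq_zero.1 h1).resolve_right (Nat.cast_add_one_ne_zero _)

/-- A fraction with zero differential is constant. In lowest terms the denominator divides its own
partial derivatives, which have smaller degree and so vanish; then those of the numerator vanish
too, and characteristic zero leaves only constants. -/
lemma exists_C_mul_of_mul_pderiv_eq {F G : Poly K} (hG : G ≠ 0)
    (h : ∀ i, G * pderiv i F = F * pderiv i G) : ∃ c : K, F = C c * G := by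
  obtain ⟨G', F', d, hrel, rfl, rfl⟩ := UniqueFactorizationMonoid.exists_reduced_factors G hG F
  have hd : d ≠ 0 := left_ne_zero_of_mul hG
  have hG' : G' ≠ 0 := right_ne_zero_of_mul hG
  have h' : ∀ i, G' * pderiv i F' = F' * pderiv i G' := by
    intro i
    have := h i
    simp only [pderiv_mul] at this
    refine mul_left_cancel₀ (pow_ne_zero 2 hd) ?_
    linear_combination this
  have hdG : ∀ i, pderiv i G' = 0 := by
    intro i
    by_contra hne
    have hdvd : G' ∣ pderiv i G' :=
      hrel.dvd_of_dvd_mul_left (Dvd.intro _ (h' i))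
    obtain ⟨e, he⟩ := hdvd
    have hlt := totalDegree_pderiv_lt i hne
    have he0 : e ≠ 0 := by rintro rfl; exact hne (by simpa using he)
    rw [he, totalDegree_mul_of_isDomain hG' he0] at hlt
    omega
  have hdF : ∀ i, pderiv i F' = 0 := by
    intro i
    have := h' i
    rw [hdG, mul_zero] at this
    exact (mul_eq_zero.1 this).resolve_left hG'
  obtain ⟨g, rfl⟩ := eq_C_of_pderiv_eq_zero hdG
  obtain ⟨f, rfl⟩ := eq_C_of_pderiv_eq_zero hdF
  have hg : g ≠ 0 := by rintro rfl; exact hG' (map_zero _)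
  refine ⟨f / g, ?_⟩
  rw [show d * C f = C (f / g * g) * d by rw [div_mul_cancel₀ _ hg, mul_comm], map_mul]
  ring

lemma inducedField_ne_zero {P₂ P₃ : Poly K} (h₃ : P₃ ≠ 0)
    (h : ¬ ∃ c : K, P₂ ^ 3 = C c * P₃ ^ 2) : inducedField P₂ P₃ ≠ 0 := by
  intro h0
  refine h (exists_C_mul_of_mul_pderiv_eq (pow_ne_zero 2 h₃) fun i => ?_)
  have e1 : 3 * P₃ * pderiv 1 P₂ - 2 * P₂ * pderiv 1 P₃ = 0 := congrFun h0 0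
  have e0 : -(3 * P₃ * pderiv 0 P₂ - 2 * P₂ * pderiv 0 P₃) = 0 := congrFun h0 1
  rw [pderiv_pow, pderiv_pow]
  push_cast
  fin_cases i
  · simp only [Fin.zero_eta]
    linear_combination -(P₃ * P₂ ^ 2) * e0
  · simp only [Fin.mk_one]
    linear_combination (P₃ * P₂ ^ 2) * e1

lemma HasRationalFirstIntegral.mul_eq {P₂ P₃ : Poly K} {V : VField K}
    (h : HasRationalFirstIntegral V (P₂ ^ 3) (P₃ ^ 2)) :
    V 0 * inducedField P₂ P₃ 1 = V 1 * inducedField P₂ P₃ 0 ∧ inducedField P₂ P₃ ≠ 0 := by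
  obtain ⟨h1, h2, h3⟩ := h
  have h₃ : P₃ ≠ 0 := by rintro rfl; simp at h1
  have h₂ : P₂ ≠ 0 := by rintro rfl; exact h2 ⟨0, by simp⟩
  refine ⟨?_, inducedField_ne_zero h₃ h2⟩
  refine mul_left_cancel₀ (mul_ne_zero (pow_ne_zero 2 h₂) h₃) ?_
  simp only [lieDeriv, pderiv_pow] at h3
  push_cast at h3
  simp only [inducedField, Matrix.cons_val_zero, Matrix.cons_val_one]
  linear_combination -h3

lemma HasRationalFirstIntegral.exists_mul_eq {P₂ P₃ : Poly K} {V : VField K}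
    (h : HasRationalFirstIntegral V (P₂ ^ 3) (P₃ ^ 2)) (hV : IsRelPrime (V 0) (V 1)) :
    ∃ g : Poly K, g ≠ 0 ∧ ∀ i, inducedField P₂ P₃ i = g * V i := by
  obtain ⟨h1, h2⟩ := h.mul_eq
  obtain ⟨g, hg⟩ := exists_mul_eq_of_isRelPrime hV h1
  refine ⟨g, ?_, hg⟩
  rintro rfl
  exact h2 (funext fun i => by simp [hg])

lemma HasRationalFirstIntegral.degree_le {P₂ P₃ : Poly K} {V : VField K} {n : ℕ}
    (h : HasRationalFirstIntegral V (P₂ ^ 3) (P₃ ^ 2)) (hV : IsRelPrime (V 0) (V 1))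
    (hd : inducedField P₂ P₃ ∈ fieldsOfDegreeLE K n) : V ∈ fieldsOfDegreeLE K n := by
  obtain ⟨g, hg, hi⟩ := h.exists_mul_eq hV
  have key : ∀ i, (V i).totalDegree ≤ (inducedField P₂ P₃ i).totalDegree := by
    intro i
    rcases eq_or_ne (V i) 0 with h0 | h0
    · simp [h0]
    · rw [hi, totalDegree_mul_of_isDomain hg h0]
      omega
  exact (max_le_max (key 0) (key 1)).trans hd

end FirstIntegrals

/-! ### The shape of special pairs: l² + 2m + a and l³ + 3lm + n. -/

section SpecialPairs

section Defs
variable {R : Type*} [CommRing R]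

/-- The polynomial `l² + 2 m + a`. -/
def conic (l m : MvPolynomial (Fin 2) R) (a : R) : MvPolynomial (Fin 2) R :=
  l ^ 2 + 2 * m + C a

/-- The polynomial `l³ + 3 l m + n`. -/
def cubic (l m n : MvPolynomial (Fin 2) R) : MvPolynomial (Fin 2) R :=
  l ^ 3 + 3 * l * m + n

/-- All terms of degree three and four cancel: for l, m, n of degree at most one and D a partial
derivative, the derivatives on the right are constants and each bracket has degree at most two. -/
lemma three_mul_cubic_mul_sub (D : Derivation R (MvPolynomial (Fin 2) R) (MvPolynomial (Fin 2) R))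
    (l m n : MvPolynomial (Fin 2) R) (a : R) :
    3 * cubic l m n * D (conic l m a) - 2 * conic l m a * D (cubic l m n) =
      6 * (l * m + n - C a * l) * D m + 6 * (n * l - 2 * m ^ 2 - C a * l ^ 2 - C a * m) * D l
        - 2 * (l ^ 2 + 2 * m + C a) * D n := by
  have h3 : D (3 : MvPolynomial (Fin 2) R) = 0 := by
    simpa using D.map_natCast 3
  have h2 : D (2 : MvPolynomial (Fin 2) R) = 0 := by
    simpa using D.map_natCast 2
  have hC : D (C a) = 0 := D.map_algebraMap a
  simp only [conic, cubic, map_add, Derivation.leibniz, Derivation.leibniz_pow, h3, h2, hC,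
    smul_eq_mul, nsmul_eq_mul]
  push_cast
  ring

end Defs

variable {K : Type*} [Field K]

lemma totalDegree_mul_le_two {F G : Poly K} (hF : F.totalDegree ≤ 1) (hG : G.totalDegree ≤ 1) :
    (F * G).totalDegree ≤ 2 :=
  (totalDegree_mul _ _).trans (by omega)

lemma totalDegree_C_mul_le {F : Poly K} {n : ℕ} (c : K) (hF : F.totalDegree ≤ n) :
    (C c * F).totalDegree ≤ n :=
  (totalDegree_mul _ _).trans (by simpa using hF)

lemma totalDegree_add_le {F G : Poly K} {n : ℕ} (hF : F.totalDegree ≤ n)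
    (hG : G.totalDegree ≤ n) : (F + G).totalDegree ≤ n :=
  (totalDegree_add _ _).trans (max_le hF hG)

lemma totalDegree_sub_le {F G : Poly K} {n : ℕ} (hF : F.totalDegree ≤ n)
    (hG : G.totalDegree ≤ n) : (F - G).totalDegree ≤ n :=
  (totalDegree_sub _ _).trans (max_le hF hG)

lemma mem_fieldsOfDegreeLE_iff {V : VField K} {n : ℕ} :
    V ∈ fieldsOfDegreeLE K n ↔ ∀ i, (V i).totalDegree ≤ n := by
  simp [fieldsOfDegreeLE, VField.degree, Fin.forall_fin_two]

lemma inducedField_mem_of_forall {P₂ P₃ : Poly K} {n : ℕ}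
    (h : ∀ i, (3 * P₃ * pderiv i P₂ - 2 * P₂ * pderiv i P₃).totalDegree ≤ n) :
    inducedField P₂ P₃ ∈ fieldsOfDegreeLE K n := by
  rw [mem_fieldsOfDegreeLE_iff]
  intro i
  fin_cases i
  · exact h 1
  · simp only [inducedField, Fin.mk_one, Matrix.cons_val_one, Matrix.cons_val_zero, totalDegree_neg]
    exact h 0

lemma exists_pderiv_lin (i : Fin 2) (p q t : K) : ∃ c, pderiv i (lin p q t) = C c := by
  fin_cases i
  · exact ⟨p, by simp⟩
  · exact ⟨q, by simp⟩

lemma inducedField_conic_cubic_mem (p q t r s u b d e a : K) :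
    inducedField (conic (lin p q t) (lin r s u) a) (cubic (lin p q t) (lin r s u) (lin b d e)) ∈
      fieldsOfDegreeLE K 2 := by
  refine inducedField_mem_of_forall fun i => ?_
  rw [three_mul_cubic_mul_sub]
  obtain ⟨c₁, h₁⟩ := exists_pderiv_lin i p q t
  obtain ⟨c₂, h₂⟩ := exists_pderiv_lin i r s u
  obtain ⟨c₃, h₃⟩ := exists_pderiv_lin i b d e
  rw [h₁, h₂, h₃]
  have hl := totalDegree_lin_le p q t
  have hm := totalDegree_lin_le r s u
  have hn := totalDegree_lin_le b d e
  generalize lin p q t = l at *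
  generalize lin r s u = m at *
  generalize lin b d e = n at *
  have e6 : (6 : Poly K) = C 6 := (map_ofNat C 6).symm
  have e2 : (2 : Poly K) = C 2 := (map_ofNat C 2).symm
  have hlm : (l * m + n - C a * l).totalDegree ≤ 2 :=
    totalDegree_sub_le (totalDegree_add_le (totalDegree_mul_le_two hl hm) (hn.trans one_le_two))
      (totalDegree_C_mul_le _ (hl.trans one_le_two))
  have hnl : (n * l - C 2 * (m * m) - C a * (l * l) - C a * m).totalDegree ≤ 2 :=
    totalDegree_sub_le (totalDegree_sub_le (totalDegree_sub_le (totalDegree_mul_le_two hn hl)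
      (totalDegree_C_mul_le _ (totalDegree_mul_le_two hm hm)))
      (totalDegree_C_mul_le _ (totalDegree_mul_le_two hl hl)))
      (totalDegree_C_mul_le _ (hm.trans one_le_two))
  have hll : (l * l + C 2 * m + C a).totalDegree ≤ 2 :=
    totalDegree_add_le (totalDegree_add_le (totalDegree_mul_le_two hl hl)
      (totalDegree_C_mul_le _ (hm.trans one_le_two))) (by simp)
  have heq : 6 * (l * m + n - C a * l) * C c₂ +
      6 * (n * l - 2 * m ^ 2 - C a * l ^ 2 - C a * m) * C c₁ - 2 * (l ^ 2 + 2 * m + C a) * C c₃ =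
      C (6 * c₂) * (l * m + n - C a * l) +
      C (6 * c₁) * (n * l - C 2 * (m * m) - C a * (l * l) - C a * m)
      - C (2 * c₃) * (l * l + C 2 * m + C a) := by
    simp only [map_mul, map_ofNat]; ring
  rw [heq]
  exact totalDegree_sub_le (totalDegree_add_le (totalDegree_C_mul_le _ hlm)
    (totalDegree_C_mul_le _ hnl)) (totalDegree_C_mul_le _ hll)

lemma homogeneousComponent_eq_ite {F : Poly K} {m : ℕ} (h : F.IsHomogeneous m) (n : ℕ) :
    homogeneousComponent n F = if m = n then F else 0 :=
  (homogeneousComponent_of_mem h).trans (by simp [eq_comm])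

lemma lin_eq_add_C (p q t : K) : lin p q t = lin p q 0 + C t := by simp [lin]

lemma lin_ne_zero {p q : K} (h : p ≠ 0 ∨ q ≠ 0) (t : K) : lin p q t ≠ 0 := by
  intro h0
  rw [show (0 : Poly K) = lin 0 0 0 by simp [lin], lin_inj] at h0
  tauto

lemma homogeneousComponent_conic (p q r s a : K) (n : ℕ) :
    homogeneousComponent n (conic (lin p q 0) (lin r s 0) a) =
      (if 2 = n then lin p q 0 ^ 2 else 0) + (if 1 = n then 2 * lin r s 0 else 0) +
        (if 0 = n then C a else 0) := by
  have h2 : (2 : Poly K) = C 2 := (map_ofNat C 2).symm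
  rw [conic, map_add, map_add, homogeneousComponent_eq_ite ((isHomogeneous_lin p q).pow 2),
    h2, homogeneousComponent_eq_ite ((isHomogeneous_lin r s).C_mul 2),
    homogeneousComponent_eq_ite (isHomogeneous_C (Fin 2) a)]

lemma homogeneousComponent_cubic (p q r s b d e : K) (n : ℕ) :
    homogeneousComponent n (cubic (lin p q 0) (lin r s 0) (lin b d e)) =
      (if 3 = n then lin p q 0 ^ 3 else 0) + (if 2 = n then 3 * lin p q 0 * lin r s 0 else 0) +
        ((if 1 = n then lin b d 0 else 0) + (if 0 = n then C e else 0)) := by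
  have h3 : (3 : Poly K) = C 3 := (map_ofNat C 3).symm
  rw [cubic, map_add, map_add, homogeneousComponent_eq_ite ((isHomogeneous_lin p q).pow 3),
    h3, homogeneousComponent_eq_ite (((isHomogeneous_lin p q).C_mul 3).mul (isHomogeneous_lin r s)),
    lin_eq_add_C b, map_add, homogeneousComponent_eq_ite (isHomogeneous_lin b d),
    homogeneousComponent_eq_ite (isHomogeneous_C (Fin 2) e)]

lemma totalDegree_eq_of_homogeneousComponent_ne_zero {F : Poly K} {n : ℕ}
    (h : F.totalDegree ≤ n) (h' : homogeneousComponent n F ≠ 0) : F.totalDegree = n := by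
  by_contra hne
  exact h' (homogeneousComponent_eq_zero _ _ (lt_of_le_of_ne h hne))

lemma isSpecialPair_conic_cubic_zero {p q : K} (hpq : p ≠ 0 ∨ q ≠ 0) (r s a b d e : K) :
    IsSpecialPair (conic (lin p q 0) (lin r s 0) a)
      (cubic (lin p q 0) (lin r s 0) (lin b d e)) := by
  have hl := lin_ne_zero hpq 0
  have h1 : (lin p q 0).totalDegree ≤ 1 := totalDegree_lin_le _ _ _
  have h2 : (lin r s 0).totalDegree ≤ 1 := totalDegree_lin_le _ _ _
  have h3 : (lin b d e).totalDegree ≤ 1 := totalDegree_lin_le _ _ _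
  have e2 : (2 : Poly K) = C 2 := (map_ofNat C 2).symm
  have e3 : (3 : Poly K) = C 3 := (map_ofNat C 3).symm
  refine ⟨totalDegree_eq_of_homogeneousComponent_ne_zero ?_ ?_,
    totalDegree_eq_of_homogeneousComponent_ne_zero ?_ ?_, ?_, ?_⟩
  · rw [conic, e2]
    refine totalDegree_add_le (totalDegree_add_le ?_ ?_) (by simp)
    · exact (totalDegree_pow _ _).trans (by omega)
    · exact totalDegree_C_mul_le _ (h2.trans one_le_two)
  · rw [homogeneousComponent_conic]
    simpa using hl
  · rw [cubic, e3, mul_assoc]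
    refine totalDegree_add_le (totalDegree_add_le ?_ ?_) (by omega)
    · exact (totalDegree_pow _ _).trans (by omega)
    · exact totalDegree_C_mul_le _ ((totalDegree_mul_le_two h1 h2).trans (by norm_num))
  · rw [homogeneousComponent_cubic]
    simpa using hl
  · rw [homogeneousComponent_cubic, homogeneousComponent_conic]
    simp; ring
  · simp only [homogeneousComponent_cubic, homogeneousComponent_conic]
    simp; ring

lemma isSpecialPair_conic_cubic {p q : K} (hpq : p ≠ 0 ∨ q ≠ 0) (t r s u a b d e : K) :
    IsSpecialPair (conic (lin p q t) (lin r s u) a)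
      (cubic (lin p q t) (lin r s u) (lin b d e)) := by
  -- In terms of the linear parts l₀, m₀, the square of l₀ + t contributes 2 t l₀, so m₀ becomes m₀
  -- + t l₀. The same replacement absorbs 3 t l₀² in the cubic, and what remains has degree at most
  -- one and goes into n.
  have h := isSpecialPair_conic_cubic_zero hpq (r + t * p) (s + t * q) (a + t ^ 2 + 2 * u)
    (b + 3 * t * r + 3 * u * p + 3 * t ^ 2 * p) (d + 3 * t * s + 3 * u * q + 3 * t ^ 2 * q)
    (e + t ^ 3 + 3 * t * u)
  convert h using 1
  · simp only [conic, lin, map_add, map_mul, map_pow, map_ofNat, map_zero]; ring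
  · simp only [cubic, lin, map_add, map_mul, map_pow, map_ofNat, map_zero]; ring

/-- F² divides G², so G = F l by unique factorization, and cancelling F² in F³ = F² l² gives F = l².
No root of a constant is needed, so this works over any field. -/
lemma exists_sq_eq_of_cube_eq_sq {F G : Poly K} (hF : F.IsHomogeneous 2) (hF0 : F ≠ 0)
    (h : F ^ 3 = G ^ 2) :
    ∃ p q : K, (p ≠ 0 ∨ q ≠ 0) ∧ F = lin p q 0 ^ 2 ∧ G = lin p q 0 ^ 3 := by
  obtain ⟨l, rfl⟩ : F ∣ G := by
    rw [← UniqueFactorizationMonoid.pow_dvd_pow_iff_dvd (n := 2) two_ne_zero]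
    exact ⟨F, by rw [← h]; ring⟩
  have hl : F = l ^ 2 := by
    refine mul_left_cancel₀ (pow_ne_zero 2 hF0) ?_
    linear_combination h
  have hl0 : l ≠ 0 := by rintro rfl; exact hF0 (by simpa using hl)
  have hdeg : l.totalDegree = 1 := by
    have := hF.totalDegree hF0
    rw [hl, pow_two, totalDegree_mul_of_isDomain hl0 hl0] at this
    omega
  have hlin := eq_lin hdeg.le
  set p := coeff (expo 1 0) l
  set q := coeff (expo 0 1) l
  have ht : coeff (expo 0 0) l = 0 := by
    have h1 : coeff (expo 0 0) F = 0 := hF.coeff_eq_zero (by simp [degree_expo])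
    have h0 : expo 0 0 = 0 := by simp [expo]
    rw [hl, h0, ← constantCoeff_eq, map_pow] at h1
    rw [h0, ← constantCoeff_eq]
    exact pow_eq_zero_iff two_ne_zero |>.1 h1
  rw [ht] at hlin
  refine ⟨p, q, ?_, by rw [hl, hlin], ?_⟩
  · by_contra! hpq
    rw [hpq.1, hpq.2] at hlin
    exact hl0 (by rw [hlin]; simp [lin])
  · rw [← hlin, hl]; ring

lemma eq_sum_homogeneousComponent {F : Poly K} {n : ℕ} (h : F.totalDegree ≤ n) :
    F = ∑ i ∈ Finset.range (n + 1), homogeneousComponent i F := by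
  conv_lhs => rw [← sum_homogeneousComponent F]
  refine Finset.sum_subset (Finset.range_mono (by omega)) fun i _ hi => ?_
  exact homogeneousComponent_eq_zero _ _ (by simpa using hi)

lemma exists_homogeneousComponent_one (F : Poly K) :
    ∃ r s : K, homogeneousComponent 1 F = lin r s 0 :=
  ⟨_, _, eq_lin_of_isHomogeneous (homogeneousComponent_isHomogeneous 1 F)⟩

lemma totalDegree_le_of_homogeneousComponent_eq_zero {F : Poly K} {n : ℕ}
    (h : F.totalDegree ≤ n + 1) (h' : homogeneousComponent (n + 1) F = 0) :
    F.totalDegree ≤ n := by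
  rw [eq_sum_homogeneousComponent h, Finset.sum_range_succ, h', add_zero]
  refine totalDegree_finsetSum_le fun i hi => ?_
  have := (homogeneousComponent_isHomogeneous i F).totalDegree_le
  have := Finset.mem_range.1 hi
  omega

variable [CharZero K]

lemma eq_conic_cubic_of_components {P₂ P₃ : Poly K} {p q : K} (h₂ : P₂.totalDegree ≤ 2)
    (h₃ : P₃.totalDegree ≤ 3) (ha₂ : homogeneousComponent 2 P₂ = lin p q 0 ^ 2)
    (hb₃ : homogeneousComponent 3 P₃ = lin p q 0 ^ 3)
    (hb₂ : 2 * homogeneousComponent 2 P₃ = 3 * lin p q 0 * homogeneousComponent 1 P₂) :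
    ∃ r s a b d e : K, P₂ = conic (lin p q 0) (lin r s 0) a ∧
      P₃ = cubic (lin p q 0) (lin r s 0) (lin b d e) := by
  obtain ⟨r, s, hrs⟩ := exists_homogeneousComponent_one P₂
  obtain ⟨b, d, hbd⟩ := exists_homogeneousComponent_one P₃
  have hrs' : lin r s 0 = 2 * lin (r / 2) (s / 2) 0 := by
    rw [show (2 : Poly K) = C 2 from (map_ofNat C 2).symm]
    conv_lhs => rw [show r = 2 * (r / 2) by ring, show s = 2 * (s / 2) by ring]
    simp only [lin, map_mul, map_zero]; ring
  refine ⟨r / 2, s / 2, coeff 0 P₂, b, d, coeff 0 P₃, ?_, ?_⟩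
  · conv_lhs => rw [eq_sum_homogeneousComponent h₂]
    simp only [Finset.sum_range_succ, Finset.sum_range_zero, ha₂, hrs, homogeneousComponent_zero]
    rw [conic, hrs']; ring
  · have hb₂' : homogeneousComponent 2 P₃ = 3 * lin p q 0 * lin (r / 2) (s / 2) 0 := by
      refine mul_left_cancel₀ (two_ne_zero (α := Poly K)) ?_
      rw [hb₂, hrs, hrs']; ring
    conv_lhs => rw [eq_sum_homogeneousComponent h₃]
    simp only [Finset.sum_range_succ, Finset.sum_range_zero, hb₃, hb₂', hbd,
      homogeneousComponent_zero]
    rw [cubic, lin_eq_add_C b d (coeff 0 P₃)]; ring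

lemma TopRelations.exists_eq {P₂ P₃ : Poly K} (h : TopRelations P₂ P₃) (h₂ : P₂.totalDegree ≤ 2)
    (h₃ : P₃.totalDegree ≤ 3) (h0 : homogeneousComponent 2 P₂ ≠ 0) :
    ∃ p q r s a b d e : K, (p ≠ 0 ∨ q ≠ 0) ∧ P₂ = conic (lin p q 0) (lin r s 0) a ∧
      P₃ = cubic (lin p q 0) (lin r s 0) (lin b d e) := by
  obtain ⟨h1, h2⟩ := h
  obtain ⟨p, q, hpq, ha, hb⟩ := exists_sq_eq_of_cube_eq_sq
    (homogeneousComponent_isHomogeneous 2 P₂) h0 h1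
  obtain ⟨r, s, a, b, d, e, h⟩ := eq_conic_cubic_of_components h₂ h₃ ha hb (by
    rw [ha, hb] at h2
    refine mul_left_cancel₀ (pow_ne_zero 3 (lin_ne_zero hpq 0)) ?_
    linear_combination -h2)
  exact ⟨p, q, r, s, a, b, d, e, hpq, h⟩

/-- If a₂ = 0 then b₃ = 0 as well; both degrees drop by one and the bound is just a count of
degrees. Otherwise the pair has the conic–cubic shape. -/
lemma inducedField_mem_of_topRelations {P₂ P₃ : Poly K} (h₂ : P₂.totalDegree ≤ 2)
    (h₃ : P₃.totalDegree ≤ 3) (h : TopRelations P₂ P₃) :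
    inducedField P₂ P₃ ∈ fieldsOfDegreeLE K 2 := by
  by_cases h0 : homogeneousComponent 2 P₂ = 0
  · have h0' : homogeneousComponent 3 P₃ = 0 := by
      have := h.1
      rw [h0] at this
      simpa using this.symm
    have h₂' := totalDegree_le_of_homogeneousComponent_eq_zero h₂ h0
    have h₃' := totalDegree_le_of_homogeneousComponent_eq_zero h₃ h0'
    refine inducedField_mem_of_forall fun i => ?_
    have e2 : (2 : Poly K) = C 2 := (map_ofNat C 2).symm
    have e3 : (3 : Poly K) = C 3 := (map_ofNat C 3).symm
    have d2 : (pderiv i P₂).totalDegree ≤ 0 := by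
      by_cases hd : pderiv i P₂ = 0
      · simp [hd]
      · have := totalDegree_pderiv_lt i hd
        omega
    have d3 : (pderiv i P₃).totalDegree ≤ 1 := by
      by_cases hd : pderiv i P₃ = 0
      · simp [hd]
      · have := totalDegree_pderiv_lt i hd
        omega
    rw [e2, e3, mul_assoc, mul_assoc]
    refine totalDegree_sub_le (totalDegree_C_mul_le _ ?_) (totalDegree_C_mul_le _ ?_)
    · exact (totalDegree_mul _ _).trans (by omega)
    · exact (totalDegree_mul _ _).trans (by omega)
  · obtain ⟨p, q, r, s, a, b, d, e, -, rfl, rfl⟩ := h.exists_eq h₂ h₃ h0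
    exact inducedField_conic_cubic_mem _ _ _ _ _ _ _ _ _ _

lemma IsSpecialPair.exists_eq {P₂ P₃ : Poly K} (h : IsSpecialPair P₂ P₃) :
    ∃ p q r s a b d e : K, (p ≠ 0 ∨ q ≠ 0) ∧ P₂ = conic (lin p q 0) (lin r s 0) a ∧
      P₃ = cubic (lin p q 0) (lin r s 0) (lin b d e) := by
  refine h.2.2.exists_eq h.1.le h.2.1.le fun h0 => ?_
  have := totalDegree_le_of_homogeneousComponent_eq_zero (n := 1) h.1.le h0
  have := h.1
  omega

end SpecialPairs

/-! ### Affine changes of variables. -/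

section Affine

variable {K : Type*} [Field K]

lemma affineSubst_X (M : Matrix (Fin 2) (Fin 2) K) (t : Fin 2 → K) (i : Fin 2) :
    affineSubst M t (X i) = lin (M i 0) (M i 1) (t i) := by
  simp [affineSubst, lin]

@[simp] lemma affineSubst_C (M : Matrix (Fin 2) (Fin 2) K) (t : Fin 2 → K) (a : K) :
    affineSubst M t (C a) = C a := by
  simp [affineSubst]

lemma affineSubst_lin (M : Matrix (Fin 2) (Fin 2) K) (t : Fin 2 → K) (p q u : K) :
    affineSubst M t (lin p q u) =
      lin (p * M 0 0 + q * M 1 0) (p * M 0 1 + q * M 1 1) (p * t 0 + q * t 1 + u) := by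
  rw [lin]
  simp only [map_add, map_mul, affineSubst_X, affineSubst_C, lin]
  ring

lemma affineSubst_affineSubst (M N : Matrix (Fin 2) (Fin 2) K) (t u : Fin 2 → K) (F : Poly K) :
    affineSubst M t (affineSubst N u F) = affineSubst (N * M) (N.mulVec t + u) F := by
  have : (affineSubst M t).comp (affineSubst N u) = affineSubst (N * M) (N.mulVec t + u) := by
    refine algHom_ext fun i => ?_
    rw [AlgHom.comp_apply, affineSubst_X, affineSubst_lin, affineSubst_X, Pi.add_apply,
      Matrix.mul_apply, Matrix.mul_apply, Matrix.mulVec, dotProduct]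
    simp only [Fin.sum_univ_two]
  exact DFunLike.congr_fun this F

lemma affineSubst_one_zero (F : Poly K) : affineSubst 1 0 F = F := by
  have : affineSubst (1 : Matrix (Fin 2) (Fin 2) K) 0 = AlgHom.id K _ := by
    refine algHom_ext fun i => ?_
    fin_cases i <;> simp [affineSubst_X, lin]
  rw [this]; rfl

/-- An invertible affine change of variables. -/
def affineEquiv {M : Matrix (Fin 2) (Fin 2) K} (hM : IsUnit M.det) (t : Fin 2 → K) :
    Poly K ≃ₐ[K] Poly K :=
  AlgEquiv.ofAlgHom (affineSubst M t) (affineSubst M⁻¹ (-(M⁻¹.mulVec t)))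
    (AlgHom.ext fun F => by
      rw [AlgHom.comp_apply, affineSubst_affineSubst, Matrix.nonsing_inv_mul _ hM,
        add_neg_cancel, affineSubst_one_zero, AlgHom.id_apply])
    (AlgHom.ext fun F => by
      rw [AlgHom.comp_apply, affineSubst_affineSubst, Matrix.mul_nonsing_inv _ hM,
        Matrix.mulVec_neg, Matrix.mulVec_mulVec, Matrix.mul_nonsing_inv _ hM, Matrix.one_mulVec,
        neg_add_cancel, affineSubst_one_zero, AlgHom.id_apply])

@[simp] lemma affineEquiv_apply {M : Matrix (Fin 2) (Fin 2) K} (hM : IsUnit M.det)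
    (t : Fin 2 → K) (F : Poly K) : affineEquiv hM t F = affineSubst M t F := rfl

@[simp] lemma affineEquiv_symm_apply {M : Matrix (Fin 2) (Fin 2) K} (hM : IsUnit M.det)
    (t : Fin 2 → K) (F : Poly K) :
    (affineEquiv hM t).symm F = affineSubst M⁻¹ (-(M⁻¹.mulVec t)) F := rfl

lemma totalDegree_affineSubst_le (M : Matrix (Fin 2) (Fin 2) K) (t : Fin 2 → K) (F : Poly K) :
    (affineSubst M t F).totalDegree ≤ F.totalDegree := by
  rw [affineSubst, aeval_def, eval₂_eq']
  refine totalDegree_finsetSum_le fun m hm => ?_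
  refine (totalDegree_mul _ _).trans ?_
  rw [algebraMap_eq, totalDegree_C, zero_add]
  refine (totalDegree_finsetProd _ _).trans (le_trans ?_ (le_totalDegree hm))
  rw [Finsupp.sum_fintype _ _ (fun _ => rfl)]
  refine Finset.sum_le_sum fun i _ => (totalDegree_pow _ _).trans ?_
  have := totalDegree_lin_le (M i 0) (M i 1) (t i)
  rw [lin] at this
  nlinarith

lemma totalDegree_affineSubst {M : Matrix (Fin 2) (Fin 2) K} (hM : IsUnit M.det) (t : Fin 2 → K)
    (F : Poly K) : (affineSubst M t F).totalDegree = F.totalDegree := by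
  refine le_antisymm (totalDegree_affineSubst_le M t F) ?_
  conv_lhs => rw [← (affineEquiv hM t).symm_apply_apply F]
  exact totalDegree_affineSubst_le _ _ _

lemma irreducible_affineSubst_iff {M : Matrix (Fin 2) (Fin 2) K} (hM : IsUnit M.det)
    (t : Fin 2 → K) {F : Poly K} : Irreducible (affineSubst M t F) ↔ Irreducible F :=
  MulEquiv.irreducible_iff (affineEquiv hM t)

lemma isRelPrime_affineSubst {M : Matrix (Fin 2) (Fin 2) K} (hM : IsUnit M.det)
    (t : Fin 2 → K) {F G : Poly K} (h : IsRelPrime F G) :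
    IsRelPrime (affineSubst M t F) (affineSubst M t G) := by
  intro d h1 h2
  have h1' := map_dvd (affineEquiv hM t).symm h1
  have h2' := map_dvd (affineEquiv hM t).symm h2
  rw [← affineEquiv_apply hM, AlgEquiv.symm_apply_apply] at h1' h2'
  exact (MulEquiv.isUnit_map (affineEquiv hM t).symm).1 (h h1' h2')

lemma map_affineSubst {L : Type*} [Field L] (φ : K →+* L) (M : Matrix (Fin 2) (Fin 2) K)
    (t : Fin 2 → K) (F : Poly K) :
    map φ (affineSubst M t F) = affineSubst (M.map φ) (φ ∘ t) (map φ F) := by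
  induction F using MvPolynomial.induction_on with
  | C a => simp
  | add F G hF hG => simp [hF, hG]
  | mul_X F i hF => simp [hF, affineSubst_X, lin]

lemma absolutelyIrreducible_affineSubst_iff {M : Matrix (Fin 2) (Fin 2) K} (hM : IsUnit M.det)
    (t : Fin 2 → K) {F : Poly K} :
    AbsolutelyIrreducible (affineSubst M t F) ↔ AbsolutelyIrreducible F := by
  rw [AbsolutelyIrreducible, map_affineSubst, irreducible_affineSubst_iff]
  · rfl
  · rw [← RingHom.mapMatrix_apply, ← RingHom.map_det]
    exact hM.map _

lemma pderiv_affineSubst (M : Matrix (Fin 2) (Fin 2) K) (t : Fin 2 → K) (j : Fin 2) (F : Poly K) :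
    pderiv j (affineSubst M t F) =
      C (M 0 j) * affineSubst M t (pderiv 0 F) + C (M 1 j) * affineSubst M t (pderiv 1 F) := by
  induction F using MvPolynomial.induction_on with
  | C a => simp
  | add F G hF hG => simp only [map_add, hF, hG]; ring
  | mul_X F i hF =>
    have h10 : pderiv 0 (X 1 : Poly K) = 0 := pderiv_X_of_ne (by decide)
    have h01 : pderiv 1 (X 0 : Poly K) = 0 := pderiv_X_of_ne (by decide)
    have hlin : ∀ i, pderiv j (lin (M i 0) (M i 1) (t i)) = C (M i j) := by
      intro i
      fin_cases j <;> simp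
    simp only [map_mul, pderiv_mul, affineSubst_X, hF, hlin]
    fin_cases i <;> simp [affineSubst_X, h10, h01] <;> ring

end Affine

/-! ### Irreducibility of the conic and of the cubic. -/

section Irreducibility

variable {K : Type*} [Field K]

lemma isUnit_C_of_ne_zero {a : K} (h : a ≠ 0) : IsUnit (C a : Poly K) :=
  (isUnit_iff_ne_zero.2 h).map C

lemma lin_not_isUnit {p q : K} (h : p ≠ 0 ∨ q ≠ 0) (t : K) : ¬ IsUnit (lin p q t) := by
  intro hu
  obtain ⟨c, -, hc⟩ := isUnit_iff_eq_C_of_isReduced.1 hu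
  rw [show (C c : Poly K) = lin 0 0 c by simp [lin], lin_inj] at hc
  tauto

lemma isUnit_det_of_ne {p q r s : K} (h : p * s - q * r ≠ 0) : IsUnit !![p, q; r, s].det := by
  rw [Matrix.det_fin_two_of]
  exact isUnit_iff_ne_zero.2 h

lemma affineSubst_conic_X (p q t r s u a : K) :
    affineSubst !![p, q; r, s] ![t, u] (conic (X 0) (X 1) a) =
      conic (lin p q t) (lin r s u) a := by
  rw [conic, map_add, map_add, map_mul, map_ofNat]
  simp [conic, affineSubst_X]

lemma affineSubst_cubic_X (p q t r s u e : K) :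
    affineSubst !![p, q; r, s] ![t, u] (cubic (X 0) (X 1) (C e)) =
      cubic (lin p q t) (lin r s u) (C e) := by
  rw [cubic, map_add, map_add, map_mul, map_mul, map_ofNat]
  simp [cubic, affineSubst_X]

/-- When m = k l the conic is a quadratic polynomial in the single form l, so it splits over an
algebraically closed field. -/
lemma not_irreducible_conic [IsAlgClosed K] {p q r s : K} (hpq : p ≠ 0 ∨ q ≠ 0)
    (h : p * s - q * r = 0) (a : K) : ¬ Irreducible (conic (lin p q 0) (lin r s 0) a) := by
  intro hirr
  obtain ⟨k, rfl, rfl⟩ : ∃ k, r = k * p ∧ s = k * q := by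
    by_cases hp : p = 0
    · have hq : q ≠ 0 := by tauto
      subst hp
      refine ⟨s / q, ?_, by field_simp⟩
      have : q * r = 0 := by linear_combination -h
      simpa [hq] using this
    · refine ⟨r / p, by field_simp, ?_⟩
      field_simp
      linear_combination h
  -- The roots of l² + 2kl + a are -k ± w with w² = k² - a.
  obtain ⟨w, hw⟩ := IsAlgClosed.exists_pow_nat_eq (k ^ 2 - a) (n := 2) (by norm_num)
  have hfac : conic (lin p q 0) (lin (k * p) (k * q) 0) a = lin p q (k - w) * lin p q (k + w) := by
    have hw' : (C w ^ 2 : Poly K) = C k ^ 2 - C a := by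
      rw [← C_pow, hw, C_sub, C_pow]
    simp only [conic, lin, map_mul, map_zero, map_sub, map_add]
    linear_combination hw'
  rcases hirr.isUnit_or_isUnit hfac with hu | hu
  · exact lin_not_isUnit hpq _ hu
  · exact lin_not_isUnit hpq _ hu

variable [CharZero K]

lemma irreducible_conic_X (a : K) : Irreducible (conic (X 0) (X 1) a : Poly K) := by
  have h := irreducible_mul_X_add (C 2 : Poly K) (X 0 ^ 2 + C a) 1
    (by simp) (by simp) (fun h => ?_) (IsUnit.isRelPrime_left ?_)
  · convert h using 1
    rw [conic, show (C 2 : Poly K) = 2 from map_ofNat C 2]; ring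
  · have := vars_add_subset _ _ h
    have h2 := vars_pow (X 0 : Poly K) 2
    simp [vars_C] at this
    simpa [vars_X] using h2 this
  · exact isUnit_C_of_ne_zero two_ne_zero

/-- The cubic is linear in y with coefficients 3x and x³ + e, which are coprime exactly because e ≠
0. -/
lemma irreducible_cubic_X {e : K} (he : e ≠ 0) :
    Irreducible (cubic (X 0) (X 1) (C e) : Poly K) := by
  have h := irreducible_mul_X_add (C 3 * X 0 : Poly K) (X 0 ^ 3 + C e) 1
    (by simp) (fun h => ?_) (fun h => ?_) ?_
  · convert h using 1
    rw [cubic, show (C 3 : Poly K) = 3 from map_ofNat C 3]; ring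
  · have := vars_mul _ _ h
    simp [vars_C, vars_X] at this
  · have := vars_add_subset _ _ h
    have h2 := vars_pow (X 0 : Poly K) 3
    simp [vars_C] at this
    simpa [vars_X] using h2 this
  · intro d h1 h2
    have h3 : d ∣ C 3 * C e := by
      have : (C 3 * C e : Poly K) = C 3 * (X 0 ^ 3 + C e) - X 0 ^ 2 * (C 3 * X 0) := by ring
      rw [this]
      exact dvd_sub (h2.mul_left _) (h1.mul_left _)
    refine isUnit_of_dvd_unit h3 ?_
    rw [← map_mul]
    exact isUnit_C_of_ne_zero (mul_ne_zero three_ne_zero he)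

lemma irreducible_conic {p q r s : K} (h : p * s - q * r ≠ 0) (t u a : K) :
    Irreducible (conic (lin p q t) (lin r s u) a) := by
  rw [← affineSubst_conic_X, irreducible_affineSubst_iff (isUnit_det_of_ne h)]
  exact irreducible_conic_X a

lemma irreducible_cubic {p q r s : K} (h : p * s - q * r ≠ 0) (t u : K) {e : K} (he : e ≠ 0) :
    Irreducible (cubic (lin p q t) (lin r s u) (C e)) := by
  rw [← affineSubst_cubic_X, irreducible_affineSubst_iff (isUnit_det_of_ne h)]
  exact irreducible_cubic_X he

/-- Without constant term, l³ + 3lm = l (l² + 3m). The cofactor is again a conic, with m rescaled by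
3/2, and so it is not a unit. -/
lemma not_irreducible_cubic_zero {p q r s : K} (h : p * s - q * r ≠ 0) (t u : K) :
    ¬ Irreducible (cubic (lin p q t) (lin r s u) 0) := by
  intro hirr
  have hpq : p ≠ 0 ∨ q ≠ 0 := by
    by_contra! h0
    simp [h0.1, h0.2] at h
  have hfac : cubic (lin p q t) (lin r s u) 0 = lin p q t *
      conic (lin p q t) (lin (3 / 2 * r) (3 / 2 * s) (3 / 2 * u)) 0 := by
    have h32 : (2 * C (3 / 2) : Poly K) = 3 := by
      rw [show (2 : Poly K) = C 2 from (map_ofNat C 2).symm, ← C_mul,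
        show (2 : K) * (3 / 2) = 3 by norm_num, map_ofNat]
    rw [cubic, conic, map_zero]
    simp only [lin, C_mul]
    linear_combination -(C p * X 0 + C q * X 1 + C t) * (C r * X 0 + C s * X 1 + C u) * h32
  rcases hirr.isUnit_or_isUnit hfac with hu | hu
  · exact lin_not_isUnit hpq t hu
  · refine (irreducible_conic (p := p) (q := q) (r := 3 / 2 * r) (s := 3 / 2 * s) ?_ _ _ _).not_isUnit hu
    have : p * (3 / 2 * s) - q * (3 / 2 * r) = 3 / 2 * (p * s - q * r) := by ring
    rw [this]
    exact mul_ne_zero (by norm_num) h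

end Irreducibility

/-! ### Reduction of the linear term of the cubic to a constant. -/

section NormalForm

variable {K : Type*} [Field K]

lemma map_lin {R S : Type*} [CommRing R] [CommRing S] (φ : R →+* S) (p q t : R) :
    map φ (lin p q t) = lin (φ p) (φ q) (φ t) := by
  simp [lin]

lemma map_conic {R S : Type*} [CommRing R] [CommRing S] (φ : R →+* S)
    (l m : MvPolynomial (Fin 2) R) (a : R) :
    map φ (conic l m a) = conic (map φ l) (map φ m) (φ a) := by
  simp [conic]

lemma map_cubic {R S : Type*} [CommRing R] [CommRing S] (φ : R →+* S)
    (l m n : MvPolynomial (Fin 2) R) :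
    map φ (cubic l m n) = cubic (map φ l) (map φ m) (map φ n) := by
  simp [cubic]

variable [CharZero K]

instance : CharZero (AlgebraicClosure K) := charZero_of_injective_algebraMap
  (algebraMap K (AlgebraicClosure K)).injective

lemma det_ne_zero_of_absolutelyIrreducible {p q r s a : K} (hpq : p ≠ 0 ∨ q ≠ 0)
    (h : AbsolutelyIrreducible (conic (lin p q 0) (lin r s 0) a)) : p * s - q * r ≠ 0 := by
  intro h0
  rw [AbsolutelyIrreducible, map_conic, map_lin, map_lin, map_zero] at h
  refine not_irreducible_conic ?_ ?_ _ h
  · simpa using hpq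
  · rw [← map_mul, ← map_mul, ← map_sub, h0, map_zero]

lemma absolutelyIrreducible_conic {p q r s : K} (h : p * s - q * r ≠ 0) (t u a : K) :
    AbsolutelyIrreducible (conic (lin p q t) (lin r s u) a) := by
  rw [AbsolutelyIrreducible, map_conic, map_lin, map_lin]
  refine irreducible_conic ?_ _ _ _
  rw [← map_mul, ← map_mul, ← map_sub]
  exact (map_ne_zero _).2 h

lemma absolutelyIrreducible_cubic_iff {p q r s : K} (h : p * s - q * r ≠ 0) (t u e : K) :
    AbsolutelyIrreducible (cubic (lin p q t) (lin r s u) (C e)) ↔ e ≠ 0 := by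
  have h' : algebraMap K (AlgebraicClosure K) p * algebraMap K (AlgebraicClosure K) s -
      algebraMap K (AlgebraicClosure K) q * algebraMap K (AlgebraicClosure K) r ≠ 0 := by
    rw [← map_mul, ← map_mul, ← map_sub]
    exact (map_ne_zero _).2 h
  rw [AbsolutelyIrreducible, map_cubic, map_lin, map_lin, map_C]
  constructor
  · rintro hirr rfl
    rw [map_zero, map_zero] at hirr
    exact not_irreducible_cubic_zero h' _ _ hirr
  · intro he
    exact irreducible_cubic h' _ _ (by simpa using he)

/-- Replacing (l, m) by (l + γ, m - γ l + β) changes the conic only by a constant, and changes the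
cubic by 3β l + 3γ m and a constant. As l and m have independent linear parts, this accounts for
every linear n. -/
lemma exists_normal_eq {p q r s : K} (h : p * s - q * r ≠ 0) (a b d e : K) :
    ∃ t r' s' u α δ : K, p * s' - q * r' ≠ 0 ∧
      conic (lin p q 0) (lin r s 0) a = conic (lin p q t) (lin r' s' u) α ∧
      cubic (lin p q 0) (lin r s 0) (lin b d e) = cubic (lin p q t) (lin r' s' u) (C δ) := by
  -- Cramer's rule for the linear part of n in the basis l, 3m.
  obtain ⟨β, γ, rfl, rfl⟩ : ∃ β γ : K, b = β * p + 3 * γ * r ∧ d = β * q + 3 * γ * s := by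
    have hi := mul_inv_cancel₀ h
    refine ⟨(b * s - d * r) * (p * s - q * r)⁻¹, (p * d - q * b) * (p * s - q * r)⁻¹ / 3, ?_, ?_⟩
    · linear_combination -b * hi
    · linear_combination -d * hi
  obtain ⟨β, rfl⟩ : ∃ β' : K, β = 3 * β' := ⟨β / 3, by ring⟩
  refine ⟨γ, r - γ * p, s - γ * q, γ ^ 2 + β - γ ^ 2, a + γ ^ 2 - 2 * (γ ^ 2 + β),
    e - γ ^ 3 - 3 * β * γ, ?_, ?_, ?_⟩
  · convert h using 1; ring
  · simp only [conic, lin, map_mul, map_zero, map_sub, map_add, map_pow, map_ofNat]; ring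
  · simp only [cubic, lin, map_mul, map_zero, map_sub, map_add, map_pow, map_ofNat]; ring

lemma IsSpecialPair.exists_normal_eq {P₂ P₃ : Poly K} (h : IsSpecialPair P₂ P₃)
    (h₂ : AbsolutelyIrreducible P₂) :
    ∃ p q t r s u α δ : K, p * s - q * r ≠ 0 ∧ P₂ = conic (lin p q t) (lin r s u) α ∧
      P₃ = cubic (lin p q t) (lin r s u) (C δ) := by
  obtain ⟨p, q, r, s, a, b, d, e, hpq, rfl, rfl⟩ := h.exists_eq
  obtain ⟨t, r', s', u, α, δ, h⟩ :=
    QuadCenter.exists_normal_eq (det_ne_zero_of_absolutelyIrreducible hpq h₂) a b d e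
  exact ⟨p, q, t, r', s', u, α, δ, h⟩

end NormalForm

/-! ### The field in the coordinates l, m; degree, coprimality, normal form of H. -/

section NormalFields

variable {K : Type*} [Field K]

lemma affineSubst_quad (p q t r s u a b c d e f : K) :
    affineSubst !![p, q; r, s] ![t, u] (quad a b c d e f) =
      C a + C b * lin p q t + C c * lin r s u + C d * lin p q t ^ 2 +
        C e * (lin p q t * lin r s u) + C f * lin r s u ^ 2 := by
  simp [quad, affineSubst_X]

lemma inducedField_normal (p q t r s u α δ : K) :
    inducedField (conic (lin p q t) (lin r s u) α) (cubic (lin p q t) (lin r s u) (C δ)) =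
      ![C s * (6 * affineSubst !![p, q; r, s] ![t, u] (quad δ (-α) 0 0 1 0)) +
          C q * (6 * affineSubst !![p, q; r, s] ![t, u] (quad 0 δ (-α) (-α) 0 (-2))),
        -(C r * (6 * affineSubst !![p, q; r, s] ![t, u] (quad δ (-α) 0 0 1 0)) +
          C p * (6 * affineSubst !![p, q; r, s] ![t, u] (quad 0 δ (-α) (-α) 0 (-2))))] := by
  rw [inducedField, three_mul_cubic_mul_sub, three_mul_cubic_mul_sub, affineSubst_quad,
    affineSubst_quad]
  simp only [pderiv_C, pderiv_zero_lin, pderiv_one_lin, map_zero, map_one, map_neg,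
    map_ofNat, mul_zero, sub_zero]
  generalize lin p q t = l
  generalize lin r s u = m
  refine funext (Fin.forall_fin_two.2 ⟨?_, ?_⟩) <;>
    simp only [Matrix.cons_val_zero, Matrix.cons_val_one] <;> ring

/-- The left side is the derivative of l along the field. Up to the factor 6 (p s - q r), the field
in the coordinates (l, m) is l' = lm - α l + δ, m' = -(δ l - α m - α l² - 2 m²). -/
lemma normal_combination_fst (p q t r s u α δ : K) :
    C p * inducedField (conic (lin p q t) (lin r s u) α) (cubic (lin p q t) (lin r s u) (C δ)) 0 +
      C q * inducedField (conic (lin p q t) (lin r s u) α)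
        (cubic (lin p q t) (lin r s u) (C δ)) 1 =
      C (6 * (p * s - q * r)) *
        affineSubst !![p, q; r, s] ![t, u] (quad δ (-α) 0 0 1 0) := by
  rw [inducedField_normal]
  simp only [Matrix.cons_val_zero, Matrix.cons_val_one, map_mul, map_sub, map_ofNat]
  ring

lemma normal_combination_snd (p q t r s u α δ : K) :
    C r * inducedField (conic (lin p q t) (lin r s u) α) (cubic (lin p q t) (lin r s u) (C δ)) 0 +
      C s * inducedField (conic (lin p q t) (lin r s u) α)
        (cubic (lin p q t) (lin r s u) (C δ)) 1 =
      C (-(6 * (p * s - q * r))) *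
        affineSubst !![p, q; r, s] ![t, u] (quad 0 δ (-α) (-α) 0 (-2)) := by
  rw [inducedField_normal]
  simp only [Matrix.cons_val_zero, Matrix.cons_val_one, map_mul, map_sub, map_neg, map_ofNat]
  ring

lemma totalDegree_map_algebraicClosure (F : Poly K) :
    (map (algebraMap K (AlgebraicClosure K)) F).totalDegree = F.totalDegree := by
  rw [totalDegree, totalDegree,
    support_map_of_injective _ (algebraMap K (AlgebraicClosure K)).injective]

lemma AbsolutelyIrreducible.not_dvd {P Q : Poly K} (hP : AbsolutelyIrreducible P)
    (hQ : AbsolutelyIrreducible Q) (h : P.totalDegree ≠ Q.totalDegree) :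
    ¬ map (algebraMap K (AlgebraicClosure K)) P ∣ map (algebraMap K (AlgebraicClosure K)) Q := by
  rintro ⟨g, hg⟩
  rcases hQ.isUnit_or_isUnit hg with hu | hu
  · exact hP.not_isUnit hu
  · obtain ⟨c, -, rfl⟩ := isUnit_iff_eq_C_of_isReduced.1 hu
    have := congrArg totalDegree hg
    rw [totalDegree_mul_of_isDomain hP.ne_zero hu.ne_zero, totalDegree_C, add_zero,
      totalDegree_map_algebraicClosure, totalDegree_map_algebraicClosure] at this
    exact h this.symm

lemma cube_ne_C_mul_sq {P₂ P₃ : Poly K} (h : P₂.totalDegree ≠ P₃.totalDegree)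
    (h₂ : AbsolutelyIrreducible P₂) (h₃ : AbsolutelyIrreducible P₃) :
    ¬ ∃ c : K, P₂ ^ 3 = C c * P₃ ^ 2 := by
  rintro ⟨c, hc⟩
  have hp : Prime (map (algebraMap K (AlgebraicClosure K)) P₂) := h₂.prime
  have hc' := congrArg (map (algebraMap K (AlgebraicClosure K))) hc
  rw [map_pow, map_mul, map_pow, map_C] at hc'
  rcases hp.dvd_or_dvd ((dvd_pow_self _ three_ne_zero).trans (dvd_of_eq hc'))
    with hd | hd
  · rcases eq_or_ne c 0 with rfl | hc0
    · rw [map_zero, map_zero, zero_mul] at hc'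
      exact hp.ne_zero (pow_eq_zero_iff three_ne_zero |>.1 hc')
    · exact hp.not_isUnit (isUnit_of_dvd_unit hd (isUnit_C_of_ne_zero ((map_ne_zero _).2 hc0)))
  · exact h₂.not_dvd h₃ h (hp.dvd_of_dvd_pow hd)

lemma normalP₂_eq_conic (α : K) : normalP₂ α = conic (lin 1 0 0) (lin 0 1 0) α := by
  simp [normalP₂, conic, lin]

lemma normalP₃_eq_cubic : normalP₃ K = cubic (lin 1 0 0) (lin 0 1 0) (C 1) := by
  simp [normalP₃, cubic, lin]

lemma C_eq_lin (e : K) : (C e : Poly K) = lin 0 0 e := by simp [lin]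

lemma AbsolutelyIrreducible.mul_C {F : Poly K} (h : AbsolutelyIrreducible F) {c : K}
    (hc : c ≠ 0) : AbsolutelyIrreducible (F * C c) := by
  rw [AbsolutelyIrreducible, map_mul, map_C]
  exact (irreducible_mul_isUnit (isUnit_C_of_ne_zero ((map_ne_zero _).2 hc))).2 h

lemma exists_eq_mul_C_of_dvd {F G : Poly K} (hF : F ≠ 0) (hG : G ≠ 0) (h : F ∣ G)
    (hd : G.totalDegree ≤ F.totalDegree) : ∃ c : K, c ≠ 0 ∧ G = F * C c := by
  obtain ⟨g, rfl⟩ := h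
  have hg := right_ne_zero_of_mul hG
  rw [totalDegree_mul_of_isDomain hF hg] at hd
  have hgC := totalDegree_eq_zero_iff_eq_C.1 (show g.totalDegree = 0 by omega)
  refine ⟨coeff 0 g, fun h0 => hg ?_, by rw [← hgC]⟩
  rw [hgC, h0, map_zero]

lemma cross_mul_of_ratioH_eq {P₂ P₃ Q₂ Q₃ : Poly K} (h₃ : P₃ ≠ 0) (h₃' : Q₃ ≠ 0)
    (h : ratioH P₂ P₃ = ratioH Q₂ Q₃) : P₂ ^ 3 * Q₃ ^ 2 = Q₂ ^ 3 * P₃ ^ 2 := by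
  have hinj := IsFractionRing.injective (Poly K) (FractionRing (Poly K))
  have hne : ∀ {F : Poly K}, F ≠ 0 → algebraMap (Poly K) (FractionRing (Poly K)) F ^ 2 ≠ 0 :=
    fun hF => pow_ne_zero 2 ((map_ne_zero_iff _ hinj).2 hF)
  rw [ratioH, ratioH, div_eq_div_iff (hne h₃) (hne h₃')] at h
  apply hinj
  simpa using h

/-- The weights 2 and 3 match the exponents 3 and 2 in H, so the factors c⁶ cancel. -/
lemma ratioH_C_mul {P₂ P₃ : Poly K} {c : K} (hc : c ≠ 0) :
    ratioH (C (c ^ 2) * P₂) (C (c ^ 3) * P₃) = ratioH P₂ P₃ := by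
  have hinj := IsFractionRing.injective (Poly K) (FractionRing (Poly K))
  have hne : algebraMap (Poly K) (FractionRing (Poly K)) (C c) ≠ 0 :=
    (map_ne_zero_iff _ hinj).2 (isUnit_C_of_ne_zero hc).ne_zero
  rw [ratioH, ratioH]
  simp only [map_mul, map_pow, mul_pow]
  rw [← pow_mul, ← pow_mul]
  exact mul_div_mul_left _ _ (pow_ne_zero 6 hne)

lemma affineSubst_diagonal_conic {c : K} (hc : c ≠ 0) (α : K) :
    affineSubst !![c, 0; 0, c ^ 2] 0 (conic (X 0) (X 1) α) =
      C (c ^ 2) * normalP₂ (α / c ^ 2) := by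
  have hα : (C α : Poly K) = C (c ^ 2) * C (α / c ^ 2) := by
    rw [← C_mul, mul_div_cancel₀ _ (pow_ne_zero 2 hc)]
  rw [conic, map_add, map_add, map_mul, map_ofNat, map_pow, affineSubst_C, affineSubst_X,
    affineSubst_X, normalP₂, hα]
  simp [lin]
  ring

lemma affineSubst_diagonal_cubic (c : K) :
    affineSubst !![c, 0; 0, c ^ 2] 0 (cubic (X 0) (X 1) (C (c ^ 3))) =
      C (c ^ 3) * normalP₃ K := by
  rw [cubic, map_add, map_add, map_mul, map_mul, map_ofNat, map_pow, affineSubst_C, affineSubst_X,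
    affineSubst_X, normalP₃]
  simp [lin]
  ring

variable [CharZero K]

lemma degree_inducedField_eq_two {P₂ P₃ : Poly K} (h : IsSpecialPair P₂ P₃)
    (h₂ : AbsolutelyIrreducible P₂) : VField.degree (inducedField P₂ P₃) = 2 := by
  refine le_antisymm (inducedField_mem_of_topRelations h.1.le h.2.1.le h.2.2) ?_
  by_contra! hlt
  obtain ⟨p, q, t, r, s, u, α, δ, hdet, rfl, rfl⟩ := h.exists_normal_eq h₂
  have hd : ∀ i, (inducedField (conic (lin p q t) (lin r s u) α)
      (cubic (lin p q t) (lin r s u) (C δ)) i).totalDegree ≤ 1 :=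
    mem_fieldsOfDegreeLE_iff.1 (Nat.le_of_lt_succ hlt)
  have h1 := totalDegree_add_le (totalDegree_C_mul_le p (hd 0)) (totalDegree_C_mul_le q (hd 1))
  rw [normal_combination_fst] at h1
  have hc : 6 * (p * s - q * r) ≠ 0 := mul_ne_zero (by norm_num) hdet
  have h2 := totalDegree_C_mul_le (6 * (p * s - q * r))⁻¹ h1
  rw [← mul_assoc, ← map_mul, inv_mul_cancel₀ hc, map_one, one_mul,
    totalDegree_affineSubst (isUnit_det_of_ne hdet)] at h2
  -- The product lm occurs in l' with coefficient one, so degree at most one is impossible.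
  have := totalDegree_le_iff.1 h2 1 1 (by norm_num)
  simp [coeff_quad] at this

/-- xy - αx + δ is linear in y with coprime coefficients, as δ ≠ 0, hence irreducible. If it divided
the other quadratic, the quotient would be constant, but only the other quadratic has a term in y².
-/
lemma isRelPrime_quad {δ : K} (hδ : δ ≠ 0) (α : K) :
    IsRelPrime (quad δ (-α) 0 0 1 0) (quad 0 δ (-α) (-α) 0 (-2)) := by
  have hirr : Irreducible (quad δ (-α) 0 0 1 0) := by
    have h := irreducible_mul_X_add (X 0 : Poly K) (C (-α) * X 0 + C δ) 1
      (X_ne_zero _) (by simp [vars_X]) (fun h => ?_) ?_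
    · convert h using 1
      simp [quad]; ring
    · have := vars_add_subset _ _ h
      rw [vars_C, Finset.union_empty] at this
      have := vars_mul _ _ this
      simp [vars_X] at this
    · intro d h1 h2
      refine isUnit_of_dvd_unit ?_ (isUnit_C_of_ne_zero hδ)
      have : (C δ : Poly K) = C (-α) * X 0 + C δ - C (-α) * X 0 := by ring
      rw [this]
      exact dvd_sub h2 (h1.mul_left _)
  rw [hirr.isRelPrime_iff_not_dvd]
  rintro ⟨g, hg⟩
  have hne : quad (0 : K) δ (-α) (-α) 0 (-2) ≠ 0 := by
    intro h0
    have := congrArg (coeff (expo 0 2)) h0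
    simp [coeff_quad] at this
  have hg0 : g ≠ 0 := by rintro rfl; exact hne (by simpa using hg)
  have h2 : 2 ≤ (quad δ (-α) 0 0 1 0).totalDegree := by
    by_contra! hlt
    have := totalDegree_le_iff.1 (Nat.le_of_lt_succ hlt) 1 1 (by norm_num)
    simp [coeff_quad] at this
  have hdeg := totalDegree_quad_le 0 δ (-α) (-α) 0 (-2)
  rw [hg, totalDegree_mul_of_isDomain hirr.ne_zero hg0] at hdeg
  obtain ⟨c, rfl⟩ : ∃ c, g = C c := ⟨_, totalDegree_eq_zero_iff_eq_C.1 (by omega)⟩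
  have := congrArg (coeff (expo 0 2)) hg
  rw [mul_comm, coeff_C_mul] at this
  simp [coeff_quad] at this

lemma isRelPrime_inducedField {P₂ P₃ : Poly K} (h : IsSpecialPair P₂ P₃)
    (h₂ : AbsolutelyIrreducible P₂) (h₃ : AbsolutelyIrreducible P₃) :
    IsRelPrime (inducedField P₂ P₃ 0) (inducedField P₂ P₃ 1) := by
  obtain ⟨p, q, t, r, s, u, α, δ, hdet, rfl, rfl⟩ := h.exists_normal_eq h₂
  rw [absolutelyIrreducible_cubic_iff hdet] at h₃
  have hc : 6 * (p * s - q * r) ≠ 0 := mul_ne_zero (by norm_num) hdet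
  intro D h0 h1
  refine isRelPrime_affineSubst (isUnit_det_of_ne hdet) ![t, u] (isRelPrime_quad h₃ α) ?_ ?_
  · have := dvd_add (h0.mul_left (C p)) (h1.mul_left (C q))
    rw [normal_combination_fst] at this
    exact (isUnit_C_of_ne_zero hc).dvd_mul_left.1 this
  · have := dvd_add (h0.mul_left (C r)) (h1.mul_left (C s))
    rw [normal_combination_snd] at this
    exact (isUnit_C_of_ne_zero (neg_ne_zero.2 hc)).dvd_mul_left.1 this

lemma hasRationalFirstIntegral_iff {P₂ P₃ : Poly K} (h : IsSpecialPair P₂ P₃)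
    (h₂ : AbsolutelyIrreducible P₂) (h₃ : AbsolutelyIrreducible P₃) (V : VField K) :
    HasRationalFirstIntegral V (P₂ ^ 3) (P₃ ^ 2) ↔
      ∃ g : Poly K, V = fun i => g * inducedField P₂ P₃ i := by
  constructor
  · intro hV
    obtain ⟨g, hg⟩ := exists_mul_eq_of_isRelPrime (V := inducedField P₂ P₃) (W := V)
      (isRelPrime_inducedField h h₂ h₃) (by linear_combination -hV.mul_eq.1)
    exact ⟨g, funext hg⟩
  · rintro ⟨g, rfl⟩
    refine ⟨?_, cube_ne_C_mul_sq (by rw [h.1, h.2.1]; norm_num) h₂ h₃, ?_⟩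
    · refine pow_ne_zero 2 ?_
      rintro rfl
      simpa using h.2.1
    · simp only [lieDeriv, pderiv_pow, inducedField, Matrix.cons_val_zero, Matrix.cons_val_one]
      push_cast
      ring

lemma absolutelyIrreducible_normalP₂ (α : K) : AbsolutelyIrreducible (normalP₂ α) := by
  rw [normalP₂_eq_conic]
  exact absolutelyIrreducible_conic (by simp) _ _ _

lemma absolutelyIrreducible_normalP₃ : AbsolutelyIrreducible (normalP₃ K) := by
  rw [normalP₃_eq_cubic, absolutelyIrreducible_cubic_iff (by simp)]
  exact one_ne_zero

lemma isSpecialPair_normal (α : K) : IsSpecialPair (normalP₂ α) (normalP₃ K) := by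
  rw [normalP₂_eq_conic, normalP₃_eq_cubic, C_eq_lin]
  exact isSpecialPair_conic_cubic (Or.inl one_ne_zero) _ _ _ _ _ _ _ _

lemma irreducible_normalP₂ (α : K) : Irreducible (normalP₂ α) := by
  rw [normalP₂_eq_conic]
  exact irreducible_conic (by simp) _ _ _

lemma irreducible_normalP₃ : Irreducible (normalP₃ K) := by
  rw [normalP₃_eq_cubic]
  exact irreducible_cubic (by simp) _ _ one_ne_zero

/-- Cross-multiplying and using that the normal forms are prime and do not divide each other, unique
factorization and equality of degrees make P₂ and P₃ constant multiples of them. -/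
lemma absolutelyIrreducible_of_ratioH_eq {P₂ P₃ : Poly K} {α : K} (h₂ : P₂.totalDegree = 2)
    (h₃ : P₃.totalDegree = 3) (h : ratioH P₂ P₃ = ratioH (normalP₂ α) (normalP₃ K)) :
    AbsolutelyIrreducible P₂ ∧ AbsolutelyIrreducible P₃ := by
  have hP₂ : P₂ ≠ 0 := by rintro rfl; simp at h₂
  have hP₃ : P₃ ≠ 0 := by rintro rfl; simp at h₃
  have hN₂ := (irreducible_normalP₂ α).prime
  have hN₃ := (irreducible_normalP₃ (K := K)).prime
  obtain ⟨hd₂, hd₃, -⟩ := isSpecialPair_normal α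
  have hcross := cross_mul_of_ratioH_eq hP₃ hN₃.ne_zero h
  have hdvd : normalP₂ α ∣ P₂ := by
    have : normalP₂ α ∣ P₂ ^ 3 * normalP₃ K ^ 2 := by
      rw [hcross]
      exact (dvd_pow_self _ three_ne_zero).mul_right _
    rcases hN₂.dvd_or_dvd this with hd | hd
    · exact hN₂.dvd_of_dvd_pow hd
    · refine absurd (map_dvd _ (hN₂.dvd_of_dvd_pow hd))
        ((absolutelyIrreducible_normalP₂ α).not_dvd absolutelyIrreducible_normalP₃ ?_)
      rw [hd₂, hd₃]
      norm_num
  obtain ⟨c, hc, rfl⟩ := exists_eq_mul_C_of_dvd hN₂.ne_zero hP₂ hdvd (by rw [h₂, hd₂])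
  have hdvd₃ : normalP₃ K ∣ P₃ := by
    refine hN₃.dvd_of_dvd_pow (n := 2) ⟨C c ^ 3 * normalP₃ K, ?_⟩
    refine mul_left_cancel₀ (pow_ne_zero 3 hN₂.ne_zero) ?_
    linear_combination -hcross
  obtain ⟨d, hd, rfl⟩ := exists_eq_mul_C_of_dvd hN₃.ne_zero hP₃ hdvd₃ (by rw [h₃, hd₃])
  exact ⟨(absolutelyIrreducible_normalP₂ α).mul_C hc, absolutelyIrreducible_normalP₃.mul_C hd⟩

lemma exists_ratioH_affineSubst_eq (hroot : ∀ x : K, ∃ y, y ^ 3 = x) {P₂ P₃ : Poly K}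
    (h : IsSpecialPair P₂ P₃) (h₂ : AbsolutelyIrreducible P₂) (h₃ : AbsolutelyIrreducible P₃) :
    ∃ (α : K) (M : Matrix (Fin 2) (Fin 2) K) (t : Fin 2 → K), IsUnit M.det ∧
      ratioH (affineSubst M t P₂) (affineSubst M t P₃) = ratioH (normalP₂ α) (normalP₃ K) := by
  obtain ⟨p, q, t, r, s, u, α, δ, hdet, rfl, rfl⟩ := h.exists_normal_eq h₂
  rw [absolutelyIrreducible_cubic_iff hdet] at h₃
  obtain ⟨c, rfl⟩ := hroot δ
  have hc : c ≠ 0 := by rintro rfl; simp at h₃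
  have hA := isUnit_det_of_ne hdet
  set A := !![p, q; r, s]
  -- The substitution first turns l, m into the coordinates x, y, and then scales them with weights
  -- 1 and 2; since c³ = δ, the constant of the cubic becomes 1.
  refine ⟨α / c ^ 2, A⁻¹ * !![c, 0; 0, c ^ 2],
    A⁻¹.mulVec 0 + -(A⁻¹.mulVec ![t, u]), ?_, ?_⟩
  · rw [Matrix.det_mul, Matrix.det_fin_two_of]
    refine IsUnit.mul ((Matrix.isUnit_nonsing_inv_det_iff).2 hA) (isUnit_iff_ne_zero.2 ?_)
    simpa using hc
  · rw [← affineSubst_affineSubst, ← affineSubst_affineSubst, ← affineSubst_conic_X,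
      ← affineSubst_cubic_X, ← affineEquiv_symm_apply hA, ← affineEquiv_apply hA,
      ← affineEquiv_symm_apply hA, ← affineEquiv_apply hA, AlgEquiv.symm_apply_apply,
      AlgEquiv.symm_apply_apply, affineSubst_diagonal_conic hc, affineSubst_diagonal_cubic,
      ratioH_C_mul hc]

lemma exists_ratioH_affineSubst_iff (hroot : ∀ x : K, ∃ y, y ^ 3 = x) {P₂ P₃ : Poly K}
    (h : IsSpecialPair P₂ P₃) :
    (∃ (α : K) (M : Matrix (Fin 2) (Fin 2) K) (t : Fin 2 → K), IsUnit M.det ∧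
      ratioH (affineSubst M t P₂) (affineSubst M t P₃) = ratioH (normalP₂ α) (normalP₃ K)) ↔
      AbsolutelyIrreducible P₂ ∧ AbsolutelyIrreducible P₃ := by
  constructor
  · rintro ⟨α, M, t, hM, hH⟩
    have := absolutelyIrreducible_of_ratioH_eq
      (by rw [totalDegree_affineSubst hM, h.1]) (by rw [totalDegree_affineSubst hM, h.2.1]) hH
    rwa [absolutelyIrreducible_affineSubst_iff hM, absolutelyIrreducible_affineSubst_iff hM] at this
  · rintro ⟨h₂, h₃⟩
    exact exists_ratioH_affineSubst_eq hroot h h₂ h₃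

end NormalFields

lemma exists_cube_eq {K : Type*} [RCLike K] (x : K) : ∃ y : K, y ^ 3 = x := by
  rcases RCLike.I_eq_zero_or_im_I_eq_one (K := K) with h | h
  · let e := RCLike.realRingEquiv h
    obtain ⟨y, hy⟩ : ∃ y : ℝ, y ^ 3 = e x := by
      rcases le_total 0 (e x) with h0 | h0
      · exact ⟨_, Real.rpow_inv_natCast_pow h0 three_ne_zero⟩
      · refine ⟨-((-e x) ^ ((3 : ℕ) : ℝ)⁻¹), ?_⟩
        rw [Odd.neg_pow (by decide), Real.rpow_inv_natCast_pow (by linarith) three_ne_zero, neg_neg]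
    exact ⟨e.symm y, by rw [← map_pow]; exact (e.symm_apply_eq).2 hy⟩
  · let e := RCLike.complexRingEquiv h
    obtain ⟨y, hy⟩ := IsAlgClosed.exists_pow_nat_eq (e x) (n := 3) (by norm_num)
    exact ⟨e.symm y, by rw [← map_pow]; exact (e.symm_apply_eq).2 hy⟩

/-! ### Quadratic fields of ℒ(2,3) come from special pairs. -/

section LogFields

variable {K : Type*} [Field K]

lemma _root_.MvPolynomial.IsHomogeneous.eq_zero_of_totalDegree_lt {F : Poly K} {n : ℕ}
    (h : F.IsHomogeneous n) (hd : F.totalDegree < n) : F = 0 := by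
  by_contra hF
  exact hd.ne (h.totalDegree hF)

lemma totalDegree_sub_homogeneousComponent_le {F : Poly K} {n : ℕ} (h : F.totalDegree ≤ n + 1) :
    (F - homogeneousComponent (n + 1) F).totalDegree ≤ n := by
  refine totalDegree_le_of_homogeneousComponent_eq_zero (totalDegree_sub_le h
    (homogeneousComponent_isHomogeneous _ _).totalDegree_le) ?_
  rw [map_sub, homogeneousComponent_eq_ite (homogeneousComponent_isHomogeneous (n + 1) F),
    if_pos rfl, sub_self]

lemma totalDegree_pderiv_le {F : Poly K} {n : ℕ} (i : Fin 2) (h : F.totalDegree ≤ n + 1) :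
    (pderiv i F).totalDegree ≤ n := by
  by_cases hd : pderiv i F = 0
  · simp [hd]
  · have := totalDegree_pderiv_lt i hd
    omega

lemma totalDegree_mul_le_add {F G : Poly K} {m n k : ℕ} (hF : F.totalDegree ≤ m)
    (hG : G.totalDegree ≤ n) (hk : m + n ≤ k) : (F * G).totalDegree ≤ k :=
  (totalDegree_mul _ _).trans (by omega)

lemma totalDegree_ofNat_mul_le {F : Poly K} {n : ℕ} (k : ℕ) [k.AtLeastTwo]
    (hF : F.totalDegree ≤ n) : ((OfNat.ofNat k : Poly K) * F).totalDegree ≤ n := by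
  rw [show (OfNat.ofNat k : Poly K) = C (OfNat.ofNat k) from (map_ofNat C k).symm]
  exact totalDegree_C_mul_le _ hF

/-- The conclusion is the degree-four part of the form; every term involving `f'` or `g'` has degree
at most three. -/
lemma top_form_eq_zero {f f' g g' : Poly K} (i : Fin 2)
    (hf : f.IsHomogeneous 2) (hg : g.IsHomogeneous 3) (hf' : f'.totalDegree ≤ 1)
    (hg' : g'.totalDegree ≤ 2)
    (h : (3 * (g + g') * pderiv i (f + f') - 2 * (f + f') * pderiv i (g + g')).totalDegree ≤ 3) :
    3 * (g * pderiv i f) - 2 * (f * pderiv i g) = 0 := by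
  have hdf : (pderiv i f).totalDegree ≤ 1 := totalDegree_pderiv_le i hf.totalDegree_le
  have hdg : (pderiv i g).totalDegree ≤ 2 := totalDegree_pderiv_le i hg.totalDegree_le
  have hdf' : (pderiv i f').totalDegree ≤ 0 := totalDegree_pderiv_le i hf'
  have hdg' : (pderiv i g').totalDegree ≤ 1 := totalDegree_pderiv_le i hg'
  have hhom : (3 * (g * pderiv i f) - 2 * (f * pderiv i g)).IsHomogeneous 4 := by
    rw [show (3 : Poly K) = C 3 from (map_ofNat C 3).symm,
      show (2 : Poly K) = C 2 from (map_ofNat C 2).symm]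
    exact ((hg.mul hf.pderiv).C_mul 3).sub ((hf.mul hg.pderiv).C_mul 2)
  refine hhom.eq_zero_of_totalDegree_lt (Nat.lt_succ_of_le ?_)
  have heq : 3 * (g * pderiv i f) - 2 * (f * pderiv i g) =
      (3 * (g + g') * pderiv i (f + f') - 2 * (f + f') * pderiv i (g + g')) -
      3 * (g' * pderiv i f + g * pderiv i f' + g' * pderiv i f') +
      2 * (f' * pderiv i g + f * pderiv i g' + f' * pderiv i g') := by
    simp only [map_add]; ring
  rw [heq]
  refine totalDegree_add_le (totalDegree_sub_le h (totalDegree_ofNat_mul_le 3 ?_))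
    (totalDegree_ofNat_mul_le 2 ?_)
  · exact totalDegree_add_le (totalDegree_add_le
      (totalDegree_mul_le_add hg' hdf (by norm_num))
      (totalDegree_mul_le_add hg.totalDegree_le hdf' (by norm_num)))
      (totalDegree_mul_le_add hg' hdf' (by norm_num))
  · exact totalDegree_add_le (totalDegree_add_le
      (totalDegree_mul_le_add hf' hdg (by norm_num))
      (totalDegree_mul_le_add hf.totalDegree_le hdg' (by norm_num)))
      (totalDegree_mul_le_add hf' hdg' (by norm_num))

/-- Once the leading parts are l² and l³, the degree-three part of the form is l (3u ∂l - l ∂u) with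
u = 2b - 3la, and it must vanish. The second relation is u = 0. -/
lemma second_form_eq_zero {l a b g : Poly K} {c : K} (i : Fin 2) (hl0 : l ≠ 0)
    (hl : l.IsHomogeneous 1) (ha : a.IsHomogeneous 1) (hb : b.IsHomogeneous 2)
    (hg : g.totalDegree ≤ 1)
    (h : (3 * (l ^ 3 + b + g) * pderiv i (l ^ 2 + a + C c) -
      2 * (l ^ 2 + a + C c) * pderiv i (l ^ 3 + b + g)).totalDegree ≤ 2) :
    l * pderiv i (2 * b - 3 * l * a) = 3 * (2 * b - 3 * l * a) * pderiv i l := by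
  have hdl : (pderiv i l).totalDegree ≤ 0 := totalDegree_pderiv_le i hl.totalDegree_le
  have hda : (pderiv i a).totalDegree ≤ 0 := totalDegree_pderiv_le i ha.totalDegree_le
  have hdb : (pderiv i b).totalDegree ≤ 1 := totalDegree_pderiv_le i hb.totalDegree_le
  have hdg : (pderiv i g).totalDegree ≤ 0 := totalDegree_pderiv_le i hg
  have hl1 := hl.totalDegree_le
  have ha1 := ha.totalDegree_le
  have hb1 := hb.totalDegree_le
  have e2 : (2 : Poly K) = C 2 := (map_ofNat C 2).symm
  have e3 : (3 : Poly K) = C 3 := (map_ofNat C 3).symm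
  have d2 : pderiv i (2 : Poly K) = 0 := by rw [e2, pderiv_C]
  have d3 : pderiv i (3 : Poly K) = 0 := by rw [e3, pderiv_C]
  set w := 3 * (2 * b - 3 * l * a) * pderiv i l - l * pderiv i (2 * b - 3 * l * a) with hw
  suffices hlw : l * w = 0 by
    have := (mul_eq_zero.1 hlw).resolve_left hl0
    rw [hw] at this
    exact (sub_eq_zero.1 this).symm
  have hu : (2 * b - 3 * l * a).IsHomogeneous 2 := by
    rw [e2, e3]
    exact (hb.C_mul 2).sub ((hl.C_mul 3).mul ha)
  have hhom : (l * w).IsHomogeneous 3 := by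
    refine hl.mul (n := 2) ?_
    rw [hw, e3]
    exact ((hu.C_mul 3).mul hl.pderiv).sub (hl.mul hu.pderiv)
  refine hhom.eq_zero_of_totalDegree_lt (Nat.lt_succ_of_le ?_)
  have heq : l * w =
      (3 * (l ^ 3 + b + g) * pderiv i (l ^ 2 + a + C c) -
        2 * (l ^ 2 + a + C c) * pderiv i (l ^ 3 + b + g)) -
      3 * (b * pderiv i a + 2 * (g * l * pderiv i l) + g * pderiv i a) +
      2 * (l * l * pderiv i g + a * pderiv i b + a * pderiv i g +
        C c * (3 * (l * l * pderiv i l) + pderiv i b + pderiv i g)) := by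
    simp only [hw, map_add, map_sub, pderiv_mul, pderiv_pow, pderiv_C, d2, d3]
    push_cast
    ring
  rw [heq]
  have hll : (l * l).totalDegree ≤ 2 := totalDegree_mul_le_two hl1 hl1
  refine totalDegree_add_le (totalDegree_sub_le h (totalDegree_ofNat_mul_le 3 ?_))
    (totalDegree_ofNat_mul_le 2 ?_)
  · exact totalDegree_add_le (totalDegree_add_le
      (totalDegree_mul_le_add hb1 hda (by norm_num))
      (totalDegree_ofNat_mul_le 2 (totalDegree_mul_le_add
        (totalDegree_mul_le_two hg hl1) hdl (by norm_num))))
      (totalDegree_mul_le_add hg hda (by norm_num))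
  · refine totalDegree_add_le (totalDegree_add_le (totalDegree_add_le
      (totalDegree_mul_le_add hll hdg (by norm_num))
      (totalDegree_mul_le_add ha1 hdb (by norm_num)))
      (totalDegree_mul_le_add ha1 hdg (by norm_num))) (totalDegree_C_mul_le _ ?_)
    exact totalDegree_add_le (totalDegree_add_le
      (totalDegree_ofNat_mul_le 3 (totalDegree_mul_le_add hll hdl (by norm_num)))
      (hdb.trans (by norm_num))) (hdg.trans (by norm_num))

lemma pderiv_form_totalDegree_le {f g : Poly K} {c : K} (hc : c ≠ 0) {n : ℕ}
    (h : (fun i => C c * inducedField f g i) ∈ fieldsOfDegreeLE K n) (i : Fin 2) :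
    (3 * g * pderiv i f - 2 * f * pderiv i g).totalDegree ≤ n := by
  have h' : ∀ i, (inducedField f g i).totalDegree ≤ n := by
    intro i
    have := totalDegree_C_mul_le c⁻¹ (mem_fieldsOfDegreeLE_iff.1 h i)
    rwa [← mul_assoc, ← C_mul, inv_mul_cancel₀ hc, C_1, one_mul] at this
  fin_cases i
  · rw [← totalDegree_neg]
    exact h' 1
  · exact h' 0

lemma inducedField_C_mul (s : K) (f g : Poly K) (i : Fin 2) :
    inducedField (C s * f) g i = C s * inducedField f g i := by
  fin_cases i <;> simp [inducedField] <;> ring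

lemma homogeneousComponent_ne_zero_of_totalDegree {F : Poly K} {n : ℕ}
    (h : F.totalDegree = n + 1) : homogeneousComponent (n + 1) F ≠ 0 := fun h0 => by
  have := totalDegree_le_of_homogeneousComponent_eq_zero h.le h0
  omega

/-- Contracting with (x, y), Euler's identity turns the equations into 2 l u = 3 u l. In other
words, u would be a constant times l³, which has the wrong degree. -/
lemma isHomogeneous_eq_zero_of_mul_pderiv {u l : Poly K} (hu : u.IsHomogeneous 2)
    (hl : l.IsHomogeneous 1) (hl0 : l ≠ 0)
    (h : ∀ i, l * pderiv i u = 3 * u * pderiv i l) : u = 0 := by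
  have e1 := hu.sum_X_mul_pderiv
  have e2 := hl.sum_X_mul_pderiv
  rw [Fin.sum_univ_two] at e1 e2
  rw [nsmul_eq_mul] at e1 e2
  push_cast at e1 e2
  have : l * u = 0 := by
    linear_combination l * e1 - 3 * u * e2 - X 0 * h 0 - X 1 * h 1
  exact (mul_eq_zero.1 this).resolve_left hl0

lemma isSpecialPair_of_top_cube_eq {f g : Poly K} (hf : f.totalDegree = 2)
    (hg : g.totalDegree = 3)
    (h : ∀ i, (3 * g * pderiv i f - 2 * f * pderiv i g).totalDegree ≤ 2)
    (hfg : homogeneousComponent 2 f ^ 3 = homogeneousComponent 3 g ^ 2) :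
    IsSpecialPair f g := by
  refine ⟨hf, hg, hfg, ?_⟩
  obtain ⟨p, q, hpq, ha, hb⟩ := exists_sq_eq_of_cube_eq_sq
    (homogeneousComponent_isHomogeneous 2 f)
    (homogeneousComponent_ne_zero_of_totalDegree (n := 1) hf) hfg
  have hl0 := lin_ne_zero hpq 0
  have hl := isHomogeneous_lin p q
  have ha1 := homogeneousComponent_isHomogeneous 1 f
  have hb2 := homogeneousComponent_isHomogeneous 2 g
  have hfe : f = lin p q 0 ^ 2 + homogeneousComponent 1 f + C (coeff 0 f) := by
    conv_lhs => rw [eq_sum_homogeneousComponent hf.le]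
    simp only [Finset.sum_range_succ, Finset.sum_range_zero, ha, homogeneousComponent_zero]
    ring
  have hge : g = lin p q 0 ^ 3 + homogeneousComponent 2 g +
      (homogeneousComponent 1 g + C (coeff 0 g)) := by
    conv_lhs => rw [eq_sum_homogeneousComponent hg.le]
    simp only [Finset.sum_range_succ, Finset.sum_range_zero, hb, homogeneousComponent_zero]
    ring
  have hg' : (homogeneousComponent 1 g + C (coeff 0 g)).totalDegree ≤ 1 :=
    totalDegree_add_le (homogeneousComponent_isHomogeneous 1 g).totalDegree_le (by simp)
  have hu : 2 * homogeneousComponent 2 g - 3 * lin p q 0 * homogeneousComponent 1 f = 0 := by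
    refine isHomogeneous_eq_zero_of_mul_pderiv ?_ hl hl0 fun i =>
      second_form_eq_zero i hl0 hl ha1 hb2 hg' (c := coeff 0 f) ?_
    · rw [show (3 : Poly K) = C 3 from (map_ofNat C 3).symm,
        show (2 : Poly K) = C 2 from (map_ofNat C 2).symm]
      exact (hb2.C_mul 2).sub ((hl.C_mul 3).mul ha1)
    · rw [← hfe, ← hge]
      exact h i
  rw [ha, hb]
  linear_combination -lin p q 0 ^ 3 * hu

variable [CharZero K]

lemma exists_top_cube_eq {f g : Poly K} (hf : f.totalDegree = 2)
    (hg : g.totalDegree = 3)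
    (h : ∀ i, (3 * g * pderiv i f - 2 * f * pderiv i g).totalDegree ≤ 3) :
    ∃ k : K, k ≠ 0 ∧ homogeneousComponent 2 f ^ 3 = C k * homogeneousComponent 3 g ^ 2 := by
  have hf0 := homogeneousComponent_ne_zero_of_totalDegree (n := 1) hf
  have hg0 := homogeneousComponent_ne_zero_of_totalDegree (n := 2) hg
  obtain ⟨k, hk⟩ := exists_C_mul_of_mul_pderiv_eq (F := homogeneousComponent 2 f ^ 3)
    (pow_ne_zero 2 hg0) fun i => by
      have := top_form_eq_zero (f' := f - homogeneousComponent 2 f)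
        (g' := g - homogeneousComponent 3 g) i
        (homogeneousComponent_isHomogeneous 2 f) (homogeneousComponent_isHomogeneous 3 g)
        (totalDegree_sub_homogeneousComponent_le hf.le)
        (totalDegree_sub_homogeneousComponent_le hg.le)
        (by rw [add_sub_cancel, add_sub_cancel]; exact h i)
      rw [pderiv_pow, pderiv_pow]
      push_cast
      linear_combination (homogeneousComponent 2 f ^ 2 * homogeneousComponent 3 g) * this
  refine ⟨k, ?_, hk⟩
  rintro rfl
  rw [map_zero, zero_mul] at hk
  exact hf0 (pow_eq_zero_iff three_ne_zero |>.1 hk)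

end LogFields

lemma inter_logFields23_subset_specialFields :
    logFields23 ∩ fieldsOfDegreeLE ℂ 2 ⊆ specialFields := by
  rintro V ⟨⟨f, g, hf, hg, c, hc, rfl⟩, hd⟩
  have h := pderiv_form_totalDegree_le hc hd
  obtain ⟨k, hk, hfg⟩ := exists_top_cube_eq hf hg fun i => (h i).trans (by norm_num)
  -- Rescaling f by a cube root of 1/k normalizes a₂³ = k b₃²; the field is only multiplied by s,
  -- which is absorbed in its constant factor.
  obtain ⟨s, hs⟩ := IsAlgClosed.exists_pow_nat_eq k⁻¹ (n := 3) (by norm_num)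
  have hs0 : s ≠ 0 := by
    rintro rfl
    rw [zero_pow three_ne_zero] at hs
    exact inv_ne_zero hk hs.symm
  refine ⟨C s * f, g, isSpecialPair_of_top_cube_eq ?_ hg (fun i => ?_) ?_, c / s,
    div_ne_zero hc hs0, funext fun i => ?_⟩
  · rw [totalDegree_mul_of_isDomain (isUnit_C_of_ne_zero hs0).ne_zero, totalDegree_C, zero_add, hf]
    rintro rfl
    simp at hf
  · have : 3 * g * pderiv i (C s * f) - 2 * (C s * f) * pderiv i g =
        C s * (3 * g * pderiv i f - 2 * f * pderiv i g) := by
      rw [pderiv_C_mul]; ring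
    rw [this]
    exact totalDegree_C_mul_le _ (h i)
  · rw [homogeneousComponent_C_mul, mul_pow, hfg, ← C_pow, ← mul_assoc, ← C_mul, hs,
      inv_mul_cancel₀ hk, C_1, one_mul]
  · rw [inducedField_C_mul, ← mul_assoc, ← C_mul, div_mul_cancel₀ _ hs0]

lemma specialFields_eq : specialFields = logFields23 ∩ fieldsOfDegreeLE ℂ 2 := by
  refine Set.Subset.antisymm ?_ inter_logFields23_subset_specialFields
  rintro V ⟨f, g, h, c, hc, rfl⟩
  refine ⟨⟨f, g, h.1, h.2.1, c, hc, rfl⟩, mem_fieldsOfDegreeLE_iff.2 fun i => ?_⟩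
  exact totalDegree_C_mul_le _
    (mem_fieldsOfDegreeLE_iff.1 (inducedField_mem_of_topRelations h.1.le h.2.1.le h.2.2) i)

/-! ### Zariski closures and images of polynomial maps. -/

section Zariski

variable {σ τ : Type*}

lemma aeval_eq_eval_apply (x : σ → ℂ) (g : MvPolynomial σ ℂ) : aeval x g = eval x g := by
  rw [aeval_def, eval, coe_eval₂Hom]
  rfl

lemma mem_zariskiClosure_iff {S : Set (σ → ℂ)} {x : σ → ℂ} :
    x ∈ zariskiClosure S ↔ ∀ g : MvPolynomial σ ℂ, (∀ y ∈ S, eval y g = 0) → eval x g = 0 := by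
  simp only [zariskiClosure, mem_zeroLocus_iff, mem_vanishingIdeal_iff,
    aeval_eq_eval_apply]

lemma subset_zariskiClosure (S : Set (σ → ℂ)) : S ⊆ zariskiClosure S :=
  fun _ hx => mem_zariskiClosure_iff.2 fun _ hg => hg _ hx

lemma isVariety_zariskiClosure (S : Set (σ → ℂ)) : IsVariety (zariskiClosure S) := ⟨_, rfl⟩

lemma zariskiClosure_subset {S Z : Set (σ → ℂ)} (hZ : IsVariety Z) (h : S ⊆ Z) :
    zariskiClosure S ⊆ Z := by
  obtain ⟨I, rfl⟩ := hZ
  intro x hx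
  rw [mem_zariskiClosure_iff] at hx
  rw [mem_zeroLocus_iff]
  intro g hg
  rw [aeval_eq_eval_apply]
  refine hx g fun y hy => ?_
  have := mem_zeroLocus_iff.1 (h hy) g hg
  rwa [aeval_eq_eval_apply] at this

lemma zariskiClosure_subset_zariskiClosure {S T : Set (σ → ℂ)} (h : S ⊆ zariskiClosure T) :
    zariskiClosure S ⊆ zariskiClosure T :=
  zariskiClosure_subset (isVariety_zariskiClosure T) h

lemma isVariety_setOf_eval_eq_zero (g : MvPolynomial σ ℂ) : IsVariety {x | eval x g = 0} := by
  refine ⟨Ideal.span {g}, ?_⟩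
  ext x
  rw [zeroLocus_span]
  simp [aeval_eq_eval_apply]

lemma IsVariety.exists_eval_ne_zero {Z : Set (σ → ℂ)} (hZ : IsVariety Z) {x : σ → ℂ}
    (hx : x ∉ Z) : ∃ g : MvPolynomial σ ℂ, (∀ y ∈ Z, eval y g = 0) ∧ eval x g ≠ 0 := by
  obtain ⟨I, rfl⟩ := hZ
  simp only [mem_zeroLocus_iff, aeval_eq_eval_apply] at hx ⊢
  push Not at hx
  obtain ⟨g, hg, hgx⟩ := hx
  exact ⟨g, fun y hy => hy g hg, hgx⟩

lemma IsVariety.inter {Z W : Set (σ → ℂ)} (hZ : IsVariety Z) (hW : IsVariety W) :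
    IsVariety (Z ∩ W) := by
  have : Z ∩ W = zariskiClosure (Z ∩ W) := by
    refine Set.Subset.antisymm (subset_zariskiClosure _) (Set.subset_inter ?_ ?_)
    · exact zariskiClosure_subset hZ Set.inter_subset_left
    · exact zariskiClosure_subset hW Set.inter_subset_right
  rw [this]
  exact isVariety_zariskiClosure _

lemma IsVariety.union {Z W : Set (σ → ℂ)} (hZ : IsVariety Z) (hW : IsVariety W) :
    IsVariety (Z ∪ W) := by
  have : Z ∪ W = zariskiClosure (Z ∪ W) := by
    refine Set.Subset.antisymm (subset_zariskiClosure _) fun x hx => ?_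
    by_contra hxZW
    rw [Set.mem_union, not_or] at hxZW
    obtain ⟨f, hf, hfx⟩ := hZ.exists_eval_ne_zero hxZW.1
    obtain ⟨g, hg, hgx⟩ := hW.exists_eval_ne_zero hxZW.2
    refine mul_ne_zero hfx hgx ?_
    rw [← map_mul]
    refine mem_zariskiClosure_iff.1 hx _ fun y hy => ?_
    rcases hy with hy | hy
    · rw [map_mul, hf y hy, zero_mul]
    · rw [map_mul, hg y hy, mul_zero]
  rw [this]
  exact isVariety_zariskiClosure _

lemma IsIrreducibleVariety.subset_of_subset_union {Z Z₁ Z₂ : Set (σ → ℂ)}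
    (hZ : IsIrreducibleVariety Z) (h₁ : IsVariety Z₁) (h₂ : IsVariety Z₂) (h : Z ⊆ Z₁ ∪ Z₂) :
    Z ⊆ Z₁ ∨ Z ⊆ Z₂ := by
  have := hZ.2.2 (Z ∩ Z₁) (Z ∩ Z₂) (hZ.1.inter h₁) (hZ.1.inter h₂)
    (by rw [← Set.inter_union_distrib_left, Set.inter_eq_left.2 h])
  simpa [Set.inter_eq_left] using this

/-- The polynomial map with components `φ`. -/
def polyMap (φ : σ → MvPolynomial τ ℂ) (θ : τ → ℂ) : σ → ℂ := fun k => eval θ (φ k)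

lemma eval_polyMap (φ : σ → MvPolynomial τ ℂ) (θ : τ → ℂ) (g : MvPolynomial σ ℂ) :
    eval (polyMap φ θ) g = eval θ (bind₁ φ g) := by
  rw [← aeval_eq_eval_apply, ← aeval_eq_eval_apply, aeval_bind₁]
  simp only [aeval_eq_eval_apply]
  rfl

/-- The image of a nonempty Zariski open set is dense in the image of a polynomial map. -/
lemma polyMap_mem_zariskiClosure {φ : σ → MvPolynomial τ ℂ} {d : MvPolynomial τ ℂ} (hd : d ≠ 0)
    {S : Set (σ → ℂ)} (h : ∀ θ, eval θ d ≠ 0 → polyMap φ θ ∈ S) (θ : τ → ℂ) :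
    polyMap φ θ ∈ zariskiClosure S := by
  rw [mem_zariskiClosure_iff]
  intro g hg
  have : d * bind₁ φ g = 0 := by
    refine MvPolynomial.funext fun θ => ?_
    rw [map_mul, map_zero]
    by_cases hθ : eval θ d = 0
    · rw [hθ, zero_mul]
    · rw [← eval_polyMap, hg _ (h θ hθ), mul_zero]
  rw [eval_polyMap, (mul_eq_zero.1 this).resolve_left hd, map_zero]

/-- A proper closed subset satisfies an equation whose pull-back along φ is a nonzero polynomial. If
two such subsets covered the closure, the product of the pull-backs would vanish at every parameter,
although a polynomial ring over ℂ is a domain. -/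
lemma isIrreducibleVariety_zariskiClosure_range (φ : σ → MvPolynomial τ ℂ) :
    IsIrreducibleVariety (zariskiClosure (Set.range (polyMap φ))) := by
  refine ⟨isVariety_zariskiClosure _, ⟨_, subset_zariskiClosure _ ⟨0, rfl⟩⟩, ?_⟩
  intro Z₁ Z₂ h₁ h₂ hZ
  by_contra! hne
  have key : ∀ W : Set (σ → ℂ), IsVariety W → W ⊆ zariskiClosure (Set.range (polyMap φ)) →
      W ≠ zariskiClosure (Set.range (polyMap φ)) →
      ∃ g : MvPolynomial σ ℂ, (∀ y ∈ W, eval y g = 0) ∧ bind₁ φ g ≠ 0 := by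
    intro W hW hsub hWne
    obtain ⟨x, hx, hxW⟩ := Set.exists_of_ssubset (hsub.ssubset_of_ne hWne)
    obtain ⟨g, hg, hgx⟩ := hW.exists_eval_ne_zero hxW
    refine ⟨g, hg, fun h0 => hgx ?_⟩
    refine mem_zariskiClosure_iff.1 hx g ?_
    rintro _ ⟨θ, rfl⟩
    rw [eval_polyMap, h0, map_zero]
  obtain ⟨f, hf, hf0⟩ := key Z₁ h₁ (by rw [hZ]; exact Set.subset_union_left) hne.1
  obtain ⟨g, hg, hg0⟩ := key Z₂ h₂ (by rw [hZ]; exact Set.subset_union_right) hne.2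
  refine mul_ne_zero hf0 hg0 (MvPolynomial.funext fun θ => ?_)
  rw [map_mul, map_zero, ← eval_polyMap, ← eval_polyMap]
  have hmem : polyMap φ θ ∈ Z₁ ∪ Z₂ := by
    rw [← hZ]
    exact subset_zariskiClosure _ ⟨θ, rfl⟩
  rcases hmem with hm | hm
  · rw [hf _ hm, zero_mul]
  · rw [hg _ hm, mul_zero]

end Zariski

/-! ### The nine-parameter family that is dense in 𝒬₄. -/

section Families

variable {R : Type*} [CommRing R]

/-- The vector field induced by `c (3 g df - 2 f dg)`, over an arbitrary ring of coefficients. -/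
def formField (c : R) (f g : MvPolynomial (Fin 2) R) : Fin 2 → MvPolynomial (Fin 2) R :=
  ![C c * (3 * g * pderiv 1 f - 2 * f * pderiv 1 g),
    C c * -(3 * g * pderiv 0 f - 2 * f * pderiv 0 g)]

lemma formField_eq {K : Type*} [Field K] (c : K) (f g : Poly K) :
    formField c f g = fun i => C c * inducedField f g i := by
  funext i
  fin_cases i <;> rfl

lemma map_formField {S : Type*} [CommRing S] (φ : R →+* S) (c : R)
    (f g : MvPolynomial (Fin 2) R) (i : Fin 2) :
    map φ (formField c f g i) = formField (φ c) (map φ f) (map φ g) i := by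
  fin_cases i <;> simp [formField, pderiv_map]

lemma coeffs_formField {τ : Type*} (n : ℕ) (θ : τ → ℂ) (c : MvPolynomial τ ℂ)
    (f g : MvPolynomial (Fin 2) (MvPolynomial τ ℂ)) :
    coeffs n (formField (eval θ c) (map (eval θ) f) (map (eval θ) g)) =
      polyMap (fun k : CoeffIndex n => coeff k.2.1 (formField c f g k.1)) θ := by
  funext k
  rw [coeffs, polyMap, ← map_formField, coeff_map]

/-- The vector fields `c X_{f, g}` with `f = l² + 2 m + a` and `g = l³ + 3 l m + e`. -/
def normalFamily (θ : Fin 9 → ℂ) : VField ℂ :=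
  formField (θ 8) (conic (lin (θ 0) (θ 1) (θ 2)) (lin (θ 3) (θ 4) (θ 5)) (θ 6))
    (cubic (lin (θ 0) (θ 1) (θ 2)) (lin (θ 3) (θ 4) (θ 5)) (C (θ 7)))

/-- The coefficients of `normalFamily` as polynomials in the parameters. -/
def normalFamilyCoeffs (k : CoeffIndex 2) : MvPolynomial (Fin 9) ℂ :=
  coeff k.2.1 (formField (X 8) (conic (lin (X 0) (X 1) (X 2)) (lin (X 3) (X 4) (X 5)) (X 6))
    (cubic (lin (X 0) (X 1) (X 2)) (lin (X 3) (X 4) (X 5)) (C (X 7))) k.1)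

lemma coeffs_normalFamily (θ : Fin 9 → ℂ) :
    coeffs 2 (normalFamily θ) = polyMap normalFamilyCoeffs θ := by
  refine Eq.trans ?_ (coeffs_formField 2 θ _ _ _)
  simp only [map_conic, map_cubic, map_lin, map_C, eval_X]
  rfl

/-- The determinant of the linear parts of `l` and `m`. -/
def detPoly : MvPolynomial (Fin 9) ℂ := X 0 * X 4 - X 1 * X 3

lemma eval_detPoly (θ : Fin 9 → ℂ) : eval θ detPoly = θ 0 * θ 4 - θ 1 * θ 3 := by
  simp [detPoly]

lemma normalFamily_mem_specialFields {θ : Fin 9 → ℂ} (h : θ 0 ≠ 0 ∨ θ 1 ≠ 0) (hc : θ 8 ≠ 0) :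
    normalFamily θ ∈ specialFields := by
  refine ⟨_, _, ?_, θ 8, hc, formField_eq _ _ _⟩
  rw [C_eq_lin]
  exact isSpecialPair_conic_cubic h _ _ _ _ _ _ _ _

lemma ne_zero_or_of_det {p q r s : ℂ} (h : p * s - q * r ≠ 0) : p ≠ 0 ∨ q ≠ 0 := by
  by_contra! h0
  simp [h0.1, h0.2] at h

lemma normalFamily_mem_generalSpecialFields {θ : Fin 9 → ℂ} (h : θ 0 * θ 4 - θ 1 * θ 3 ≠ 0)
    (he : θ 7 ≠ 0) (hc : θ 8 ≠ 0) : normalFamily θ ∈ generalSpecialFields := by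
  refine ⟨_, _, ?_, irreducible_conic h _ _ _, irreducible_cubic h _ _ he, θ 8, hc,
    formField_eq _ _ _⟩
  rw [C_eq_lin]
  exact isSpecialPair_conic_cubic (ne_zero_or_of_det h) _ _ _ _ _ _ _ _

lemma exists_normalFamily_eq {p q r s : ℂ} (h : p * s - q * r ≠ 0) (a b d e c : ℂ) :
    ∃ θ, normalFamily θ = formField c (conic (lin p q 0) (lin r s 0) a)
      (cubic (lin p q 0) (lin r s 0) (lin b d e)) := by
  obtain ⟨t, r', s', u, α, δ, -, h₂, h₃⟩ := exists_normal_eq h a b d e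
  refine ⟨![p, q, t, r', s', u, α, δ, c], ?_⟩
  rw [h₂, h₃]
  rfl

/-- If l and m have dependent linear parts the reduction of n fails. Such a pair lies on a line of
pairs, obtained by moving m in a direction independent of l, whose general point is covered by the
family. -/
lemma coeffs_special_mem_zariskiClosure {p q : ℂ} (hpq : p ≠ 0 ∨ q ≠ 0) (r s a b d e c : ℂ) :
    coeffs 2 (formField c (conic (lin p q 0) (lin r s 0) a)
      (cubic (lin p q 0) (lin r s 0) (lin b d e))) ∈
      zariskiClosure (Set.range (polyMap normalFamilyCoeffs)) := by
  obtain ⟨r', s', h'⟩ : ∃ r' s' : ℂ, p * s' - q * r' ≠ 0 := by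
    rcases hpq with hp | hq
    · exact ⟨0, 1, by simpa using hp⟩
    · exact ⟨1, 0, by simpa using hq⟩
  have hfam : ∀ θ : Fin 1 → ℂ, coeffs 2 (formField c
      (conic (lin p q 0) (lin (r + θ 0 * r') (s + θ 0 * s') 0) a)
      (cubic (lin p q 0) (lin (r + θ 0 * r') (s + θ 0 * s') 0) (lin b d e))) =
      polyMap (fun k : CoeffIndex 2 => coeff k.2.1 (formField (C c)
        (conic (lin (C p) (C q) 0) (lin (C r + X 0 * C r') (C s + X 0 * C s') 0) (C a))
        (cubic (lin (C p) (C q) 0) (lin (C r + X 0 * C r') (C s + X 0 * C s') 0)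
          (lin (C b) (C d) (C e))) k.1)) θ := by
    intro θ
    refine Eq.trans ?_ (coeffs_formField 2 θ _ _ _)
    simp only [map_conic, map_cubic, map_lin, eval_C, map_add, map_mul, eval_X,
      map_zero]
  have h0 := hfam 0
  simp only [Pi.zero_apply, zero_mul, add_zero] at h0
  rw [h0]
  refine polyMap_mem_zariskiClosure
    (d := C (p * s - q * r) + C (p * s' - q * r') * X 0) ?_ (fun θ hθ => ?_) 0
  · intro hd
    have h1 := congrArg (eval fun _ => 1) hd
    have h2 := congrArg (eval fun _ => 0) hd
    simp only [map_add, map_mul, eval_C, eval_X, map_zero] at h1 h2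
    exact h' (by linear_combination h1 - h2)
  · rw [← hfam]
    obtain ⟨η, hη⟩ := exists_normalFamily_eq (p := p) (q := q) (r := r + θ 0 * r')
      (s := s + θ 0 * s') (fun h0 => hθ (by
        simp only [map_add, map_mul, eval_C, eval_X]
        linear_combination h0)) a b d e c
    exact ⟨η, by rw [← hη, coeffs_normalFamily]⟩

lemma Q₄_eq_zariskiClosure_special : Q₄ = zariskiClosure (coeffs 2 '' specialFields) := by
  rw [Q₄, specialFields_eq]

lemma Q₄_eq_zariskiClosure_range :
    Q₄ = zariskiClosure (Set.range (polyMap normalFamilyCoeffs)) := by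
  rw [Q₄_eq_zariskiClosure_special]
  refine Set.Subset.antisymm (zariskiClosure_subset_zariskiClosure ?_)
    (zariskiClosure_subset_zariskiClosure ?_)
  · rintro _ ⟨V, ⟨P₂, P₃, h, c, -, rfl⟩, rfl⟩
    obtain ⟨p, q, r, s, a, b, d, e, hpq, rfl, rfl⟩ := h.exists_eq
    rw [← formField_eq]
    exact coeffs_special_mem_zariskiClosure hpq _ _ _ _ _ _ _
  · rintro _ ⟨θ, rfl⟩
    refine polyMap_mem_zariskiClosure (d := X 0 * X 8) (mul_ne_zero (X_ne_zero _) (X_ne_zero _))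
      (fun θ hθ => ?_) θ
    simp only [map_mul, eval_X, mul_ne_zero_iff] at hθ
    rw [← coeffs_normalFamily]
    exact ⟨_, normalFamily_mem_specialFields (Or.inl hθ.1) hθ.2, rfl⟩

lemma detPoly_ne_zero : detPoly ≠ 0 := by
  intro h
  have := congrArg (eval ![1, 0, 0, 0, 1, 0, 0, 0, 0]) h
  rw [eval_detPoly] at this
  simp at this

/-- A Zariski closed set that contains the general member of the family contains `𝒬₄`. -/
lemma Q₄_subset_zariskiClosure {S : Set (CoeffIndex 2 → ℂ)} {d : MvPolynomial (Fin 9) ℂ}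
    (hd : d ≠ 0) (h : ∀ θ, eval θ d ≠ 0 → coeffs 2 (normalFamily θ) ∈ S) :
    Q₄ ⊆ zariskiClosure S := by
  rw [Q₄_eq_zariskiClosure_range]
  refine zariskiClosure_subset_zariskiClosure ?_
  rintro _ ⟨θ, rfl⟩
  exact polyMap_mem_zariskiClosure hd (fun θ hθ => by
    rw [← coeffs_normalFamily]; exact h θ hθ) θ

lemma zariskiClosure_general : zariskiClosure (coeffs 2 '' generalSpecialFields) = Q₄ := by
  refine Set.Subset.antisymm ?_ ?_
  · rw [Q₄_eq_zariskiClosure_special]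
    refine zariskiClosure_subset_zariskiClosure
      (Set.Subset.trans (Set.image_mono ?_) (subset_zariskiClosure _))
    rintro V ⟨P₂, P₃, h, -, -, hV⟩
    exact ⟨P₂, P₃, h, hV⟩
  · refine Q₄_subset_zariskiClosure (d := detPoly * X 7 * X 8)
      (mul_ne_zero (mul_ne_zero detPoly_ne_zero (X_ne_zero _)) (X_ne_zero _)) fun θ hθ => ?_
    simp only [map_mul, eval_X, eval_detPoly, mul_ne_zero_iff] at hθ
    exact ⟨_, normalFamily_mem_generalSpecialFields hθ.1.1 hθ.1.2 hθ.2, rfl⟩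

lemma isIrreducibleVariety_Q₄ : IsIrreducibleVariety Q₄ := by
  rw [Q₄_eq_zariskiClosure_range]
  exact isIrreducibleVariety_zariskiClosure_range _

end Families

/-! ### Morse centers of the general member of the family. -/

section Calculus

/-- The coordinates as linear forms. -/
def coordForm (i : Fin 2) : (Fin 2 → ℂ) →L[ℂ] ℂ := ContinuousLinearMap.proj i

@[simp] lemma coordForm_apply (i : Fin 2) (v : Fin 2 → ℂ) : coordForm i v = v i := rfl

/-- The value at `q` of the polynomial one-form `F 0 dx + F 1 dy`. -/
def polyForm (F : Fin 2 → Poly ℂ) (q : Fin 2 → ℂ) : (Fin 2 → ℂ) →L[ℂ] ℂ :=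
  eval q (F 0) • coordForm 0 + eval q (F 1) • coordForm 1

lemma polyForm_apply (F : Fin 2 → Poly ℂ) (q v : Fin 2 → ℂ) :
    polyForm F q v = eval q (F 0) * v 0 + eval q (F 1) * v 1 := rfl

lemma hasFDerivAt_eval (F : Poly ℂ) (q : Fin 2 → ℂ) :
    HasFDerivAt (fun x => eval x F) (polyForm (fun i => pderiv i F) q) q := by
  induction F using MvPolynomial.induction_on with
  | C a =>
    simp only [eval_C]
    refine (hasFDerivAt_const a q).congr_fderiv ?_
    ext v
    simp [polyForm_apply]
  | add F G hF hG =>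
    simp only [map_add]
    refine (hF.add hG).congr_fderiv ?_
    ext v
    simp only [add_apply, polyForm_apply, map_add]
    ring
  | mul_X F i hF =>
    simp only [map_mul, eval_X]
    refine (hF.mul (coordForm i).hasFDerivAt).congr_fderiv ?_
    refine ContinuousLinearMap.ext fun v => ?_
    fin_cases i
    · simp [polyForm_apply]; ring
    · simp [polyForm_apply]; ring

lemma analyticAt_eval (F : Poly ℂ) (q : Fin 2 → ℂ) : AnalyticAt ℂ (fun x => eval x F) q :=
  AnalyticOnNhd.eval_mvPolynomial F q (Set.mem_univ q)

lemma hasFDerivAt_polyForm (F : Fin 2 → Poly ℂ) (q : Fin 2 → ℂ) :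
    HasFDerivAt (polyForm F)
      ((polyForm (fun j => pderiv j (F 0)) q).smulRight (coordForm 0) +
        (polyForm (fun j => pderiv j (F 1)) q).smulRight (coordForm 1)) q :=
  ((hasFDerivAt_eval (F 0) q).smul_const (coordForm 0)).add
    ((hasFDerivAt_eval (F 1) q).smul_const (coordForm 1))

lemma hasFDerivAt_ratio {P₂ P₃ : Poly ℂ} {q : Fin 2 → ℂ} (h₃ : eval q P₃ ≠ 0) :
    HasFDerivAt (fun x => eval x P₂ ^ 3 / eval x P₃ ^ 2)
      ((eval q P₂ ^ 2 / eval q P₃ ^ 3) •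
        polyForm (fun i => 3 * P₃ * pderiv i P₂ - 2 * P₂ * pderiv i P₃) q) q := by
  have h2 := (hasFDerivAt_eval P₂ q).pow 3
  have h3 := (hasDerivAt_inv (pow_ne_zero 2 h₃)).comp_hasFDerivAt q ((hasFDerivAt_eval P₃ q).pow 2)
  refine (h2.mul h3).congr_fderiv (ContinuousLinearMap.ext fun v => ?_)
  simp [polyForm_apply]
  field_simp
  ring

/-- H itself is the integral. Its differential is P₂² / P₃³ times the form dual to the field; as the
form vanishes at p, the Hessian of H there is a nonzero number times the derivative of the form, and
this is injective because the Jacobian of the field is. -/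
lemma isMorseCenter_of_eval {P₂ P₃ : Poly ℂ} {p : Fin 2 → ℂ} {c : ℂ} (hc : c ≠ 0)
    (h₂ : eval p P₂ ≠ 0) (h₃ : eval p P₃ ≠ 0) (hp : ∀ i, eval p (inducedField P₂ P₃ i) = 0)
    (hdet : eval p (pderiv 0 (inducedField P₂ P₃ 0)) * eval p (pderiv 1 (inducedField P₂ P₃ 1)) -
      eval p (pderiv 1 (inducedField P₂ P₃ 0)) * eval p (pderiv 0 (inducedField P₂ P₃ 1)) ≠ 0) :
    IsMorseCenter (fun i => C c * inducedField P₂ P₃ i) p := by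
  set W := inducedField P₂ P₃ with hW
  have hform : (fun i => 3 * P₃ * pderiv i P₂ - 2 * P₂ * pderiv i P₃) = ![-W 1, W 0] := by
    funext i
    fin_cases i <;> simp [hW, inducedField]
  have hne : ∀ᶠ q in 𝓝 p, eval q P₃ ≠ 0 :=
    (hasFDerivAt_eval P₃ p).continuousAt.eventually_ne h₃
  have hder : ∀ᶠ q in 𝓝 p, fderiv ℂ (fun x => eval x P₂ ^ 3 / eval x P₃ ^ 2) q =
      (eval q P₂ ^ 2 / eval q P₃ ^ 3) • polyForm ![-W 1, W 0] q := by
    filter_upwards [hne] with q hq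
    rw [(hasFDerivAt_ratio hq).fderiv, hform]
  refine ⟨?_, ?_, fun x => eval x P₂ ^ 3 / eval x P₃ ^ 2, ?_, ?_, ?_, ?_⟩
  · funext i
    simp [VField.evalAt, hp]
  · rw [Matrix.det_fin_two]
    simp only [Matrix.of_apply, pderiv_C_mul, map_mul, eval_C]
    intro h0
    refine mul_ne_zero (pow_ne_zero 2 hc) hdet ?_
    linear_combination h0
  · exact ((analyticAt_eval P₂ p).pow 3).div ((analyticAt_eval P₃ p).pow 2) (pow_ne_zero 2 h₃)
  · filter_upwards [hder] with q hq
    rw [hq]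
    simp [polyForm_apply, VField.evalAt]
    ring_nf
    simp
  · rw [hder.self_of_nhds]
    ext v
    simp [polyForm_apply, hp]
  · have hu : DifferentiableAt ℂ (fun q => eval q P₂ ^ 2 / eval q P₃ ^ 3) p :=
      (((analyticAt_eval P₂ p).pow 2).div ((analyticAt_eval P₃ p).pow 3)
        (pow_ne_zero 3 h₃)).differentiableAt
    have h2 := hu.hasFDerivAt.smul (hasFDerivAt_polyForm ![-W 1, W 0] p)
    have hzero : polyForm ![-W 1, W 0] p = 0 := by
      ext v
      simp [polyForm_apply, hp]
    have h3 := (Filter.EventuallyEq.fderiv_eq (𝕜 := ℂ) hder).trans h2.fderiv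
    have hu0 : eval p P₂ ^ 2 / eval p P₃ ^ 3 ≠ 0 :=
      div_ne_zero (pow_ne_zero 2 h₂) (pow_ne_zero 3 h₃)
    rw [h3, injective_iff_map_eq_zero]
    intro v hv
    have e0 := congrArg (fun L : (Fin 2 → ℂ) →L[ℂ] ℂ => L ![1, 0]) hv
    have e1 := congrArg (fun L : (Fin 2 → ℂ) →L[ℂ] ℂ => L ![0, 1]) hv
    simp [hzero, polyForm_apply] at e0 e1
    have e0' := e0.resolve_left (not_or.2 ⟨h₂, h₃⟩)
    have e1' := e1.resolve_left (not_or.2 ⟨h₂, h₃⟩)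
    funext i
    fin_cases i
    · refine (mul_eq_zero.1 ?_).resolve_left hdet
      simp only [Fin.zero_eta]
      linear_combination eval p (pderiv 1 (W 1)) * e1' + eval p (pderiv 1 (W 0)) * e0'
    · refine (mul_eq_zero.1 ?_).resolve_left hdet
      simp only [Fin.mk_one]
      linear_combination -eval p (pderiv 0 (W 1)) * e1' - eval p (pderiv 0 (W 0)) * e0'

lemma eval_lin (p q t : ℂ) (x : Fin 2 → ℂ) : eval x (lin p q t) = p * x 0 + q * x 1 + t := by
  simp [lin]

lemma eval_affineSubst (M : Matrix (Fin 2) (Fin 2) ℂ) (t x : Fin 2 → ℂ) (F : Poly ℂ) :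
    eval x (affineSubst M t F) = eval (M.mulVec x + t) F := by
  induction F using MvPolynomial.induction_on with
  | C a => simp
  | add F G hF hG => simp [hF, hG]
  | mul_X F i hF =>
    rw [map_mul, map_mul, hF, affineSubst_X, eval_lin, map_mul, eval_X, Pi.add_apply,
      Matrix.mulVec, dotProduct, Fin.sum_univ_two]

lemma exists_affine_eq {p q r s : ℂ} (h : p * s - q * r ≠ 0) (t u a b : ℂ) :
    ∃ x : Fin 2 → ℂ, p * x 0 + q * x 1 + t = a ∧ r * x 0 + s * x 1 + u = b := by
  have hi := mul_inv_cancel₀ h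
  refine ⟨![(s * (a - t) - q * (b - u)) * (p * s - q * r)⁻¹,
    (p * (b - u) - r * (a - t)) * (p * s - q * r)⁻¹], ?_, ?_⟩
  · simp only [Matrix.cons_val_zero, Matrix.cons_val_one]
    linear_combination (a - t) * hi
  · simp only [Matrix.cons_val_zero, Matrix.cons_val_one]
    linear_combination (b - u) * hi

lemma eval_quad (a b c d e f : ℂ) (x : Fin 2 → ℂ) : eval x (quad a b c d e f) =
    a + b * x 0 + c * x 1 + d * x 0 ^ 2 + e * (x 0 * x 1) + f * x 1 ^ 2 := by
  simp [quad]

/-- The field of `(l² + 2 m + a)³ / (l³ + 3 l m + e)²` has a center where `l = e / a`, `m = 0`. -/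
lemma exists_isMorseCenter {p q r s a e c : ℂ} (h : p * s - q * r ≠ 0) (t u : ℂ) (ha : a ≠ 0)
    (he : e ≠ 0) (hc : c ≠ 0) (hae : a ^ 3 + e ^ 2 ≠ 0) :
    ∃ x, IsMorseCenter (fun i => C c * inducedField (conic (lin p q t) (lin r s u) a)
      (cubic (lin p q t) (lin r s u) (C e)) i) x := by
  -- On m = 0 the equations lm - a l + e = 0 and e l - a m - a l² - 2 m² = 0 share the root l = e /
  -- a. There the Jacobian determinant of these two quadratics in (l, m) is (a³ + e²) / a.
  obtain ⟨x, hl, hm⟩ := exists_affine_eq h t u (e / a) 0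
  have hz : (!![p, q; r, s] : Matrix (Fin 2) (Fin 2) ℂ).mulVec x + ![t, u] = ![e / a, 0] := by
    funext i
    fin_cases i
    · simpa [Matrix.mulVec, dotProduct, Fin.sum_univ_two] using hl
    · simpa [Matrix.mulVec, dotProduct, Fin.sum_univ_two] using hm
  refine ⟨x, isMorseCenter_of_eval hc ?_ ?_ ?_ ?_⟩
  · rw [conic]
    simp only [map_add, map_mul, map_pow, map_ofNat, eval_lin, eval_C, hl, hm]
    intro h0
    field_simp at h0
    exact hae (by linear_combination h0)
  · rw [cubic]
    simp only [map_add, map_mul, map_pow, map_ofNat, eval_lin, eval_C, hl, hm]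
    intro h0
    field_simp at h0
    have : e * (a ^ 3 + e ^ 2) = 0 := by linear_combination h0
    exact (mul_ne_zero he hae) this
  · intro i
    rw [inducedField_normal]
    have h0 : eval x (affineSubst !![p, q; r, s] ![t, u] (quad e (-a) 0 0 1 0)) = 0 := by
      rw [eval_affineSubst, hz, eval_quad]
      simp only [Matrix.cons_val_zero, Matrix.cons_val_one]
      field_simp
      ring
    have h1 : eval x (affineSubst !![p, q; r, s] ![t, u] (quad 0 e (-a) (-a) 0 (-2))) = 0 := by
      rw [eval_affineSubst, hz, eval_quad]
      simp only [Matrix.cons_val_zero, Matrix.cons_val_one]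
      field_simp
      ring
    fin_cases i <;> simp [h0, h1]
  · rw [inducedField_normal]
    have e6 : (6 : Poly ℂ) = C 6 := (map_ofNat C 6).symm
    simp only [Matrix.cons_val_zero, Matrix.cons_val_one, map_add, map_neg, pderiv_C_mul, e6,
      pderiv_affineSubst, pderiv_zero_quad, pderiv_one_quad, map_mul, eval_C, eval_affineSubst,
      hz, eval_lin, Matrix.of_apply, Matrix.cons_val']
    intro h0
    refine mul_ne_zero ha (mul_ne_zero (pow_ne_zero 2 h) hae) ?_
    field_simp at h0
    linear_combination -h0 / 36

end Calculus

lemma Q₄_subset_centerSet : Q₄ ⊆ centerSet 2 := by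
  have h3 : (X 6 ^ 3 + X 7 ^ 2 : MvPolynomial (Fin 9) ℂ) ≠ 0 := by
    intro h
    have := congrArg (eval ![0, 0, 0, 0, 0, 0, 0, 1, 0]) h
    simp at this
  refine Q₄_subset_zariskiClosure (d := detPoly * X 6 * X 7 * X 8 * (X 6 ^ 3 + X 7 ^ 2))
    (mul_ne_zero (mul_ne_zero (mul_ne_zero (mul_ne_zero detPoly_ne_zero (X_ne_zero _))
      (X_ne_zero _)) (X_ne_zero _)) h3) fun θ hθ => ?_
  simp only [map_mul, map_add, map_pow, eval_X, eval_detPoly, mul_ne_zero_iff] at hθ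
  obtain ⟨⟨⟨⟨hdet, ha⟩, he⟩, hc⟩, hae⟩ := hθ
  refine ⟨normalFamily θ, ⟨?_, ?_⟩, rfl⟩
  · have := normalFamily_mem_specialFields (ne_zero_or_of_det hdet) hc
    rw [specialFields_eq] at this
    exact this.2
  · rw [normalFamily, formField_eq]
    exact exists_isMorseCenter hdet _ _ ha he hc hae

/-! ### Taylor coefficients of holomorphic functions of two variables. -/

section Taylor

/-- The partial derivatives of a function on the plane. -/
def partialDeriv (i : Fin 2) (F : (Fin 2 → ℂ) → ℂ) (q : Fin 2 → ℂ) : ℂ :=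
  fderiv ℂ F q (Pi.single i 1)

variable {F G : (Fin 2 → ℂ) → ℂ}

lemma analyticAt_partialDeriv (i : Fin 2) {p : Fin 2 → ℂ} (hF : AnalyticAt ℂ F p) :
    AnalyticAt ℂ (partialDeriv i F) p :=
  ((ContinuousLinearMap.apply ℂ ℂ (Pi.single i 1 : Fin 2 → ℂ)).analyticAt _).comp hF.fderiv

lemma analyticAt_iterate_partialDeriv (i : Fin 2) {p : Fin 2 → ℂ} (hF : AnalyticAt ℂ F p) (n : ℕ) :
    AnalyticAt ℂ ((partialDeriv i)^[n] F) p := by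
  induction n with
  | zero => exact hF
  | succ n ih =>
    rw [Function.iterate_succ_apply']
    exact analyticAt_partialDeriv i ih

lemma analyticAt_smul_const {p : Fin 2 → ℂ} (c : ℂ) (hF : AnalyticAt ℂ F p) :
    AnalyticAt ℂ (c • F) p :=
  (analyticAt_const (v := c)).smul hF

lemma partialDeriv_congr (i : Fin 2) {p : Fin 2 → ℂ} (h : F =ᶠ[𝓝 p] G) :
    partialDeriv i F =ᶠ[𝓝 p] partialDeriv i G := by
  filter_upwards [h.fderiv (𝕜 := ℂ)] with q hq
  rw [partialDeriv, partialDeriv, hq]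

lemma iterate_partialDeriv_congr (i : Fin 2) {p : Fin 2 → ℂ} (h : F =ᶠ[𝓝 p] G) (n : ℕ) :
    (partialDeriv i)^[n] F =ᶠ[𝓝 p] (partialDeriv i)^[n] G := by
  induction n with
  | zero => exact h
  | succ n ih =>
    rw [Function.iterate_succ_apply', Function.iterate_succ_apply']
    exact partialDeriv_congr i ih

lemma partialDeriv_add (i : Fin 2) {p : Fin 2 → ℂ} (hF : AnalyticAt ℂ F p)
    (hG : AnalyticAt ℂ G p) :
    partialDeriv i (F + G) =ᶠ[𝓝 p] partialDeriv i F + partialDeriv i G := by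
  filter_upwards [hF.eventually_analyticAt, hG.eventually_analyticAt] with q h1 h2
  simp only [partialDeriv, Pi.add_apply]
  rw [fderiv_add h1.differentiableAt h2.differentiableAt]
  rfl

lemma partialDeriv_smul (i : Fin 2) {p : Fin 2 → ℂ} (c : ℂ) (hF : AnalyticAt ℂ F p) :
    partialDeriv i (c • F) =ᶠ[𝓝 p] c • partialDeriv i F := by
  filter_upwards [hF.eventually_analyticAt] with q h1
  simp only [partialDeriv, Pi.smul_apply]
  rw [fderiv_const_smul h1.differentiableAt]
  rfl

lemma iterate_partialDeriv_add (i : Fin 2) {p : Fin 2 → ℂ} (hF : AnalyticAt ℂ F p)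
    (hG : AnalyticAt ℂ G p) (n : ℕ) : (partialDeriv i)^[n] (F + G) =ᶠ[𝓝 p]
      (partialDeriv i)^[n] F + (partialDeriv i)^[n] G := by
  induction n with
  | zero => rfl
  | succ n ih =>
    simp only [Function.iterate_succ_apply']
    exact (partialDeriv_congr i ih).trans (partialDeriv_add i
      (analyticAt_iterate_partialDeriv i hF n) (analyticAt_iterate_partialDeriv i hG n))

lemma iterate_partialDeriv_smul (i : Fin 2) {p : Fin 2 → ℂ} (c : ℂ) (hF : AnalyticAt ℂ F p)
    (n : ℕ) : (partialDeriv i)^[n] (c • F) =ᶠ[𝓝 p] c • (partialDeriv i)^[n] F := by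
  induction n with
  | zero => rfl
  | succ n ih =>
    simp only [Function.iterate_succ_apply']
    exact (partialDeriv_congr i ih).trans (partialDeriv_smul i c
      (analyticAt_iterate_partialDeriv i hF n))

/-- A coordinate function. -/
def coordFun (i : Fin 2) : (Fin 2 → ℂ) → ℂ := fun q => q i

lemma analyticAt_coordFun (i : Fin 2) (p : Fin 2 → ℂ) : AnalyticAt ℂ (coordFun i) p :=
  (coordForm i).analyticAt p

lemma partialDeriv_coordFun_mul (i j : Fin 2) {p : Fin 2 → ℂ} (hF : AnalyticAt ℂ F p) :
    partialDeriv i (coordFun j * F) =ᶠ[𝓝 p]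
      (if i = j then (1 : ℂ) else 0) • F + coordFun j * partialDeriv i F := by
  filter_upwards [hF.eventually_analyticAt] with q h1
  have h2 : HasFDerivAt (coordFun j) (coordForm j) q := (coordForm j).hasFDerivAt
  simp only [partialDeriv, Pi.add_apply, Pi.mul_apply, Pi.smul_apply]
  rw [(h2.mul h1.differentiableAt.hasFDerivAt).fderiv]
  by_cases hij : i = j
  · subst hij
    simp [add_comm]
  · simp [hij]

lemma iterate_partialDeriv_coordFun_mul_of_ne {i j : Fin 2} (hij : i ≠ j) {p : Fin 2 → ℂ}
    (hF : AnalyticAt ℂ F p) (n : ℕ) : (partialDeriv i)^[n] (coordFun j * F) =ᶠ[𝓝 p]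
      coordFun j * (partialDeriv i)^[n] F := by
  induction n with
  | zero => rfl
  | succ n ih =>
    simp only [Function.iterate_succ_apply']
    refine (partialDeriv_congr i ih).trans ((partialDeriv_coordFun_mul i j
      (analyticAt_iterate_partialDeriv i hF n)).trans ?_)
    rw [if_neg hij, zero_smul, zero_add]

lemma iterate_partialDeriv_coordFun_mul_self (i : Fin 2) {p : Fin 2 → ℂ}
    (hF : AnalyticAt ℂ F p) (n : ℕ) : (partialDeriv i)^[n + 1] (coordFun i * F) =ᶠ[𝓝 p]
      ((n : ℂ) + 1) • (partialDeriv i)^[n] F + coordFun i * (partialDeriv i)^[n + 1] F := by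
  induction n with
  | zero =>
    have := partialDeriv_coordFun_mul i i hF
    rw [if_pos rfl] at this
    simpa using this
  | succ n ih =>
    rw [Function.iterate_succ_apply']
    refine (partialDeriv_congr i ih).trans ?_
    have hn := analyticAt_iterate_partialDeriv i hF n
    have hn1 := analyticAt_iterate_partialDeriv i hF (n + 1)
    refine (partialDeriv_add i (analyticAt_smul_const _ hn)
      ((analyticAt_coordFun i p).mul hn1)).trans ?_
    filter_upwards [partialDeriv_smul i ((n : ℂ) + 1) hn, partialDeriv_coordFun_mul i i hn1]
      with q h1 h2
    rw [if_pos rfl] at h2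
    simp only [Pi.add_apply, Pi.smul_apply, smul_eq_mul, Pi.mul_apply] at h1 h2 ⊢
    rw [h1, h2]
    simp only [Function.iterate_succ_apply']
    push_cast
    ring

lemma partialDeriv_partialDeriv {p : Fin 2 → ℂ} (hF : AnalyticAt ℂ F p) (k l : Fin 2) :
    partialDeriv k (partialDeriv l F) p =
      fderiv ℂ (fderiv ℂ F) p (Pi.single k 1) (Pi.single l 1) := by
  have h1 : HasFDerivAt (fderiv ℂ F) (fderiv ℂ (fderiv ℂ F) p) p :=
    hF.fderiv.differentiableAt.hasFDerivAt
  have h2 : HasFDerivAt (partialDeriv l F) _ p :=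
    (ContinuousLinearMap.apply ℂ ℂ (Pi.single l 1 : Fin 2 → ℂ)).hasFDerivAt.comp p h1
  rw [partialDeriv, h2.fderiv]
  rfl

lemma partialDeriv_comm {p : Fin 2 → ℂ} (hF : AnalyticAt ℂ F p) (i j : Fin 2) :
    partialDeriv i (partialDeriv j F) =ᶠ[𝓝 p] partialDeriv j (partialDeriv i F) := by
  filter_upwards [hF.eventually_analyticAt] with q hq
  have hsymm : IsSymmSndFDerivAt ℂ F q :=
    (hq.contDiffAt (n := 2)).isSymmSndFDerivAt (by simp)
  rw [partialDeriv_partialDeriv hq, partialDeriv_partialDeriv hq]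
  exact hsymm _ _

lemma iterate_partialDeriv_comm {p : Fin 2 → ℂ} (hF : AnalyticAt ℂ F p) (i j : Fin 2) (n : ℕ) :
    (partialDeriv i)^[n] (partialDeriv j F) =ᶠ[𝓝 p] partialDeriv j ((partialDeriv i)^[n] F) := by
  induction n with
  | zero => rfl
  | succ n ih =>
    simp only [Function.iterate_succ_apply']
    exact (partialDeriv_congr i ih).trans
      (partialDeriv_comm (analyticAt_iterate_partialDeriv i hF n) i j)

/-- The Taylor coefficients at the origin. -/
def taylorCoeff (F : (Fin 2 → ℂ) → ℂ) (i j : ℕ) : ℂ :=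
  (partialDeriv 0)^[i] ((partialDeriv 1)^[j] F) 0 / (i.factorial * j.factorial)

lemma taylorCoeff_congr (h : F =ᶠ[𝓝 0] G) (i j : ℕ) : taylorCoeff F i j = taylorCoeff G i j := by
  rw [taylorCoeff, taylorCoeff, (iterate_partialDeriv_congr 0
    (iterate_partialDeriv_congr 1 h j) i).self_of_nhds]

lemma taylorCoeff_zero (i j : ℕ) : taylorCoeff 0 i j = 0 := by
  have h : ∀ (k : Fin 2) (n : ℕ), (partialDeriv k)^[n] (0 : (Fin 2 → ℂ) → ℂ) = 0 := by
    intro k n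
    induction n with
    | zero => rfl
    | succ n ih =>
      rw [Function.iterate_succ_apply', ih]
      funext q
      simp [partialDeriv]
  rw [taylorCoeff, h, h]
  simp

lemma taylorCoeff_add (hF : AnalyticAt ℂ F 0) (hG : AnalyticAt ℂ G 0) (i j : ℕ) :
    taylorCoeff (F + G) i j = taylorCoeff F i j + taylorCoeff G i j := by
  rw [taylorCoeff, (iterate_partialDeriv_congr 0 (iterate_partialDeriv_add 1 hF hG j)
    i).self_of_nhds, (iterate_partialDeriv_add 0 (analyticAt_iterate_partialDeriv 1 hF j)
    (analyticAt_iterate_partialDeriv 1 hG j) i).self_of_nhds, Pi.add_apply, add_div]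
  rfl

lemma taylorCoeff_smul (c : ℂ) (hF : AnalyticAt ℂ F 0) (i j : ℕ) :
    taylorCoeff (c • F) i j = c * taylorCoeff F i j := by
  rw [taylorCoeff, (iterate_partialDeriv_congr 0 (iterate_partialDeriv_smul 1 c hF j)
    i).self_of_nhds, (iterate_partialDeriv_smul 0 c (analyticAt_iterate_partialDeriv 1 hF j)
    i).self_of_nhds, Pi.smul_apply, smul_eq_mul, mul_div_assoc]
  rfl

lemma taylorCoeff_coord_zero_mul (hF : AnalyticAt ℂ F 0) (i j : ℕ) :
    taylorCoeff (coordFun 0 * F) i j = if 1 ≤ i then taylorCoeff F (i - 1) j else 0 := by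
  have h1 := analyticAt_iterate_partialDeriv 1 hF j
  rw [taylorCoeff, (iterate_partialDeriv_congr 0 (iterate_partialDeriv_coordFun_mul_of_ne
    (show (1 : Fin 2) ≠ 0 by decide) hF j) i).self_of_nhds]
  cases i with
  | zero => simp [coordFun]
  | succ i =>
    rw [(iterate_partialDeriv_coordFun_mul_self 0 h1 i).self_of_nhds, if_pos (by omega),
      taylorCoeff, Nat.add_sub_cancel, Nat.factorial_succ]
    have hi : (i : ℂ) + 1 ≠ 0 := Nat.cast_add_one_ne_zero i
    simp only [Pi.add_apply, Pi.smul_apply, Pi.mul_apply, coordFun, Pi.zero_apply, zero_mul,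
      add_zero, smul_eq_mul]
    push_cast
    rw [mul_assoc, mul_div_mul_left _ _ hi]

lemma taylorCoeff_coord_one_mul (hF : AnalyticAt ℂ F 0) (i j : ℕ) :
    taylorCoeff (coordFun 1 * F) i j = if 1 ≤ j then taylorCoeff F i (j - 1) else 0 := by
  cases j with
  | zero =>
    rw [taylorCoeff, Function.iterate_zero, id, (iterate_partialDeriv_coordFun_mul_of_ne
      (show (0 : Fin 2) ≠ 1 by decide) hF i).self_of_nhds]
    simp [coordFun]
  | succ j =>
    have h1 := analyticAt_iterate_partialDeriv 1 hF j
    have h2 := analyticAt_iterate_partialDeriv 1 hF (j + 1)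
    rw [taylorCoeff, (iterate_partialDeriv_congr 0 (iterate_partialDeriv_coordFun_mul_self 1 hF j)
      i).self_of_nhds, (iterate_partialDeriv_add 0 (analyticAt_smul_const _ h1)
      ((analyticAt_coordFun 1 0).mul h2) i).self_of_nhds, Pi.add_apply,
      (iterate_partialDeriv_smul 0 _ h1 i).self_of_nhds, (iterate_partialDeriv_coordFun_mul_of_ne
      (show (0 : Fin 2) ≠ 1 by decide) h2 i).self_of_nhds, if_pos (by omega),
      taylorCoeff, Nat.add_sub_cancel, Nat.factorial_succ]
    have hj : (j : ℂ) + 1 ≠ 0 := Nat.cast_add_one_ne_zero j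
    simp only [Pi.smul_apply, Pi.mul_apply, coordFun, Pi.zero_apply, zero_mul,
      add_zero, smul_eq_mul]
    push_cast
    rw [mul_left_comm, mul_div_mul_left _ _ hj]

lemma taylorCoeff_partialDeriv_zero (hF : AnalyticAt ℂ F 0) (i j : ℕ) :
    taylorCoeff (partialDeriv 0 F) i j = (i + 1) * taylorCoeff F (i + 1) j := by
  rw [taylorCoeff, (iterate_partialDeriv_congr 0 (iterate_partialDeriv_comm hF 1 0 j)
    i).self_of_nhds, ← Function.iterate_succ_apply, taylorCoeff, Nat.factorial_succ]
  have hi : (i : ℂ) + 1 ≠ 0 := Nat.cast_add_one_ne_zero i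
  push_cast
  rw [mul_assoc, ← mul_div_assoc, mul_div_mul_left _ _ hi]

lemma taylorCoeff_partialDeriv_one (i j : ℕ) :
    taylorCoeff (partialDeriv 1 F) i j = (j + 1) * taylorCoeff F i (j + 1) := by
  rw [taylorCoeff, ← Function.iterate_succ_apply, taylorCoeff, Nat.factorial_succ]
  have hj : (j : ℂ) + 1 ≠ 0 := Nat.cast_add_one_ne_zero j
  push_cast
  rw [mul_left_comm, ← mul_div_assoc, mul_div_mul_left _ _ hj]

end Taylor

/-! ### The recurrence for the Taylor coefficients of a first integral. -/

section Recurrence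

/-- The Taylor coefficients of `(a + b x + c y + d x² + e x y + f y²) G` in terms of those
of `G`. -/
def quadShift (a b c d e f : ℂ) (g : ℕ → ℕ → ℂ) (i j : ℕ) : ℂ :=
  a * g i j + b * (if 1 ≤ i then g (i - 1) j else 0) + c * (if 1 ≤ j then g i (j - 1) else 0) +
    d * (if 2 ≤ i then g (i - 2) j else 0) + e * (if 1 ≤ i ∧ 1 ≤ j then g (i - 1) (j - 1) else 0) +
    f * (if 2 ≤ j then g i (j - 2) else 0)

lemma taylorCoeff_quad_mul {G : (Fin 2 → ℂ) → ℂ} (hG : AnalyticAt ℂ G 0) (a b c d e f : ℂ)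
    (i j : ℕ) : taylorCoeff (fun q => eval q (quad a b c d e f) * G q) i j =
      quadShift a b c d e f (taylorCoeff G) i j := by
  have hx := (analyticAt_coordFun 0 0).mul hG
  have hy := (analyticAt_coordFun 1 0).mul hG
  have hxx := (analyticAt_coordFun 0 0).mul hx
  have hxy := (analyticAt_coordFun 0 0).mul hy
  have hyy := (analyticAt_coordFun 1 0).mul hy
  have s1 := analyticAt_smul_const a hG
  have s2 := analyticAt_smul_const b hx
  have s3 := analyticAt_smul_const c hy
  have s4 := analyticAt_smul_const d hxx
  have s5 := analyticAt_smul_const e hxy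
  have s6 := analyticAt_smul_const f hyy
  have heq : (fun q => eval q (quad a b c d e f) * G q) = a • G + b • (coordFun 0 * G) +
      c • (coordFun 1 * G) + d • (coordFun 0 * (coordFun 0 * G)) +
      e • (coordFun 0 * (coordFun 1 * G)) + f • (coordFun 1 * (coordFun 1 * G)) := by
    funext q
    simp only [eval_quad, Pi.add_apply, Pi.smul_apply, Pi.mul_apply, coordFun, smul_eq_mul]
    ring
  have hii : ∀ i : ℕ, (1 ≤ i ∧ 1 ≤ i - 1) ↔ 2 ≤ i := fun i => by omega
  rw [heq, taylorCoeff_add ((((s1.add s2).add s3).add s4).add s5) s6,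
    taylorCoeff_add (((s1.add s2).add s3).add s4) s5, taylorCoeff_add ((s1.add s2).add s3) s4,
    taylorCoeff_add (s1.add s2) s3, taylorCoeff_add s1 s2, taylorCoeff_smul a hG,
    taylorCoeff_smul b hx, taylorCoeff_smul c hy, taylorCoeff_smul d hxx, taylorCoeff_smul e hxy,
    taylorCoeff_smul f hyy, taylorCoeff_coord_zero_mul hx, taylorCoeff_coord_zero_mul hy,
    taylorCoeff_coord_one_mul hy, taylorCoeff_coord_zero_mul hG, taylorCoeff_coord_one_mul hG,
    taylorCoeff_coord_one_mul hG, taylorCoeff_coord_zero_mul hG, taylorCoeff_coord_one_mul hG]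
  simp only [← ite_and, hii, Nat.sub_sub]
  rfl

/-- The equation `V f = 0` in terms of Taylor coefficients, `V` a quadratic vector field with
components `∑ v_i m_i`, `∑ w_i m_i`. -/
def TaylorRec (v w : Fin 6 → ℂ) (t : ℕ → ℕ → ℂ) : Prop :=
  ∀ i j, quadShift (v 0) (v 1) (v 2) (v 3) (v 4) (v 5) (fun i j => (i + 1) * t (i + 1) j) i j +
    quadShift (w 0) (w 1) (w 2) (w 3) (w 4) (w 5) (fun i j => (j + 1) * t i (j + 1)) i j = 0

lemma taylorRec_of_fderiv_eq_zero {f : (Fin 2 → ℂ) → ℂ} (hf : AnalyticAt ℂ f 0) {V : VField ℂ}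
    (v w : Fin 6 → ℂ) (hv : V 0 = quad (v 0) (v 1) (v 2) (v 3) (v 4) (v 5))
    (hw : V 1 = quad (w 0) (w 1) (w 2) (w 3) (w 4) (w 5))
    (h : ∀ᶠ q in 𝓝 0, fderiv ℂ f q (V.evalAt q) = 0) : TaylorRec v w (taylorCoeff f) := by
  have h0 := analyticAt_partialDeriv 0 hf
  have h1 := analyticAt_partialDeriv 1 hf
  have heq : (fun q => eval q (V 0) * partialDeriv 0 f q) +
      (fun q => eval q (V 1) * partialDeriv 1 f q) =ᶠ[𝓝 0] 0 := by
    filter_upwards [h] with q hq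
    have hdec : V.evalAt q = eval q (V 0) • (Pi.single 0 1 : Fin 2 → ℂ) +
        eval q (V 1) • (Pi.single 1 1 : Fin 2 → ℂ) := by
      funext i
      fin_cases i <;> simp [VField.evalAt]
    rw [hdec, map_add, map_smul, map_smul] at hq
    exact hq
  intro i j
  have e0 : (fun i j : ℕ => ((i : ℂ) + 1) * taylorCoeff f (i + 1) j) =
      taylorCoeff (partialDeriv 0 f) := by
    funext i j
    rw [taylorCoeff_partialDeriv_zero hf]
  have e1 : (fun i j : ℕ => ((j : ℂ) + 1) * taylorCoeff f i (j + 1)) =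
      taylorCoeff (partialDeriv 1 f) := by
    funext i j
    rw [taylorCoeff_partialDeriv_one]
  rw [e0, e1, ← taylorCoeff_quad_mul h0, ← taylorCoeff_quad_mul h1, ← hv, ← hw,
    ← taylorCoeff_add, taylorCoeff_congr heq, taylorCoeff_zero]
  · exact (analyticAt_eval (V 0) 0).mul h0
  · exact (analyticAt_eval (V 1) 0).mul h1

end Recurrence

/-! ### The saddle quantities in degrees four, six and eight. -/

section Lyapunov

/-- The recurrence for the vector field
`x' = x + a x² + b x y + c y²`, `y' = -(y + a' y² + b' x y + c' x²)`. -/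
lemma TaylorRec.saddle {a b c a' b' c' : ℂ} {t : ℕ → ℕ → ℂ}
    (h : TaylorRec ![0, 1, 0, a, b, c] ![0, 0, -1, -c', -b', -a'] t) (i j : ℕ) :
    ((i : ℂ) - j) * t i j + (if 1 ≤ i then (a * (i - 1) - b' * j) * t (i - 1) j else 0) +
      (if 1 ≤ j then (b * i - a' * (j - 1)) * t i (j - 1) else 0) +
      (if 2 ≤ j then c * (i + 1) * t (i + 1) (j - 2) else 0) -
      (if 2 ≤ i then c' * (j + 1) * t (i - 2) (j + 1) else 0) = 0 := by
  have := h i j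
  simp only [quadShift, Matrix.cons_val_zero, Matrix.cons_val_one, Matrix.cons_val] at this
  rcases i with _ | _ | i <;> rcases j with _ | _ | j <;> simp at this ⊢ <;>
    linear_combination this

variable {a b c a' b' c' s : ℂ} {t : ℕ → ℕ → ℂ}

/-- The first saddle quantity, from the terms of degree four. -/
lemma first_saddle_quantity
    (h : TaylorRec ![0, 1, 0, a, b, c] ![0, 0, -1, -c', -b', -a'] t) :
    (a * b - a' * b') * t 1 1 = 0 := by
  have h := h.saddle
  -- At i = j the coefficient of `t i j` vanishes, so the equation (2, 2) is a condition on lower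
  -- coefficients. The nonresonant equations serve to eliminate all of these except `t 1 1`; the
  -- multipliers are those of this back-substitution.
  have e22 := h 2 2
  have e03 := h 0 3
  have e12 := h 1 2
  have e21 := h 2 1
  have e30 := h 3 0
  have e02 := h 0 2
  have e20 := h 2 0
  have e01 := h 0 1
  have e10 := h 1 0
  simp only [Nat.cast_ofNat, Nat.cast_zero, Nat.cast_one, Nat.reduceLeDiff, le_refl, Nat.reduceSub,
    ↓reduceIte] at e22 e03 e12 e21 e30 e02 e20 e01 e10
  linear_combination
    (-1) * (
      ((1)) * e22 + ((-1)*c') * e03 + ((1)*a + (-2)*b') * e12 + ((1)*a' + (-2)*b) * e21 +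
      ((-1)*c) * e30 + ((-1)*a*b' + (2)*b*c' + (2)*b'^2) * e02 + ((-1)*a'*b + (2)*b^2 + (2)*b'*c)
      * e20 + ((1)*a*a'*b' + (-1)*a'*b*c' + (-2)*a'*b'^2 + (-2)*b^2*c' + (-2)*b'*c*c') * e01 +
      ((1)*a*a'*b + (-2)*a*b^2 + (-1)*a*b'*c + (-2)*b*c*c' + (-2)*b'^2*c) * e10)

/-- The second saddle quantity, from the terms of degree six, if `a = s b'`, `a' = s b`. -/
lemma second_saddle_quantity
    (h : TaylorRec ![0, 1, 0, s * b', b, c] ![0, 0, -1, -c', -b', -(s * b)] t) :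
    ((s + 2) * (2 * s - 1) * (c * b' ^ 3 - c' * b ^ 3)) * t 1 1 = 0 := by
  have h := h.saddle
  -- The same elimination from the resonant equation (3, 3). The coefficient of `t 2 2`, which no
  -- equation determines, is a multiple of the first saddle quantity and vanishes because a = s b',
  -- a' = s b.
  have e33 := h 3 3
  have e14 := h 1 4
  have e23 := h 2 3
  have e32 := h 3 2
  have e41 := h 4 1
  have e04 := h 0 4
  have e13 := h 1 3
  have e31 := h 3 1
  have e40 := h 4 0
  have e03 := h 0 3
  have e12 := h 1 2
  have e21 := h 2 1
  have e30 := h 3 0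
  have e02 := h 0 2
  have e20 := h 2 0
  have e01 := h 0 1
  have e10 := h 1 0
  simp only [Nat.cast_ofNat, Nat.cast_zero, Nat.cast_one, Nat.reduceLeDiff, le_refl, Nat.reduceSub,
    ↓reduceIte] at e33 e14 e23 e32 e41 e04 e13 e31 e40 e03 e12 e21 e30 e02 e20 e01
  simp only [Nat.cast_zero, Nat.cast_one, Nat.reduceLeDiff, le_refl, Nat.reduceSub,
    ↓reduceIte] at e10
  linear_combination
    (-3) * (
      ((1)) * e33 + ((-4/3)*c') * e14 + ((2)*s*b' + (-3)*b') * e23 + ((2)*s*b + (-3)*b) * e32 +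
      ((-4/3)*c) * e41 + ((-2)*s*b'*c' + (13/3)*b'*c') * e04 + ((1)*s^2*b'^2 + (-1)*s*b*c' +
      (-9/2)*s*b'^2 + (23/6)*b*c' + (9/2)*b'^2) * e13 + ((1)*s^2*b^2 + (-9/2)*s*b^2 + (-1)*s*b'*c
      + (9/2)*b^2 + (23/6)*b'*c) * e31 + ((-2)*s*b*c + (13/3)*b*c) * e40 + ((2)*s^2*b*b'*c' +
      (-1)*s^2*b'^3 + (-10/3)*s*b*b'*c' + (9/2)*s*b'^3 + (-23/6)*b*b'*c' + (-9/2)*b'^3) * e03 +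
      ((-2)*s^3*b*b'^2 + (10)*s^2*b*b'^2 + (1/3)*s*b^2*c' + (-27/2)*s*b*b'^2 + (-31/6)*b^2*c' +
      (9/2)*b*b'^2 + (-10/3)*b'*c*c') * e12 + ((-2)*s^3*b^2*b' + (10)*s^2*b^2*b' +
      (-27/2)*s*b^2*b' + (1/3)*s*b'^2*c + (9/2)*b^2*b' + (-10/3)*b*c*c' + (-31/6)*b'^2*c) * e21 +
      ((-1)*s^2*b^3 + (2)*s^2*b*b'*c + (9/2)*s*b^3 + (-10/3)*s*b*b'*c + (-9/2)*b^3 +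
      (-23/6)*b*b'*c) * e30 + ((3)*s^3*b*b'^3 + (-20/3)*s^2*b^2*b'*c' + (-29/2)*s^2*b*b'^3 +
      (17)*s*b^2*b'*c' + (18)*s*b*b'^3 + (-1/3)*s*b'^2*c*c' + (2/3)*b^2*b'*c' + (-9/2)*b*b'^3 +
      (10/3)*b*c*c'^2 + (17/2)*b'^2*c*c') * e02 + ((3)*s^3*b^3*b' + (-29/2)*s^2*b^3*b' +
      (-20/3)*s^2*b*b'^2*c + (18)*s*b^3*b' + (-1/3)*s*b^2*c*c' + (17)*s*b*b'^2*c + (-9/2)*b^3*b'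
      + (17/2)*b^2*c*c' + (2/3)*b*b'^2*c + (10/3)*b'*c^2*c') * e20 + ((-3)*s^4*b^2*b'^3 +
      (11/3)*s^3*b^3*b'*c' + (29/2)*s^3*b^2*b'^3 + (-5/2)*s^2*b^3*b'*c' + (-18)*s^2*b^2*b'^3 +
      (7)*s^2*b*b'^2*c*c' + (-56/3)*s*b^3*b'*c' + (9/2)*s*b^2*b'^3 + (-3)*s*b^2*c*c'^2 +
      (-51/2)*s*b*b'^2*c*c' + (9/2)*b^3*b'*c' + (-17/2)*b^2*c*c'^2 + (-2/3)*b*b'^2*c*c' +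
      (-10/3)*b'*c^2*c'^2) * e01 + ((-3)*s^4*b^3*b'^2 + (29/2)*s^3*b^3*b'^2 + (11/3)*s^3*b*b'^3*c
      + (-18)*s^2*b^3*b'^2 + (7)*s^2*b^2*b'*c*c' + (-5/2)*s^2*b*b'^3*c + (9/2)*s*b^3*b'^2 +
      (-51/2)*s*b^2*b'*c*c' + (-56/3)*s*b*b'^3*c + (-3)*s*b'^2*c^2*c' + (-2/3)*b^2*b'*c*c' +
      (9/2)*b*b'^3*c + (-10/3)*b*c^2*c'^2 + (-17/2)*b'^2*c^2*c') * e10)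

/-- The third saddle quantity, from the terms of degree eight, if `a = -2 b'`, `a' = -2 b`. -/
lemma third_saddle_quantity
    (h : TaylorRec ![0, 1, 0, -2 * b', b, c] ![0, 0, -1, -c', -b', -(-2 * b)] t) :
    ((b * b' - c * c') * (c * b' ^ 3 - c' * b ^ 3)) * t 1 1 = 0 := by
  have h := h.saddle
  -- Elimination from the resonant equation (4, 4). The free coefficients `t 2 2` and `t 3 3`
  -- cancel, as the first two saddle quantities vanish for s = -2.
  have e44 := h 4 4
  have e25 := h 2 5
  have e34 := h 3 4
  have e43 := h 4 3
  have e52 := h 5 2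
  have e06 := h 0 6
  have e15 := h 1 5
  have e24 := h 2 4
  have e42 := h 4 2
  have e51 := h 5 1
  have e60 := h 6 0
  have e05 := h 0 5
  have e14 := h 1 4
  have e23 := h 2 3
  have e32 := h 3 2
  have e41 := h 4 1
  have e50 := h 5 0
  have e04 := h 0 4
  have e13 := h 1 3
  have e31 := h 3 1
  have e40 := h 4 0
  have e03 := h 0 3
  have e12 := h 1 2
  have e21 := h 2 1
  have e30 := h 3 0
  have e02 := h 0 2
  have e20 := h 2 0
  have e01 := h 0 1
  have e10 := h 1 0
  simp only [Nat.cast_ofNat, Nat.cast_zero, Nat.cast_one, Nat.reduceLeDiff, le_refl, Nat.reduceSub,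
    ↓reduceIte] at e44 e25 e34 e43 e52 e06 e15 e24 e42 e51 e60 e05 e14 e23 e32 e41
  simp only [Nat.cast_ofNat, Nat.cast_zero, Nat.cast_one, Nat.reduceLeDiff, le_refl, Nat.reduceSub,
    ↓reduceIte] at e50 e04 e13 e31 e40 e03 e12 e21 e30 e02 e20 e01 e10
  linear_combination
    (-8 / 25) * (
      ((1)) * e44 + ((-5/3)*c') * e25 + ((-10)*b') * e34 + ((-10)*b) * e43 + ((-5/3)*c) * e52 +
      ((5/3)*c'^2) * e06 + ((185/12)*b'*c') * e15 + ((35/3)*b*c' + (40)*b'^2) * e24 + ((40)*b^2 +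
      (35/3)*b'*c) * e42 + ((185/12)*b*c) * e51 + ((5/3)*c^2) * e60 + ((-25/3)*b*c'^2 +
      (-665/12)*b'^2*c') * e05 + ((275/12)*b*b'*c' + (-80)*b'^3 + (5/9)*c*c'^2) * e14 +
      ((-80/3)*b^2*c' + (320)*b*b'^2 + (-25/6)*b'*c*c') * e23 + ((320)*b^2*b' + (-25/6)*b*c*c' +
      (-80/3)*b'^2*c) * e32 + ((-80)*b^3 + (275/12)*b*b'*c + (5/9)*c^2*c') * e41 +
      ((-665/12)*b^2*c + (-25/3)*b'*c^2) * e50 + ((10)*b^2*c'^2 + (-1815/4)*b*b'^2*c' + (80)*b'^4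
      + (65/18)*b'*c*c'^2) * e04 + ((-2665/8)*b^2*b'*c' + (-1080)*b*b'^3 + (145/36)*b*c*c'^2 +
      (545/24)*b'^2*c*c') * e13 + ((-1080)*b^3*b' + (545/24)*b^2*c*c' + (-2665/8)*b*b'^2*c +
      (145/36)*b'*c^2*c') * e31 + ((80)*b^4 + (-1815/4)*b^2*b'*c + (65/18)*b*c^2*c' +
      (10)*b'^2*c^2) * e40 + ((20)*b^3*c'^2 + (-4595/8)*b^2*b'^2*c' + (1240)*b*b'^4 +
      (115/36)*b*b'*c*c'^2 + (-545/24)*b'^3*c*c') * e03 + ((3955/8)*b^3*b'*c' + (-5400)*b^2*b'^3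
      + (-275/18)*b^2*c*c'^2 + (7825/24)*b*b'^2*c*c' + (80)*b'^4*c + (-40/9)*b'*c^2*c'^2) * e12 +
      ((80)*b^4*c' + (-5400)*b^3*b'^2 + (7825/24)*b^2*b'*c*c' + (3955/8)*b*b'^3*c +
      (-40/9)*b*c^2*c'^2 + (-275/18)*b'^2*c^2*c') * e21 + ((1240)*b^4*b' + (-545/24)*b^3*c*c' +
      (-4595/8)*b^2*b'^2*c + (115/36)*b*b'*c^2*c' + (20)*b'^3*c^2) * e30 + ((-40)*b^4*c'^2 +
      (30055/8)*b^3*b'^2*c' + (7880)*b^2*b'^4 + (-2435/8)*b^2*b'*c*c'^2 + (-5195/6)*b*b'^3*c*c' +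
      (40/9)*b*c^2*c'^3 + (-80)*b'^5*c + (355/18)*b'^2*c^2*c'^2) * e02 + ((-80)*b^5*c' +
      (7880)*b^4*b'^2 + (-5195/6)*b^3*b'*c*c' + (30055/8)*b^2*b'^3*c + (355/18)*b^2*c^2*c'^2 +
      (-2435/8)*b*b'^2*c^2*c' + (-40)*b'^4*c^2 + (40/9)*b'*c^3*c'^2) * e20 +
      ((-1465/4)*b^4*b'^2*c' + (15760)*b^3*b'^4 + (3085/12)*b^3*b'*c*c'^2 +
      (-131725/24)*b^2*b'^3*c*c' + (-65/6)*b^2*c^2*c'^3 + (-160)*b*b'^5*c +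
      (24755/72)*b*b'^2*c^2*c'^2 + (40)*b'^4*c^2*c' + (-40/9)*b'*c^3*c'^3) * e01 +
      ((-160)*b^5*b'*c' + (15760)*b^4*b'^3 + (40)*b^4*c*c'^2 + (-131725/24)*b^3*b'^2*c*c' +
      (-1465/4)*b^2*b'^4*c + (24755/72)*b^2*b'*c^2*c'^2 + (3085/12)*b*b'^3*c^2*c' +
      (-40/9)*b*c^3*c'^3 + (-65/6)*b'^2*c^3*c'^2) * e10)

end Lyapunov

/-! ### Morse integrals: affine changes, trace zero, nonzero coefficient of xy. -/

section MorseIntegral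

/-- Near `p` there is a holomorphic first integral with a Morse critical point at `p`. -/
def HasMorseIntegral (V : VField ℂ) (p : Fin 2 → ℂ) : Prop :=
  ∃ f : (Fin 2 → ℂ) → ℂ, AnalyticAt ℂ f p ∧
    (∀ᶠ q in 𝓝 p, fderiv ℂ f q (V.evalAt q) = 0) ∧
    fderiv ℂ f p = 0 ∧ Function.Injective (fderiv ℂ (fderiv ℂ f) p)

/-- The vector field `V` in the coordinates `z`, where `q = M z + p`, multiplied by `det M`. -/
def pullField {K : Type*} [Field K] (M : Matrix (Fin 2) (Fin 2) K) (p : Fin 2 → K)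
    (V : VField K) : VField K :=
  ![C (M 1 1) * affineSubst M p (V 0) - C (M 0 1) * affineSubst M p (V 1),
    C (M 0 0) * affineSubst M p (V 1) - C (M 1 0) * affineSubst M p (V 0)]

/-- The pulled-back field is adj(M) V(M z + p); using the adjugate in place of the inverse keeps
everything polynomial in M. -/
lemma mulVec_evalAt_pullField (M : Matrix (Fin 2) (Fin 2) ℂ) (p q : Fin 2 → ℂ) (V : VField ℂ) :
    M.mulVec ((pullField M p V).evalAt q) = M.det • V.evalAt (M.mulVec q + p) := by
  funext i
  fin_cases i <;>
  · simp only [VField.evalAt, pullField, Matrix.mulVec, dotProduct, Fin.sum_univ_two,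
      Matrix.det_fin_two, Pi.smul_apply, smul_eq_mul, Matrix.cons_val_zero, Matrix.cons_val_one,
      map_sub, map_mul, eval_C, eval_affineSubst, Fin.zero_eta, Fin.mk_one, Fin.isValue]
    ring

lemma HasMorseIntegral.pull {V : VField ℂ} {p : Fin 2 → ℂ} (h : HasMorseIntegral V p)
    {M : Matrix (Fin 2) (Fin 2) ℂ} (hM : M.det ≠ 0) : HasMorseIntegral (pullField M p V) 0 := by
  obtain ⟨f, hf, hV, h0, hinj⟩ := h
  let L : (Fin 2 → ℂ) →L[ℂ] (Fin 2 → ℂ) := LinearMap.toContinuousLinearMap (Matrix.mulVecLin M)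
  have hL : ∀ q, L q = M.mulVec q := fun q => rfl
  have hu : IsUnit M := (Matrix.isUnit_iff_isUnit_det M).2 (isUnit_iff_ne_zero.2 hM)
  have hLi : Function.Injective L := Matrix.mulVec_injective_iff_isUnit.2 hu
  have hLs : Function.Surjective L := Matrix.mulVec_surjective_iff_isUnit.2 hu
  have hp : L 0 + p = p := by rw [map_zero, zero_add]
  have hφ : ∀ q, HasFDerivAt (fun q => L q + p) L q := fun q => L.hasFDerivAt.add_const p
  have hφa : AnalyticAt ℂ (fun q => L q + p) 0 := (L.analyticAt 0).add analyticAt_const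
  have ht : Filter.Tendsto (fun q => L q + p) (𝓝 0) (𝓝 p) := by
    have := (hφ 0).continuousAt
    rwa [ContinuousAt, hp] at this
  have hd : fderiv ℂ (fun q => f (L q + p)) =ᶠ[𝓝 0] fun q => (fderiv ℂ f (L q + p)).comp L := by
    filter_upwards [ht.eventually hf.eventually_analyticAt] with q hq
    exact (hq.differentiableAt.hasFDerivAt.comp q (hφ q)).fderiv
  refine ⟨fun q => f (L q + p), ?_, ?_, ?_, ?_⟩
  · exact AnalyticAt.fun_comp (by rwa [hp]) hφa
  · filter_upwards [hd, ht.eventually hV] with q hq hVq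
    rw [hq, ContinuousLinearMap.comp_apply, hL ((pullField M p V).evalAt q),
      mulVec_evalAt_pullField, map_smul, ← hL, hVq, smul_zero]
  · rw [hd.self_of_nhds]
    simp only [hp, h0, ContinuousLinearMap.zero_comp]
  · have h2 : HasFDerivAt (fderiv ℂ f) (fderiv ℂ (fderiv ℂ f) p) (L 0 + p) := by
      rw [hp]
      exact hf.fderiv.differentiableAt.hasFDerivAt
    have h3 := ((ContinuousLinearMap.compL ℂ (Fin 2 → ℂ) (Fin 2 → ℂ) ℂ).flip
      L).hasFDerivAt.comp 0 (h2.comp 0 (hφ 0))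
    have h4 := (h3.congr_of_eventuallyEq hd).fderiv
    rw [h4]
    intro x y hxy
    refine hLi (hinj (ContinuousLinearMap.ext fun z => ?_))
    obtain ⟨z, rfl⟩ := hLs z
    exact DFunLike.congr_fun hxy z

/-- The Hessian of a function at a Morse critical point, in terms of Taylor coefficients. -/
lemma hessian_taylorCoeff_ne_zero {f : (Fin 2 → ℂ) → ℂ} (hf : AnalyticAt ℂ f 0)
    (h : Function.Injective (fderiv ℂ (fderiv ℂ f) 0)) :
    4 * taylorCoeff f 2 0 * taylorCoeff f 0 2 - taylorCoeff f 1 1 ^ 2 ≠ 0 := by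
  have e20 : 2 * taylorCoeff f 2 0 = partialDeriv 0 (partialDeriv 0 f) 0 := by
    simp only [taylorCoeff, Nat.factorial, Function.iterate_succ, Function.iterate_zero,
      Function.comp_apply, id]
    norm_num
    ring
  have e11 : taylorCoeff f 1 1 = partialDeriv 0 (partialDeriv 1 f) 0 := by
    simp [taylorCoeff]
  have e11' : taylorCoeff f 1 1 = partialDeriv 1 (partialDeriv 0 f) 0 := by
    rw [e11, (partialDeriv_comm hf 0 1).self_of_nhds]
  have e02 : 2 * taylorCoeff f 0 2 = partialDeriv 1 (partialDeriv 1 f) 0 := by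
    simp only [taylorCoeff, Nat.factorial, Function.iterate_succ, Function.iterate_zero,
      Function.comp_apply, id]
    norm_num
    ring
  rw [partialDeriv_partialDeriv hf] at e20 e11 e11' e02
  generalize taylorCoeff f 2 0 = r at *
  generalize taylorCoeff f 1 1 = s at *
  generalize taylorCoeff f 0 2 = t at *
  set B := fderiv ℂ (fderiv ℂ f) 0
  have key : ∀ x y : ℂ, 2 * r * x + s * y = 0 → s * x + 2 * t * y = 0 → x = 0 ∧ y = 0 := by
    intro x y h1 h2
    have hz : x • (Pi.single 0 1 : Fin 2 → ℂ) + y • (Pi.single 1 1 : Fin 2 → ℂ) = 0 := by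
      refine h ((ContinuousLinearMap.ext fun w => ?_ : B _ = 0).trans (map_zero B).symm)
      have hw : w = w 0 • (Pi.single 0 1 : Fin 2 → ℂ) + w 1 • (Pi.single 1 1 : Fin 2 → ℂ) := by
        funext i
        fin_cases i <;> simp
      rw [hw]
      simp only [map_add, map_smul, add_apply,
        smul_apply, smul_eq_mul, ← e20, ← e11, ← e11', ← e02,
        zero_apply]
      linear_combination w 0 * h1 + w 1 * h2
    have h0 := congrFun hz 0
    have h1 := congrFun hz 1
    simp at h0 h1
    exact ⟨h0, h1⟩
  intro hdet
  obtain ⟨ht, hs⟩ := key (2 * t) (-s) (by linear_combination hdet) (by ring)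
  obtain ⟨-, hr⟩ := key (-s) (2 * r) (by ring) (by linear_combination hdet)
  have := (key 1 0 (by linear_combination hr) (by linear_combination -hs)).1
  exact one_ne_zero this

lemma taylorCoeff_eq_zero_of_fderiv_eq_zero {f : (Fin 2 → ℂ) → ℂ} (h : fderiv ℂ f 0 = 0) :
    taylorCoeff f 1 0 = 0 ∧ taylorCoeff f 0 1 = 0 := by
  constructor <;> simp [taylorCoeff, partialDeriv, h]

/-- A quadratic vector field with a Morse integral has trace zero at the singular point. -/
lemma HasMorseIntegral.trace_eq_zero {V : VField ℂ} {b c d e f b' c' d' e' f' : ℂ}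
    (h : HasMorseIntegral V 0) (h₀ : V 0 = quad 0 b c d e f) (h₁ : V 1 = quad 0 b' c' d' e' f') :
    b + c' = 0 := by
  obtain ⟨F, hF, hV, h0, hinj⟩ := h
  have hrec := taylorRec_of_fderiv_eq_zero hF ![0, b, c, d, e, f] ![0, b', c', d', e', f']
    h₀ h₁ hV
  have hdet := hessian_taylorCoeff_ne_zero hF hinj
  obtain ⟨h10, h01⟩ := taylorCoeff_eq_zero_of_fderiv_eq_zero h0
  have r20 := hrec 2 0
  have r11 := hrec 1 1
  have r02 := hrec 0 2
  simp [quadShift, h10, h01] at r20 r11 r02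
  -- The three equations say that S J is skew, for S the Hessian and J the linear part. With S
  -- symmetric and invertible, J = S⁻¹ (S J) has trace zero.
  refine (mul_eq_zero.1 (?_ : (b + c') * _ = 0)).resolve_right hdet
  linear_combination 2 * taylorCoeff F 0 2 * r20 + 2 * taylorCoeff F 2 0 * r02 -
    taylorCoeff F 1 1 * r11

/-- The recurrence relations of a saddle with a Morse integral have a solution with a non-zero
coefficient of `x y`. -/
lemma HasMorseIntegral.exists_taylorRec {V : VField ℂ} {a b c a' b' c' : ℂ}
    (h : HasMorseIntegral V 0) (h₀ : V 0 = quad 0 1 0 a b c)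
    (h₁ : V 1 = quad 0 0 (-1) (-c') (-b') (-a')) :
    ∃ t, TaylorRec ![0, 1, 0, a, b, c] ![0, 0, -1, -c', -b', -a'] t ∧ t 1 1 ≠ 0 := by
  obtain ⟨F, hF, hV, h0, hinj⟩ := h
  have hrec := taylorRec_of_fderiv_eq_zero hF ![0, 1, 0, a, b, c] ![0, 0, -1, -c', -b', -a']
    h₀ h₁ hV
  refine ⟨_, hrec, fun h11 => hessian_taylorCoeff_ne_zero hF hinj ?_⟩
  obtain ⟨h10, h01⟩ := taylorCoeff_eq_zero_of_fderiv_eq_zero h0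
  -- For eigenvalues 1 and -1 this equation gives `t 2 0 = 0`, so the Hessian determinant is minus
  -- the square of the xy coefficient.
  have r20 := hrec 2 0
  simp [quadShift, h10, h01] at r20
  rw [r20, h11]
  ring

end MorseIntegral

/-! ### Saddles with vanishing saddle quantities and their first integral. -/

section SpecialSaddle

/-- The cubic `2 k (1 - 3 b' x - 3 b y) + …`, `k = b' c'`, of the special saddle. -/
def saddleCubic (b c b' c' : ℂ) : Poly ℂ :=
  quad (2 * (b' * c')) (-6 * (b' * c') * b') (-6 * (b' * c') * b)
      (3 * (b' * c') * (b' ^ 2 - b * c')) (-3 * (b' ^ 2 - b * c') ^ 2)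
      (3 * (b' * c') * (b ^ 2 - b' * c)) +
    X 0 * quad 0 0 0 ((b' ^ 2 - b * c') * b * c' ^ 2)
      (3 * (b' * c') * (b' ^ 2 - b * c') * b + 6 * (b' * c') * (b ^ 2 - b' * c) * c')
      (6 * (b' * c') * (b' ^ 2 - b * c') * c + 3 * (b' * c') * (b ^ 2 - b' * c) * b') +
    X 1 * quad 0 0 0 0 0 (b * (b' * c') * (b ^ 2 - b' * c) - c * (b' ^ 2 - b * c') ^ 2)

/-- The conic of the special saddle. -/
def saddleConic (b c b' c' : ℂ) : Poly ℂ :=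
  quad 1 (-2 * b') (-2 * b) (-(b * c')) (2 * b * b') (-(b' * c))

variable {a b c a' b' c' : ℂ}

/-- This exhibits the first integral of a saddle with a = -2b', a' = -2b. The identity holds only
modulo bb' = cc'; the long factors are the quotients by that relation. -/
lemma inducedField_saddle (h : b * b' = c * c') :
    inducedField (saddleConic b c b' c') (saddleCubic b c b' c') 0 =
        C (6 * (b' ^ 2 + b * c') ^ 2) * quad 0 1 0 (-2 * b') b c ∧
      inducedField (saddleConic b c b' c') (saddleCubic b c b' c') 1 =
        C (6 * (b' ^ 2 + b * c') ^ 2) * quad 0 0 (-1) (-c') (-b') (-(-2 * b)) := by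
  have hC : (C b * C b' : Poly ℂ) = C c * C c' := by rw [← C_mul, h, C_mul]
  simp only [inducedField, saddleConic, saddleCubic, Matrix.cons_val_zero, Matrix.cons_val_one,
    map_add, Derivation.leibniz, pderiv_zero_quad, pderiv_one_quad, smul_eq_mul, pderiv_X_self,
    pderiv_X_of_ne (R := ℂ) (show (0 : Fin 2) ≠ 1 by decide),
    pderiv_X_of_ne (R := ℂ) (show (1 : Fin 2) ≠ 0 by decide)]
  simp only [quad, lin, map_add, map_mul, map_sub, map_neg, map_pow, map_ofNat, map_one, map_zero]
  constructor
  · linear_combination (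
      -6*C b ^ 3*C b'*C c'*X 0*X 1 ^ 3 + 6*C b ^ 3*C c' ^ 2*X 0 ^ 2*X 1 ^ 2 + 6*C b ^ 3*C
      c'*X 1 ^ 3 - 6*C b ^ 2*C b' ^ 2*C c'*X 0 ^ 2*X 1 ^ 2 + 18*C b ^ 2*C b'*C c' ^ 2*X 0 ^
      3*X 1 + 12*C b ^ 2*C b'*C c'*X 0*X 1 ^ 2 + 6*C b*C b' ^ 3*C c'*X 0 ^ 3*X 1 - 12*C b*C
      b' ^ 2*C c*C c'*X 0*X 1 ^ 3 + 12*C b*C b' ^ 2*C c' ^ 2*X 0 ^ 4 + 30*C b*C b' ^ 2*C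
      c'*X 0 ^ 2*X 1 - 24*C b*C b'*C c'*X 0*X 1 + 6*C b' ^ 4*C c*X 0*X 1 ^ 3 - 6*C b' ^ 4*X
      0 ^ 2*X 1 - 24*C b' ^ 3*C c*C c'*X 0 ^ 2*X 1 ^ 2 - 6*C b' ^ 3*C c*X 1 ^ 3 + 24*C b' ^
      3*C c'*X 0 ^ 3 - 12*C b' ^ 2*C c'*X 0 ^ 2) * hC
  · linear_combination (
      -6*C b ^ 3*C b'*C c'*X 1 ^ 4 + 6*C b ^ 3*C c' ^ 2*X 0*X 1 ^ 3 - 6*C b ^ 2*C b' ^ 2*C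
      c'*X 0*X 1 ^ 3 + 18*C b ^ 2*C b'*C c' ^ 2*X 0 ^ 2*X 1 ^ 2 - 24*C b ^ 2*C b'*C c'*X 1 ^
      3 + 6*C b*C b' ^ 3*C c'*X 0 ^ 2*X 1 ^ 2 - 12*C b*C b' ^ 2*C c*C c'*X 1 ^ 4 + 12*C b*C
      b' ^ 2*C c' ^ 2*X 0 ^ 3*X 1 - 30*C b*C b' ^ 2*C c'*X 0*X 1 ^ 2 + 12*C b*C b'*C c'*X 1
      ^ 2 + 6*C b' ^ 4*C c*X 1 ^ 4 + 6*C b' ^ 4*X 0*X 1 ^ 2 - 24*C b' ^ 3*C c*C c'*X 0*X 1 ^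
      3 - 12*C b' ^ 3*C c'*X 0 ^ 2*X 1 + 24*C b' ^ 2*C c'*X 0*X 1) * hC

/-- Modulo bb' = cc', b times this product is c' (c b'³ - c' b³). The second factor keeps the scalar
in `inducedField_saddle` nonzero, the first one is needed for the degree of the cubic. -/
lemma pow_four_sub_ne_zero (h : b * b' = c * c') (hne : c * b' ^ 3 - c' * b ^ 3 ≠ 0) :
    (b' ^ 2 - b * c') * (b' ^ 2 + b * c') ≠ 0 := by
  intro h0
  have h1 : c' * (c * b' ^ 3 - c' * b ^ 3) = 0 := by linear_combination b * h0 - b' ^ 3 * h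
  rcases mul_eq_zero.1 h1 with rfl | h1
  · have hb : b' = 0 := pow_eq_zero_iff (n := 4) (by norm_num) |>.1 (by linear_combination h0)
    subst hb
    simp at hne
  · exact hne h1

lemma coeff_X_zero_mul_expo (F : Poly ℂ) (i j : ℕ) :
    coeff (expo (i + 1) j) (X 0 * F) = coeff (expo i j) F := by
  rw [← coeff_X_mul (expo i j) 0 F]
  congr 1
  ext k
  fin_cases k <;> simp [expo, add_comm]

lemma coeff_X_one_mul_expo (F : Poly ℂ) (i j : ℕ) :
    coeff (expo i (j + 1)) (X 1 * F) = coeff (expo i j) F := by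
  rw [← coeff_X_mul (expo i j) 1 F]
  congr 1
  ext k
  fin_cases k <;> simp [expo, add_comm]

lemma coeff_X_zero_mul_expo_zero (F : Poly ℂ) (j : ℕ) : coeff (expo 0 j) (X 0 * F) = 0 := by
  rw [coeff_X_mul', if_neg]
  simp

lemma coeff_X_one_mul_expo_zero (F : Poly ℂ) (i : ℕ) : coeff (expo i 0) (X 1 * F) = 0 := by
  rw [coeff_X_mul', if_neg]
  simp

lemma totalDegree_saddleConic (hne : c * b' ^ 3 - c' * b ^ 3 ≠ 0) :
    (saddleConic b c b' c').totalDegree = 2 := by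
  refine le_antisymm (totalDegree_quad_le ..) ?_
  by_contra hlt
  have h := totalDegree_le_iff.1 (Nat.lt_succ_iff.1 (not_le.1 hlt))
  have h1 := h 2 0 (by norm_num)
  have h2 := h 0 2 (by norm_num)
  simp [saddleConic, coeff_quad] at h1 h2
  apply hne
  rcases h1 with rfl | rfl <;> rcases h2 with rfl | rfl <;> simp

lemma totalDegree_saddleCubic (h : b * b' = c * c') (hne : c * b' ^ 3 - c' * b ^ 3 ≠ 0) :
    (saddleCubic b c b' c').totalDegree = 3 := by
  refine le_antisymm ?_ ?_
  · have hX : ∀ (i : Fin 2) (F : Poly ℂ), F.totalDegree ≤ 2 → (X i * F).totalDegree ≤ 3 :=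
      fun i F hF => (totalDegree_mul _ _).trans (by rw [totalDegree_X]; omega)
    exact totalDegree_add_le (totalDegree_add_le ((totalDegree_quad_le ..).trans (by norm_num))
      (hX 0 _ (totalDegree_quad_le ..))) (hX 1 _ (totalDegree_quad_le ..))
  · by_contra hlt
    have h' := totalDegree_le_iff.1 (Nat.lt_succ_iff.1 (not_le.1 hlt))
    have h1 := h' 3 0 (by norm_num)
    have h2 := h' 0 3 (by norm_num)
    have hp := left_ne_zero_of_mul (pow_four_sub_ne_zero h hne)
    simp [saddleCubic, coeff_quad, coeff_X_zero_mul_expo, coeff_X_one_mul_expo,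
      coeff_X_zero_mul_expo_zero, coeff_X_one_mul_expo_zero, hp] at h1 h2
    rcases h1 with rfl | rfl
    · have hc : c' = 0 := by
        by_contra hc
        have : c = 0 := by simpa [hc, eq_comm] using h
        subst this
        simp at hne
      subst hc
      have : b' = 0 ∨ c = 0 := by simpa [or_comm] using h2
      rcases this with rfl | rfl <;> simp at hne
    · have hb : b = 0 := by
        by_contra hb
        have : b' = 0 := by simpa [hb] using h
        subst this
        simp at hne
      subst hb
      have : b' = 0 ∨ c = 0 := by simpa [or_comm] using h2
      rcases this with rfl | rfl <;> simp at hne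

/-- `hb` excludes the Lotka–Volterra stratum b = b' = 0. Once the first saddle quantity vanishes,
`hE` excludes the Hamiltonian fields (s = 1/2, divergence zero) and those with c b'³ = c' b³, among
them the reversible ones. The remaining two saddle quantities then leave only s = -2 and bb' = cc'.
-/
lemma HasMorseIntegral.mem_logFields23 {V : VField ℂ} (h : HasMorseIntegral V 0)
    (h₀ : V 0 = quad 0 1 0 a b c) (h₁ : V 1 = quad 0 0 (-1) (-c') (-b') (-a'))
    (hb : b ≠ 0 ∨ b' ≠ 0)
    (hE : (b - 2 * a') * (c' * (b - 2 * a') ^ 2 + b' * (b - 2 * a') * (b' - 2 * a) +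
        a' * (b' - 2 * a) ^ 2) - (b' - 2 * a) * (a * (b - 2 * a') ^ 2 +
        b * (b - 2 * a') * (b' - 2 * a) + c * (b' - 2 * a) ^ 2) ≠ 0) :
    V ∈ logFields23 := by
  obtain ⟨t, ht, ht11⟩ := h.exists_taylorRec h₀ h₁
  have q1 := (mul_eq_zero.1 (first_saddle_quantity ht)).resolve_right ht11
  obtain ⟨s, rfl, rfl⟩ : ∃ s, a = s * b' ∧ a' = s * b := by
    rcases hb with hb | hb
    · exact ⟨a' / b, by field_simp; linear_combination q1, by field_simp⟩
    · exact ⟨a / b', by field_simp, by field_simp; linear_combination -q1⟩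
  -- With a = s b' and a' = s b one has b - 2a' = (1 - 2s) b and b' - 2a = (1 - 2s) b', and the
  -- terms in b² b'² cancel.
  have hE' : (2 * s - 1) ^ 3 * (c * b' ^ 3 - c' * b ^ 3) ≠ 0 := fun h0 =>
    hE (by linear_combination h0)
  have hne := right_ne_zero_of_mul hE'
  have hs := (pow_ne_zero_iff three_ne_zero).1 (left_ne_zero_of_mul hE')
  have q2 := (mul_eq_zero.1 (second_saddle_quantity ht)).resolve_right ht11
  have hs2 := (mul_eq_zero.1 ((mul_eq_zero.1 q2).resolve_right hne)).resolve_right hs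
  obtain rfl : s = -2 := by linear_combination hs2
  have q3 := (mul_eq_zero.1 (third_saddle_quantity ht)).resolve_right ht11
  have hbc : b * b' = c * c' := by linear_combination (mul_eq_zero.1 q3).resolve_right hne
  have hw : 6 * (b' ^ 2 + b * c') ^ 2 ≠ 0 :=
    mul_ne_zero (by norm_num) (pow_ne_zero 2 (right_ne_zero_of_mul (pow_four_sub_ne_zero hbc hne)))
  obtain ⟨i0, i1⟩ := inducedField_saddle hbc
  refine ⟨_, _, totalDegree_saddleConic hne, totalDegree_saddleCubic hbc hne,
    (6 * (b' ^ 2 + b * c') ^ 2)⁻¹, inv_ne_zero hw, funext (Fin.forall_fin_two.2 ⟨?_, ?_⟩)⟩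
  · rw [i0, ← mul_assoc, ← C_mul, inv_mul_cancel₀ hw, C_1, one_mul, h₀]
  · rw [i1, ← mul_assoc, ← C_mul, inv_mul_cancel₀ hw, C_1, one_mul, h₁]

end SpecialSaddle

/-! ### Behaviour of fields, and of ℒ(2,3), under affine changes. -/

section Pull

variable {K : Type*} [Field K]

lemma pullField_inducedField (M : Matrix (Fin 2) (Fin 2) K) (p : Fin 2 → K) (F G : Poly K) :
    pullField M p (inducedField F G) = inducedField (affineSubst M p F) (affineSubst M p G) := by
  refine funext (Fin.forall_fin_two.2 ⟨?_, ?_⟩) <;>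
  · simp only [pullField, inducedField, Matrix.cons_val_zero, Matrix.cons_val_one,
      pderiv_affineSubst, map_sub, map_mul, map_neg, map_ofNat]
    ring

lemma pullField_C_mul (M : Matrix (Fin 2) (Fin 2) K) (p : Fin 2 → K) (c : K) (V : VField K) :
    pullField M p (fun i => C c * V i) = fun i => C c * pullField M p V i := by
  refine funext (Fin.forall_fin_two.2 ⟨?_, ?_⟩) <;>
  · simp only [pullField, Matrix.cons_val_zero, Matrix.cons_val_one, map_mul, algHom_C,
      algebraMap_eq]
    ring

lemma pullField_injective {M : Matrix (Fin 2) (Fin 2) K} (hM : IsUnit M.det) (p : Fin 2 → K) :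
    Function.Injective (pullField M p) := by
  intro V W h
  have h0 : C (M 1 1) * affineSubst M p (V 0) - C (M 0 1) * affineSubst M p (V 1) =
      C (M 1 1) * affineSubst M p (W 0) - C (M 0 1) * affineSubst M p (W 1) := congrFun h 0
  have h1 : C (M 0 0) * affineSubst M p (V 1) - C (M 1 0) * affineSubst M p (V 0) =
      C (M 0 0) * affineSubst M p (W 1) - C (M 1 0) * affineSubst M p (W 0) := congrFun h 1
  have hd : (C M.det : Poly K) ≠ 0 := (isUnit_C_of_ne_zero hM.ne_zero).ne_zero
  have hC : (C M.det : Poly K) = C (M 0 0) * C (M 1 1) - C (M 0 1) * C (M 1 0) := by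
    rw [Matrix.det_fin_two, C_sub, C_mul, C_mul]
  have hinj : Function.Injective (affineSubst M p) := (affineEquiv hM p).injective
  refine funext (Fin.forall_fin_two.2 ⟨hinj (mul_left_cancel₀ hd ?_),
    hinj (mul_left_cancel₀ hd ?_)⟩)
  · rw [hC]
    linear_combination C (M 0 0) * h0 + C (M 0 1) * h1
  · rw [hC]
    linear_combination C (M 1 0) * h0 + C (M 1 1) * h1

lemma mem_logFields23_of_pullField {M : Matrix (Fin 2) (Fin 2) ℂ} (hM : IsUnit M.det)
    (p : Fin 2 → ℂ) {V : VField ℂ} {s : ℂ} (hs : s ≠ 0)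
    (h : (fun i => C s * pullField M p V i) ∈ logFields23) : V ∈ logFields23 := by
  obtain ⟨f, g, hf, hg, c, hc, h⟩ := h
  obtain ⟨F, rfl⟩ := (affineEquiv hM p).surjective f
  obtain ⟨G, rfl⟩ := (affineEquiv hM p).surjective g
  simp only [affineEquiv_apply] at h hf hg
  rw [totalDegree_affineSubst hM] at hf hg
  refine ⟨F, G, hf, hg, s⁻¹ * c, mul_ne_zero (inv_ne_zero hs) hc, pullField_injective hM p ?_⟩
  rw [pullField_C_mul, pullField_inducedField]
  funext i
  rw [C_mul, mul_assoc, ← congrFun h i, ← mul_assoc, ← C_mul, inv_mul_cancel₀ hs, C_1, one_mul]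

/-- The quadratic form `a x² + b x y + c y²`. -/
def quadVal {R : Type*} [CommRing R] (a b c x y : R) : R := a * x ^ 2 + b * x * y + c * y ^ 2

/-- The polar form of `a x² + b x y + c y²`. -/
def polarVal {R : Type*} [CommRing R] (a b c x y z w : R) : R :=
  2 * a * x * z + b * (x * w + y * z) + 2 * c * y * w

lemma affineSubst_quad_eq (M : Matrix (Fin 2) (Fin 2) K) (p : Fin 2 → K) (a b c d e f : K) :
    affineSubst M p (quad a b c d e f) =
      quad (eval p (quad a b c d e f))
        ((b + 2 * d * p 0 + e * p 1) * M 0 0 + (c + e * p 0 + 2 * f * p 1) * M 1 0)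
        ((b + 2 * d * p 0 + e * p 1) * M 0 1 + (c + e * p 0 + 2 * f * p 1) * M 1 1)
        (quadVal d e f (M 0 0) (M 1 0)) (polarVal d e f (M 0 0) (M 1 0) (M 0 1) (M 1 1))
        (quadVal d e f (M 0 1) (M 1 1)) := by
  simp only [quad, quadVal, polarVal, map_add, map_mul, affineSubst_X, affineSubst_C, lin, map_pow,
    map_ofNat, eval_C, eval_X]
  ring

lemma C_mul_quad_sub (s t a b c d e f a' b' c' d' e' f' : K) :
    C s * quad a b c d e f - C t * quad a' b' c' d' e' f' = quad (s * a - t * a') (s * b - t * b')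
      (s * c - t * c') (s * d - t * d') (s * e - t * e') (s * f - t * f') := by
  simp only [quad, map_sub, map_mul]
  ring

lemma C_mul_quad (s a b c d e f : K) :
    C s * quad a b c d e f = quad (s * a) (s * b) (s * c) (s * d) (s * e) (s * f) := by
  simp only [quad, map_mul]
  ring

end Pull

/-! ### Two semi-invariants and the elimination of the singular point. -/

section SemiInvariants

variable {R : Type*} [CommRing R]

/-- `det (J v, Q v)` for a linear map `J` and a quadratic map `Q` of the plane, `v` spanning the
kernel of the divergence of `Q`. -/
def detForm (j₀₀ j₀₁ j₁₀ j₁₁ a b c a' b' c' : R) : R :=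
  (j₀₀ * (b + 2 * c') - j₀₁ * (2 * a + b')) * quadVal a' b' c' (b + 2 * c') (-(2 * a + b')) -
    (j₁₀ * (b + 2 * c') - j₁₁ * (2 * a + b')) * quadVal a b c (b + 2 * c') (-(2 * a + b'))

/-- `tr (J ∘ DQ(v)) - div Q (J v)` for a linear map `J` and a quadratic map `Q` of the plane, `v`
spanning the kernel of the divergence of `Q`. -/
def traceForm (j₀₀ j₀₁ j₁₀ j₁₁ a b c a' b' c' : R) : R :=
  j₀₀ * polarVal a b c (b + 2 * c') (-(2 * a + b')) 1 0 +
    j₀₁ * polarVal a' b' c' (b + 2 * c') (-(2 * a + b')) 1 0 +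
    j₁₀ * polarVal a b c (b + 2 * c') (-(2 * a + b')) 0 1 +
    j₁₁ * polarVal a' b' c' (b + 2 * c') (-(2 * a + b')) 0 1 -
    (2 * a + b') * (j₀₀ * (b + 2 * c') - j₀₁ * (2 * a + b')) -
    (b + 2 * c') * (j₁₀ * (b + 2 * c') - j₁₁ * (2 * a + b'))

section Transform

variable (m₀₀ m₀₁ m₁₀ m₁₁ j₀₀ j₀₁ j₁₀ j₁₁ a b c a' b' c' : R)

/-- With J' = adj(M) J M and Q' = adj(M) Q(M ·), the kernel vector becomes v' = det(M) adj(M) v, so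
M v' = det(M)² v. The factors are det(M)² from J'v', det(M)⁴ from Q'(v') and det(M) from the
determinant of adj(M). -/
lemma detForm_transform : detForm
    (m₁₁ * (j₀₀ * m₀₀ + j₀₁ * m₁₀) - m₀₁ * (j₁₀ * m₀₀ + j₁₁ * m₁₀))
    (m₁₁ * (j₀₀ * m₀₁ + j₀₁ * m₁₁) - m₀₁ * (j₁₀ * m₀₁ + j₁₁ * m₁₁))
    (m₀₀ * (j₁₀ * m₀₀ + j₁₁ * m₁₀) - m₁₀ * (j₀₀ * m₀₀ + j₀₁ * m₁₀))
    (m₀₀ * (j₁₀ * m₀₁ + j₁₁ * m₁₁) - m₁₀ * (j₀₀ * m₀₁ + j₀₁ * m₁₁))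
    (m₁₁ * quadVal a b c m₀₀ m₁₀ - m₀₁ * quadVal a' b' c' m₀₀ m₁₀)
    (m₁₁ * polarVal a b c m₀₀ m₁₀ m₀₁ m₁₁ - m₀₁ * polarVal a' b' c' m₀₀ m₁₀ m₀₁ m₁₁)
    (m₁₁ * quadVal a b c m₀₁ m₁₁ - m₀₁ * quadVal a' b' c' m₀₁ m₁₁)
    (m₀₀ * quadVal a' b' c' m₀₀ m₁₀ - m₁₀ * quadVal a b c m₀₀ m₁₀)
    (m₀₀ * polarVal a' b' c' m₀₀ m₁₀ m₀₁ m₁₁ - m₁₀ * polarVal a b c m₀₀ m₁₀ m₀₁ m₁₁)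
    (m₀₀ * quadVal a' b' c' m₀₁ m₁₁ - m₁₀ * quadVal a b c m₀₁ m₁₁) =
    (m₀₀ * m₁₁ - m₀₁ * m₁₀) ^ 7 * detForm j₀₀ j₀₁ j₁₀ j₁₁ a b c a' b' c' := by
  have hv0 : m₁₁ * polarVal a b c m₀₀ m₁₀ m₀₁ m₁₁ - m₀₁ * polarVal a' b' c' m₀₀ m₁₀ m₀₁ m₁₁ +
      2 * (m₀₀ * quadVal a' b' c' m₀₁ m₁₁ - m₁₀ * quadVal a b c m₀₁ m₁₁) =
      (m₀₀ * m₁₁ - m₀₁ * m₁₀) * (m₁₁ * (b + 2 * c') + m₀₁ * (2 * a + b')) := by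
    simp only [quadVal, polarVal]
    ring
  have hv1 : 2 * (m₁₁ * quadVal a b c m₀₀ m₁₀ - m₀₁ * quadVal a' b' c' m₀₀ m₁₀) +
      (m₀₀ * polarVal a' b' c' m₀₀ m₁₀ m₀₁ m₁₁ - m₁₀ * polarVal a b c m₀₀ m₁₀ m₀₁ m₁₁) =
      (m₀₀ * m₁₁ - m₀₁ * m₁₀) * (m₁₀ * (b + 2 * c') + m₀₀ * (2 * a + b')) := by
    simp only [quadVal, polarVal]
    ring
  have hQ : ∀ p q s a b c a' b' c' x y : R, quadVal (p * quadVal a b c m₀₀ m₁₀ -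
      q * quadVal a' b' c' m₀₀ m₁₀) (p * polarVal a b c m₀₀ m₁₀ m₀₁ m₁₁ -
      q * polarVal a' b' c' m₀₀ m₁₀ m₀₁ m₁₁) (p * quadVal a b c m₀₁ m₁₁ -
      q * quadVal a' b' c' m₀₁ m₁₁) (s * (m₁₁ * x + m₀₁ * y)) (-(s * (m₁₀ * x + m₀₀ * y))) =
      s ^ 2 * (m₀₀ * m₁₁ - m₀₁ * m₁₀) ^ 2 *
        (p * quadVal a b c x (-y) - q * quadVal a' b' c' x (-y)) := by
    intros
    simp only [quadVal, polarVal]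
    ring
  rw [detForm, hv0, hv1, hQ, hQ, detForm]
  generalize quadVal a b c (b + 2 * c') (-(2 * a + b')) = r
  generalize quadVal a' b' c' (b + 2 * c') (-(2 * a + b')) = s
  ring

/-- Here DQ'(v') contributes det(M)², and cancelling M against adj(M) twice, once in the product and
once under the trace, contributes the other two powers. -/
lemma traceForm_transform : traceForm
    (m₁₁ * (j₀₀ * m₀₀ + j₀₁ * m₁₀) - m₀₁ * (j₁₀ * m₀₀ + j₁₁ * m₁₀))
    (m₁₁ * (j₀₀ * m₀₁ + j₀₁ * m₁₁) - m₀₁ * (j₁₀ * m₀₁ + j₁₁ * m₁₁))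
    (m₀₀ * (j₁₀ * m₀₀ + j₁₁ * m₁₀) - m₁₀ * (j₀₀ * m₀₀ + j₀₁ * m₁₀))
    (m₀₀ * (j₁₀ * m₀₁ + j₁₁ * m₁₁) - m₁₀ * (j₀₀ * m₀₁ + j₀₁ * m₁₁))
    (m₁₁ * quadVal a b c m₀₀ m₁₀ - m₀₁ * quadVal a' b' c' m₀₀ m₁₀)
    (m₁₁ * polarVal a b c m₀₀ m₁₀ m₀₁ m₁₁ - m₀₁ * polarVal a' b' c' m₀₀ m₁₀ m₀₁ m₁₁)
    (m₁₁ * quadVal a b c m₀₁ m₁₁ - m₀₁ * quadVal a' b' c' m₀₁ m₁₁)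
    (m₀₀ * quadVal a' b' c' m₀₀ m₁₀ - m₁₀ * quadVal a b c m₀₀ m₁₀)
    (m₀₀ * polarVal a' b' c' m₀₀ m₁₀ m₀₁ m₁₁ - m₁₀ * polarVal a b c m₀₀ m₁₀ m₀₁ m₁₁)
    (m₀₀ * quadVal a' b' c' m₀₁ m₁₁ - m₁₀ * quadVal a b c m₀₁ m₁₁) =
    (m₀₀ * m₁₁ - m₀₁ * m₁₀) ^ 4 * traceForm j₀₀ j₀₁ j₁₀ j₁₁ a b c a' b' c' := by
  have hv0 : m₁₁ * polarVal a b c m₀₀ m₁₀ m₀₁ m₁₁ - m₀₁ * polarVal a' b' c' m₀₀ m₁₀ m₀₁ m₁₁ +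
      2 * (m₀₀ * quadVal a' b' c' m₀₁ m₁₁ - m₁₀ * quadVal a b c m₀₁ m₁₁) =
      (m₀₀ * m₁₁ - m₀₁ * m₁₀) * (m₁₁ * (b + 2 * c') + m₀₁ * (2 * a + b')) := by
    simp only [quadVal, polarVal]
    ring
  have hv1 : 2 * (m₁₁ * quadVal a b c m₀₀ m₁₀ - m₀₁ * quadVal a' b' c' m₀₀ m₁₀) +
      (m₀₀ * polarVal a' b' c' m₀₀ m₁₀ m₀₁ m₁₁ - m₁₀ * polarVal a b c m₀₀ m₁₀ m₀₁ m₁₁) =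
      (m₀₀ * m₁₁ - m₀₁ * m₁₀) * (m₁₀ * (b + 2 * c') + m₀₀ * (2 * a + b')) := by
    simp only [quadVal, polarVal]
    ring
  have hP : ∀ p q s a b c a' b' c' x y z w : R, polarVal (p * quadVal a b c m₀₀ m₁₀ -
      q * quadVal a' b' c' m₀₀ m₁₀) (p * polarVal a b c m₀₀ m₁₀ m₀₁ m₁₁ -
      q * polarVal a' b' c' m₀₀ m₁₀ m₀₁ m₁₁) (p * quadVal a b c m₀₁ m₁₁ -
      q * quadVal a' b' c' m₀₁ m₁₁) (s * (m₁₁ * x + m₀₁ * y)) (-(s * (m₁₀ * x + m₀₀ * y))) z w =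
      s * (m₀₀ * m₁₁ - m₀₁ * m₁₀) *
        (p * (polarVal a b c x (-y) 1 0 * (m₀₀ * z + m₀₁ * w) +
            polarVal a b c x (-y) 0 1 * (m₁₀ * z + m₁₁ * w)) -
          q * (polarVal a' b' c' x (-y) 1 0 * (m₀₀ * z + m₀₁ * w) +
            polarVal a' b' c' x (-y) 0 1 * (m₁₀ * z + m₁₁ * w))) := by
    intros
    simp only [quadVal, polarVal]
    ring
  rw [traceForm, hv0, hv1]
  simp only [hP]
  rw [traceForm]
  generalize polarVal a b c (b + 2 * c') (-(2 * a + b')) 1 0 = r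
  generalize polarVal a' b' c' (b + 2 * c') (-(2 * a + b')) 1 0 = s
  generalize polarVal a b c (b + 2 * c') (-(2 * a + b')) 0 1 = r'
  generalize polarVal a' b' c' (b + 2 * c') (-(2 * a + b')) 0 1 = s'
  generalize 2 * a + b' = x
  generalize b + 2 * c' = y
  ring

end Transform

/-- A polynomial in the coefficients of the vector field with components `∑ a_i m_i`, `∑ b_i m_i`,
`m = (1, x, y, x², x y, y²)`; at a singular point with linear part `J` of trace zero it is a
multiple of `detForm J * traceForm J`. -/
def sepPoly (a b : Fin 6 → R) : R :=
  detForm ((a 4 + 2 * b 5) * a 1 - (a 1 + b 2) * a 4) ((a 4 + 2 * b 5) * a 2 - (a 1 + b 2) * (2 * a 5))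
      ((a 4 + 2 * b 5) * b 1 - (a 1 + b 2) * b 4) ((a 4 + 2 * b 5) * b 2 - (a 1 + b 2) * (2 * b 5))
      (a 3) (a 4) (a 5) (b 3) (b 4) (b 5) *
    traceForm ((a 4 + 2 * b 5) * a 1 - (a 1 + b 2) * a 4)
      ((a 4 + 2 * b 5) * a 2 - (a 1 + b 2) * (2 * a 5))
      ((a 4 + 2 * b 5) * b 1 - (a 1 + b 2) * b 4) ((a 4 + 2 * b 5) * b 2 - (a 1 + b 2) * (2 * b 5))
      (a 3) (a 4) (a 5) (b 3) (b 4) (b 5) -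
    (quadVal (a 0) (-a 2) (a 5) (a 4 + 2 * b 5) (a 1 + b 2) *
        quadVal (b 3) (b 4) (b 5) (a 4 + 2 * b 5) (-(2 * a 3 + b 4)) -
      quadVal (b 0) (-b 2) (b 5) (a 4 + 2 * b 5) (a 1 + b 2) *
        quadVal (a 3) (a 4) (a 5) (a 4 + 2 * b 5) (-(2 * a 3 + b 4))) *
    traceForm (polarVal (a 3) (a 4) (a 5) (a 4 + 2 * b 5) (-(2 * a 3 + b 4)) 1 0)
      (polarVal (a 3) (a 4) (a 5) (a 4 + 2 * b 5) (-(2 * a 3 + b 4)) 0 1)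
      (polarVal (b 3) (b 4) (b 5) (a 4 + 2 * b 5) (-(2 * a 3 + b 4)) 1 0)
      (polarVal (b 3) (b 4) (b 5) (a 4 + 2 * b 5) (-(2 * a 3 + b 4)) 0 1)
      (a 3) (a 4) (a 5) (b 3) (b 4) (b 5)

/-- The singular point (x, y) lies on the line div V = 0, which has direction v. With k = a₄ + 2b₅
the first component of v, the point of this line with abscissa 0 is (x, y) - (x/k) v. The entries in
`sepPoly` are, up to powers of k, the linear part and the value of V at that point, so they depend
on the coefficients only; the terms in x cancel between the two products. -/
lemma sepPoly_eq {a b : Fin 6 → R} {x y : R}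
    (ha : a 0 + a 1 * x + a 2 * y + a 3 * x ^ 2 + a 4 * (x * y) + a 5 * y ^ 2 = 0)
    (hb : b 0 + b 1 * x + b 2 * y + b 3 * x ^ 2 + b 4 * (x * y) + b 5 * y ^ 2 = 0)
    (hd : a 1 + 2 * a 3 * x + a 4 * y + (b 2 + b 4 * x + 2 * b 5 * y) = 0) :
    sepPoly a b = (a 4 + 2 * b 5) ^ 2 *
      (detForm (a 1 + 2 * a 3 * x + a 4 * y) (a 2 + a 4 * x + 2 * a 5 * y)
        (b 1 + 2 * b 3 * x + b 4 * y) (b 2 + b 4 * x + 2 * b 5 * y)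
        (a 3) (a 4) (a 5) (b 3) (b 4) (b 5) *
      traceForm (a 1 + 2 * a 3 * x + a 4 * y) (a 2 + a 4 * x + 2 * a 5 * y)
        (b 1 + 2 * b 3 * x + b 4 * y) (b 2 + b 4 * x + 2 * b 5 * y)
        (a 3) (a 4) (a 5) (b 3) (b 4) (b 5)) := by
  rw [sepPoly]
  generalize a 0 = a₀, a 1 = a₁, a 2 = a₂, a 3 = a₃, a 4 = a₄, a 5 = a₅ at *
  generalize b 0 = b₀, b 1 = b₁, b 2 = b₂, b 3 = b₃, b 4 = b₄, b 5 = b₅ at *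
  have e₀₀ : (a₄ + 2 * b₅) * a₁ - (a₁ + b₂) * a₄ = (a₄ + 2 * b₅) * (a₁ + 2 * a₃ * x + a₄ * y) -
      x * polarVal a₃ a₄ a₅ (a₄ + 2 * b₅) (-(2 * a₃ + b₄)) 1 0 := by
    simp only [polarVal]
    linear_combination -a₄ * hd
  have e₀₁ : (a₄ + 2 * b₅) * a₂ - (a₁ + b₂) * (2 * a₅) =
      (a₄ + 2 * b₅) * (a₂ + a₄ * x + 2 * a₅ * y) -
      x * polarVal a₃ a₄ a₅ (a₄ + 2 * b₅) (-(2 * a₃ + b₄)) 0 1 := by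
    simp only [polarVal]
    linear_combination -2 * a₅ * hd
  have e₁₀ : (a₄ + 2 * b₅) * b₁ - (a₁ + b₂) * b₄ = (a₄ + 2 * b₅) * (b₁ + 2 * b₃ * x + b₄ * y) -
      x * polarVal b₃ b₄ b₅ (a₄ + 2 * b₅) (-(2 * a₃ + b₄)) 1 0 := by
    simp only [polarVal]
    linear_combination -b₄ * hd
  have e₁₁ : (a₄ + 2 * b₅) * b₂ - (a₁ + b₂) * (2 * b₅) =
      (a₄ + 2 * b₅) * (b₂ + b₄ * x + 2 * b₅ * y) -
      x * polarVal b₃ b₄ b₅ (a₄ + 2 * b₅) (-(2 * a₃ + b₄)) 0 1 := by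
    simp only [polarVal]
    linear_combination -2 * b₅ * hd
  have f₀ : quadVal a₀ (-a₂) a₅ (a₄ + 2 * b₅) (a₁ + b₂) = -((a₄ + 2 * b₅) * x *
      ((a₁ + 2 * a₃ * x + a₄ * y) * (a₄ + 2 * b₅) -
        (a₂ + a₄ * x + 2 * a₅ * y) * (2 * a₃ + b₄))) +
      x ^ 2 * quadVal a₃ a₄ a₅ (a₄ + 2 * b₅) (-(2 * a₃ + b₄)) := by
    simp only [quadVal]
    linear_combination (a₄ + 2 * b₅) ^ 2 * ha + (-(a₄ + 2 * b₅) * a₂ +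
      a₅ * (a₁ + b₂ - (2 * a₃ + b₄) * x - (a₄ + 2 * b₅) * y)) * hd
  have f₁ : quadVal b₀ (-b₂) b₅ (a₄ + 2 * b₅) (a₁ + b₂) = -((a₄ + 2 * b₅) * x *
      ((b₁ + 2 * b₃ * x + b₄ * y) * (a₄ + 2 * b₅) -
        (b₂ + b₄ * x + 2 * b₅ * y) * (2 * a₃ + b₄))) +
      x ^ 2 * quadVal b₃ b₄ b₅ (a₄ + 2 * b₅) (-(2 * a₃ + b₄)) := by
    simp only [quadVal]
    linear_combination (a₄ + 2 * b₅) ^ 2 * hb + (-(a₄ + 2 * b₅) * b₂ +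
      b₅ * (a₁ + b₂ - (2 * a₃ + b₄) * x - (a₄ + 2 * b₅) * y)) * hd
  rw [e₀₀, e₀₁, e₁₀, e₁₁, f₀, f₁]
  generalize a₁ + 2 * a₃ * x + a₄ * y = j₀₀, a₂ + a₄ * x + 2 * a₅ * y = j₀₁,
    b₁ + 2 * b₃ * x + b₄ * y = j₁₀, b₂ + b₄ * x + 2 * b₅ * y = j₁₁
  -- By linearity in J the correction is `detForm` of DQ(v), and this is det(2Q(v), Q(v)) = 0.
  have hdet : ∀ s t : R, detForm
      (s * j₀₀ - t * polarVal a₃ a₄ a₅ (a₄ + 2 * b₅) (-(2 * a₃ + b₄)) 1 0)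
      (s * j₀₁ - t * polarVal a₃ a₄ a₅ (a₄ + 2 * b₅) (-(2 * a₃ + b₄)) 0 1)
      (s * j₁₀ - t * polarVal b₃ b₄ b₅ (a₄ + 2 * b₅) (-(2 * a₃ + b₄)) 1 0)
      (s * j₁₁ - t * polarVal b₃ b₄ b₅ (a₄ + 2 * b₅) (-(2 * a₃ + b₄)) 0 1)
      a₃ a₄ a₅ b₃ b₄ b₅ = s * detForm j₀₀ j₀₁ j₁₀ j₁₁ a₃ a₄ a₅ b₃ b₄ b₅ := by
    intro s t
    simp only [detForm]
    generalize a₄ + 2 * b₅ = v, 2 * a₃ + b₄ = w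
    simp only [quadVal, polarVal]
    ring
  have htr : ∀ s t k₀₀ k₀₁ k₁₀ k₁₁ : R, traceForm (s * j₀₀ - t * k₀₀) (s * j₀₁ - t * k₀₁)
      (s * j₁₀ - t * k₁₀) (s * j₁₁ - t * k₁₁) a₃ a₄ a₅ b₃ b₄ b₅ =
      s * traceForm j₀₀ j₀₁ j₁₀ j₁₁ a₃ a₄ a₅ b₃ b₄ b₅ -
        t * traceForm k₀₀ k₀₁ k₁₀ k₁₁ a₃ a₄ a₅ b₃ b₄ b₅ := by
    intros
    simp only [traceForm]
    ring
  rw [hdet, htr]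
  rw [detForm]
  ring

lemma map_sepPoly {S : Type*} [CommRing S] (φ : R →+* S) (a b : Fin 6 → R) :
    φ (sepPoly a b) = sepPoly (fun i => φ (a i)) (fun i => φ (b i)) := by
  simp only [sepPoly, detForm, traceForm, quadVal, polarVal, map_sub, map_add, map_mul, map_neg,
    map_pow, map_ofNat, map_one, map_zero]

end SemiInvariants

/-! ### 𝒬₄ is a component of the center set. -/

section Maximality

/-- A linear map of the plane with eigenvalues `s ≠ -s` is diagonalizable, by a matrix of
determinant `s`. -/
lemma exists_diagonalization {α β γ : ℂ} (h : α ^ 2 + β * γ ≠ 0) :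
    ∃ s m₀₀ m₀₁ m₁₀ m₁₁ : ℂ, s ≠ 0 ∧ m₀₀ * m₁₁ - m₀₁ * m₁₀ = s ∧
      α * m₀₀ + β * m₁₀ = s * m₀₀ ∧ γ * m₀₀ - α * m₁₀ = s * m₁₀ ∧
      α * m₀₁ + β * m₁₁ = -s * m₀₁ ∧ γ * m₀₁ - α * m₁₁ = -s * m₁₁ := by
  obtain ⟨s, hs⟩ := IsAlgClosed.exists_pow_nat_eq (α ^ 2 + β * γ) (n := 2) (by norm_num)
  have hs0 : s ≠ 0 := by
    rintro rfl
    exact h (by rw [← hs]; norm_num)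
  by_cases hβ : β = 0
  · by_cases hγ : γ = 0
    · subst hβ hγ
      refine ⟨α, 1, 0, 0, α, fun h0 => h (by rw [h0]; ring), ?_, ?_, ?_, ?_, ?_⟩ <;> ring
    · refine ⟨s, s + α, (α - s) / (2 * γ), γ, 1 / 2, hs0, ?_, ?_, ?_, ?_, ?_⟩ <;> field_simp <;>
        first | ring1 | linear_combination hs | linear_combination -hs
  · refine ⟨s, β, -1 / 2, s - α, (s + α) / (2 * β), hs0, ?_, ?_, ?_, ?_, ?_⟩ <;> field_simp <;>
      first | ring1 | linear_combination hs | linear_combination -hs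

lemma HasMorseIntegral.C_mul {V : VField ℂ} {p : Fin 2 → ℂ} (h : HasMorseIntegral V p) (s : ℂ) :
    HasMorseIntegral (fun i => C s * V i) p := by
  obtain ⟨f, hf, hV, h0⟩ := h
  refine ⟨f, hf, ?_, h0⟩
  filter_upwards [hV] with q hq
  have : VField.evalAt (fun i => C s * V i) q = s • V.evalAt q := by
    funext i
    simp [VField.evalAt]
  rw [this, map_smul, hq, smul_zero]

lemma pullField_quad {K : Type*} [Field K] (M : Matrix (Fin 2) (Fin 2) K) (p : Fin 2 → K)
    {V : VField K} {a b : Fin 6 → K} (h₀ : V 0 = quad (a 0) (a 1) (a 2) (a 3) (a 4) (a 5))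
    (h₁ : V 1 = quad (b 0) (b 1) (b 2) (b 3) (b 4) (b 5)) (e₀ : eval p (V 0) = 0)
    (e₁ : eval p (V 1) = 0) {j₀₀ j₀₁ j₁₀ j₁₁ : K}
    (hj₀₀ : a 1 + 2 * a 3 * p 0 + a 4 * p 1 = j₀₀) (hj₀₁ : a 2 + a 4 * p 0 + 2 * a 5 * p 1 = j₀₁)
    (hj₁₀ : b 1 + 2 * b 3 * p 0 + b 4 * p 1 = j₁₀) (hj₁₁ : b 2 + b 4 * p 0 + 2 * b 5 * p 1 = j₁₁) :
    pullField M p V 0 = quad 0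
        (M 1 1 * (j₀₀ * M 0 0 + j₀₁ * M 1 0) - M 0 1 * (j₁₀ * M 0 0 + j₁₁ * M 1 0))
        (M 1 1 * (j₀₀ * M 0 1 + j₀₁ * M 1 1) - M 0 1 * (j₁₀ * M 0 1 + j₁₁ * M 1 1))
        (M 1 1 * quadVal (a 3) (a 4) (a 5) (M 0 0) (M 1 0) -
          M 0 1 * quadVal (b 3) (b 4) (b 5) (M 0 0) (M 1 0))
        (M 1 1 * polarVal (a 3) (a 4) (a 5) (M 0 0) (M 1 0) (M 0 1) (M 1 1) -
          M 0 1 * polarVal (b 3) (b 4) (b 5) (M 0 0) (M 1 0) (M 0 1) (M 1 1))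
        (M 1 1 * quadVal (a 3) (a 4) (a 5) (M 0 1) (M 1 1) -
          M 0 1 * quadVal (b 3) (b 4) (b 5) (M 0 1) (M 1 1)) ∧
      pullField M p V 1 = quad 0
        (M 0 0 * (j₁₀ * M 0 0 + j₁₁ * M 1 0) - M 1 0 * (j₀₀ * M 0 0 + j₀₁ * M 1 0))
        (M 0 0 * (j₁₀ * M 0 1 + j₁₁ * M 1 1) - M 1 0 * (j₀₀ * M 0 1 + j₀₁ * M 1 1))
        (M 0 0 * quadVal (b 3) (b 4) (b 5) (M 0 0) (M 1 0) -
          M 1 0 * quadVal (a 3) (a 4) (a 5) (M 0 0) (M 1 0))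
        (M 0 0 * polarVal (b 3) (b 4) (b 5) (M 0 0) (M 1 0) (M 0 1) (M 1 1) -
          M 1 0 * polarVal (a 3) (a 4) (a 5) (M 0 0) (M 1 0) (M 0 1) (M 1 1))
        (M 0 0 * quadVal (b 3) (b 4) (b 5) (M 0 1) (M 1 1) -
          M 1 0 * quadVal (a 3) (a 4) (a 5) (M 0 1) (M 1 1)) := by
  rw [h₀] at e₀
  rw [h₁] at e₁
  constructor
  · rw [pullField, Matrix.cons_val_zero, h₀, h₁, affineSubst_quad_eq, affineSubst_quad_eq,
      C_mul_quad_sub, e₀, e₁, hj₀₀, hj₀₁, hj₁₀, hj₁₁, mul_zero, mul_zero, sub_zero]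
  · rw [pullField, Matrix.cons_val_one, Matrix.cons_val_zero, h₀, h₁, affineSubst_quad_eq,
      affineSubst_quad_eq, C_mul_quad_sub, e₀, e₁, hj₀₀, hj₀₁, hj₁₀, hj₁₁, mul_zero, mul_zero,
      sub_zero]

/-- A Morse center has a linear part with trace zero and nonzero determinant, so after an affine
change it is a saddle with eigenvalues 1 and -1. The semi-invariants translate `hne` into the two
nondegeneracy conditions for such a saddle. -/
lemma IsMorseCenter.mem_logFields23 {V : VField ℂ} {p : Fin 2 → ℂ} (h : IsMorseCenter V p)
    {a b : Fin 6 → ℂ} (h₀ : V 0 = quad (a 0) (a 1) (a 2) (a 3) (a 4) (a 5))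
    (h₁ : V 1 = quad (b 0) (b 1) (b 2) (b 3) (b 4) (b 5)) (hne : sepPoly a b ≠ 0) :
    V ∈ logFields23 := by
  obtain ⟨hp, hdet, hm⟩ := h
  replace hm : HasMorseIntegral V p := hm
  have e₀ : eval p (V 0) = 0 := congrFun hp 0
  have e₁ : eval p (V 1) = 0 := congrFun hp 1
  obtain ⟨j₀₀, hj₀₀⟩ : ∃ j, a 1 + 2 * a 3 * p 0 + a 4 * p 1 = j := ⟨_, rfl⟩
  obtain ⟨j₀₁, hj₀₁⟩ : ∃ j, a 2 + a 4 * p 0 + 2 * a 5 * p 1 = j := ⟨_, rfl⟩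
  obtain ⟨j₁₀, hj₁₀⟩ : ∃ j, b 1 + 2 * b 3 * p 0 + b 4 * p 1 = j := ⟨_, rfl⟩
  obtain ⟨j₁₁, hj₁₁⟩ : ∃ j, b 2 + b 4 * p 0 + 2 * b 5 * p 1 = j := ⟨_, rfl⟩
  have hdet' : j₀₀ * j₁₁ - j₀₁ * j₁₀ ≠ 0 := by
    rw [Matrix.det_fin_two] at hdet
    simp only [Matrix.of_apply, h₀, h₁, pderiv_zero_quad, pderiv_one_quad, eval_lin] at hdet
    refine fun h0 => hdet ?_
    rw [← h0, ← hj₀₀, ← hj₀₁, ← hj₁₀, ← hj₁₁]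
    ring
  have htr : j₀₀ + j₁₁ = 0 := by
    obtain ⟨q₀, q₁⟩ := pullField_quad (1 : Matrix (Fin 2) (Fin 2) ℂ) p h₀ h₁ e₀ e₁ hj₀₀ hj₀₁ hj₁₀
      hj₁₁
    have := (hm.pull (M := 1) (by simp)).trace_eq_zero q₀ q₁
    simpa using this
  have hsep := sepPoly_eq (a := a) (b := b) (x := p 0) (y := p 1)
    (by rw [← e₀, h₀, eval_quad]) (by rw [← e₁, h₁, eval_quad])
    (by rw [hj₀₀, hj₁₁, htr])
  rw [hj₀₀, hj₀₁, hj₁₀, hj₁₁] at hsep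
  rw [hsep] at hne
  have hdf := left_ne_zero_of_mul (right_ne_zero_of_mul hne)
  have htf := right_ne_zero_of_mul (right_ne_zero_of_mul hne)
  obtain rfl : j₁₁ = -j₀₀ := by linear_combination htr
  obtain ⟨s, m₀₀, m₀₁, m₁₀, m₁₁, hs, hM, k₀₀, k₁₀, k₀₁, k₁₁⟩ :=
    exists_diagonalization (α := j₀₀) (β := j₀₁) (γ := j₁₀)
      (fun h0 => hdet' (by linear_combination -h0))
  have t₁ := detForm_transform m₀₀ m₀₁ m₁₀ m₁₁ j₀₀ j₀₁ j₁₀ (-j₀₀) (a 3) (a 4) (a 5) (b 3) (b 4)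
    (b 5)
  have t₂ := traceForm_transform m₀₀ m₀₁ m₁₀ m₁₁ j₀₀ j₀₁ j₁₀ (-j₀₀) (a 3) (a 4) (a 5) (b 3) (b 4)
    (b 5)
  obtain ⟨q₀, q₁⟩ := pullField_quad !![m₀₀, m₀₁; m₁₀, m₁₁] p h₀ h₁ e₀ e₁ hj₀₀ hj₀₁ hj₁₀ hj₁₁
  have hMd : (!![m₀₀, m₀₁; m₁₀, m₁₁] : Matrix (Fin 2) (Fin 2) ℂ).det = s := by
    rw [Matrix.det_fin_two_of, hM]
  simp only [Matrix.of_apply, Matrix.cons_val', Matrix.cons_val_zero, Matrix.cons_val_one,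
    Matrix.cons_val_fin_one] at q₀ q₁
  have l₀₀ : m₁₁ * (j₀₀ * m₀₀ + j₀₁ * m₁₀) - m₀₁ * (j₁₀ * m₀₀ + -j₀₀ * m₁₀) = s ^ 2 := by
    linear_combination m₁₁ * k₀₀ - m₀₁ * k₁₀ + s * hM
  have l₀₁ : m₁₁ * (j₀₀ * m₀₁ + j₀₁ * m₁₁) - m₀₁ * (j₁₀ * m₀₁ + -j₀₀ * m₁₁) = 0 := by
    linear_combination m₁₁ * k₀₁ - m₀₁ * k₁₁
  have l₁₀ : m₀₀ * (j₁₀ * m₀₀ + -j₀₀ * m₁₀) - m₁₀ * (j₀₀ * m₀₀ + j₀₁ * m₁₀) = 0 := by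
    linear_combination m₀₀ * k₁₀ - m₁₀ * k₀₀
  have l₁₁ : m₀₀ * (j₁₀ * m₀₁ + -j₀₀ * m₁₁) - m₁₀ * (j₀₀ * m₀₁ + j₀₁ * m₁₁) = -s ^ 2 := by
    linear_combination m₀₀ * k₁₁ - m₁₀ * k₀₁ - s * hM
  -- The pulled-back field is multiplied by det M = s, so its eigenvalues are ±s² and the
  -- normalizing factor is 1/s².
  have hmp := (hm.pull (M := !![m₀₀, m₀₁; m₁₀, m₁₁]) (by rwa [hMd])).C_mul (s ^ 2)⁻¹
  refine mem_logFields23_of_pullField (M := !![m₀₀, m₀₁; m₁₀, m₁₁])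
    (by rw [hMd]; exact isUnit_iff_ne_zero.2 hs) p (inv_ne_zero (pow_ne_zero 2 hs)) ?_
  rw [l₀₀, l₀₁, l₁₀, l₁₁, hM] at t₁ t₂
  rw [l₀₀, l₀₁] at q₀
  rw [l₁₀, l₁₁] at q₁
  generalize m₁₁ * quadVal (a 3) (a 4) (a 5) m₀₀ m₁₀ -
    m₀₁ * quadVal (b 3) (b 4) (b 5) m₀₀ m₁₀ = A at *
  generalize m₁₁ * polarVal (a 3) (a 4) (a 5) m₀₀ m₁₀ m₀₁ m₁₁ -
    m₀₁ * polarVal (b 3) (b 4) (b 5) m₀₀ m₁₀ m₀₁ m₁₁ = B at *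
  generalize m₁₁ * quadVal (a 3) (a 4) (a 5) m₀₁ m₁₁ -
    m₀₁ * quadVal (b 3) (b 4) (b 5) m₀₁ m₁₁ = D at *
  generalize m₀₀ * quadVal (b 3) (b 4) (b 5) m₀₀ m₁₀ -
    m₁₀ * quadVal (a 3) (a 4) (a 5) m₀₀ m₁₀ = A' at *
  generalize m₀₀ * polarVal (b 3) (b 4) (b 5) m₀₀ m₁₀ m₀₁ m₁₁ -
    m₁₀ * polarVal (a 3) (a 4) (a 5) m₀₀ m₁₀ m₀₁ m₁₁ = B' at *
  generalize m₀₀ * quadVal (b 3) (b 4) (b 5) m₀₁ m₁₁ -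
    m₁₀ * quadVal (a 3) (a 4) (a 5) m₀₁ m₁₁ = D' at *
  have n₁ := t₁.trans_ne (mul_ne_zero (pow_ne_zero 7 hs) hdf)
  have n₂ := t₂.trans_ne (mul_ne_zero (pow_ne_zero 4 hs) htf)
  have hs2 : s ^ 2 ≠ 0 := pow_ne_zero 2 hs
  refine hmp.mem_logFields23 (a := (s ^ 2)⁻¹ * A) (b := (s ^ 2)⁻¹ * B) (c := (s ^ 2)⁻¹ * D)
    (a' := -((s ^ 2)⁻¹ * D')) (b' := -((s ^ 2)⁻¹ * B')) (c' := -((s ^ 2)⁻¹ * A')) ?_ ?_ ?_ ?_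
  · rw [q₀, C_mul_quad, inv_mul_cancel₀ hs2, mul_zero]
  · rw [q₁, C_mul_quad, mul_neg, inv_mul_cancel₀ hs2, mul_zero, neg_neg, neg_neg, neg_neg]
  -- For J a multiple of diag(1, -1), `traceForm` vanishes when both xy coefficients do.
  · by_contra! hbb
    have hB : B = 0 := (mul_eq_zero.1 hbb.1).resolve_left (inv_ne_zero hs2)
    have hB' : B' = 0 := (mul_eq_zero.1 (neg_eq_zero.1 hbb.2)).resolve_left (inv_ne_zero hs2)
    refine n₂ ?_
    rw [traceForm, hB, hB']
    simp only [polarVal]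
    ring
  · intro h0
    refine mul_ne_zero (pow_ne_zero 4 (inv_ne_zero hs2)) n₁ ?_
    rw [detForm]
    simp only [quadVal]
    linear_combination -s ^ 2 * h0

/-- The monomials of degree at most two. -/
def quadIdx : Fin 6 → {m : Fin 2 →₀ ℕ // m.degree ≤ 2} :=
  ![⟨expo 0 0, by simp [degree_expo]⟩, ⟨expo 1 0, by simp [degree_expo]⟩,
    ⟨expo 0 1, by simp [degree_expo]⟩, ⟨expo 2 0, by simp [degree_expo]⟩,
    ⟨expo 1 1, by simp [degree_expo]⟩, ⟨expo 0 2, by simp [degree_expo]⟩]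

/-- The polynomial `sepPoly` in the coordinates of the space of quadratic vector fields. -/
def sepMvPoly : MvPolynomial (CoeffIndex 2) ℂ :=
  sepPoly (fun k => X (0, quadIdx k)) (fun k => X (1, quadIdx k))

lemma eval_sepMvPoly (V : VField ℂ) : eval (coeffs 2 V) sepMvPoly =
    sepPoly (fun k => coeff (quadIdx k).1 (V 0)) (fun k => coeff (quadIdx k).1 (V 1)) := by
  rw [sepMvPoly, map_sepPoly]
  simp only [eval_X, coeffs]

lemma inducedField_normal_one : inducedField (normalP₂ (1 : ℂ)) (normalP₃ ℂ) =
    ![quad 6 (-6) 0 0 6 0, quad 0 (-6) 6 6 0 12] := by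
  have h2 : ∀ i, pderiv i (2 : Poly ℂ) = 0 := fun i => by exact_mod_cast (pderiv i).map_natCast 2
  have h3 : ∀ i, pderiv i (3 : Poly ℂ) = 0 := fun i => by exact_mod_cast (pderiv i).map_natCast 3
  refine funext (Fin.forall_fin_two.2 ⟨?_, ?_⟩) <;>
  · simp [inducedField, normalP₂, normalP₃, quad, Derivation.leibniz, Derivation.leibniz_pow,
      pderiv_X_of_ne (R := ℂ) (show (0 : Fin 2) ≠ 1 by decide),
      pderiv_X_of_ne (R := ℂ) (show (1 : Fin 2) ≠ 0 by decide), h2, h3, map_ofNat C]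
    ring

lemma eval_sepMvPoly_normal_ne_zero :
    eval (coeffs 2 (inducedField (normalP₂ (1 : ℂ)) (normalP₃ ℂ))) sepMvPoly ≠ 0 := by
  rw [eval_sepMvPoly, inducedField_normal_one]
  simp only [sepPoly, quadIdx, Matrix.cons_val, Matrix.cons_val_zero, Matrix.cons_val_one,
    coeff_quad, detForm, traceForm, quadVal, polarVal]
  norm_num

lemma coeffs_normal_mem_Q₄ : coeffs 2 (inducedField (normalP₂ (1 : ℂ)) (normalP₃ ℂ)) ∈ Q₄ := by
  rw [Q₄_eq_zariskiClosure_special]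
  refine subset_zariskiClosure _ ⟨_, ⟨_, _, isSpecialPair_normal 1, 1, one_ne_zero, ?_⟩, rfl⟩
  simp

lemma centerSet_subset : centerSet 2 ⊆ Q₄ ∪ {x | eval x sepMvPoly = 0} := by
  refine zariskiClosure_subset ((isVariety_zariskiClosure _).union
    (isVariety_setOf_eval_eq_zero _)) ?_
  rintro _ ⟨V, ⟨hV, p, hp⟩, rfl⟩
  by_cases h : eval (coeffs 2 V) sepMvPoly = 0
  · exact Or.inr h
  · refine Or.inl (subset_zariskiClosure _ ⟨V, ⟨?_, hV⟩, rfl⟩)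
    rw [eval_sepMvPoly] at h
    have hd := mem_fieldsOfDegreeLE_iff.1 hV
    exact hp.mem_logFields23 (a := fun k => coeff (quadIdx k).1 (V 0))
      (b := fun k => coeff (quadIdx k).1 (V 1)) (eq_quad (hd 0)) (eq_quad (hd 1)) h

/-- An irreducible variety between 𝒬₄ and 𝒞₂ lies in 𝒬₄ or in the zero set of `sepMvPoly`. The
latter is impossible, since it misses the normal form with α = 1, a point of 𝒬₄. -/
theorem isIrreducibleComponent_Q₄ : IsIrreducibleComponent Q₄ (centerSet 2) := by
  refine ⟨isIrreducibleVariety_Q₄, Q₄_subset_centerSet, fun Z hZ hQ hZc => ?_⟩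
  rcases hZ.subset_of_subset_union (isVariety_zariskiClosure _)
    (isVariety_setOf_eval_eq_zero sepMvPoly) (hZc.trans centerSet_subset) with h | h
  · exact Set.Subset.antisymm h hQ
  · exact absurd (h (hQ coeffs_normal_mem_Q₄)) eval_sepMvPoly_normal_ne_zero

end Maximality

end QuadCenter

end

theorem mainTheorem8 (K : Type*) [RCLike K] :
    -- the vector fields are of degree two
    (∀ P₂ P₃ : QuadCenter.Poly K, P₂.totalDegree ≤ 2 → P₃.totalDegree ≤ 3 →
      QuadCenter.TopRelations P₂ P₃ →
      QuadCenter.inducedField P₂ P₃ ∈ QuadCenter.fieldsOfDegreeLE K 2 ∧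
      ∀ V : QuadCenter.VField K,
        QuadCenter.HasRationalFirstIntegral V (P₂ ^ 3) (P₃ ^ 2) → IsRelPrime (V 0) (V 1) →
        V ∈ QuadCenter.fieldsOfDegreeLE K 2) ∧
    (∀ P₂ P₃ : QuadCenter.Poly K, QuadCenter.IsSpecialPair P₂ P₃ →
      QuadCenter.AbsolutelyIrreducible P₂ →
      QuadCenter.VField.degree (QuadCenter.inducedField P₂ P₃) = 2 ∧
      (QuadCenter.AbsolutelyIrreducible P₃ →
        ∀ V : QuadCenter.VField K,
          QuadCenter.HasRationalFirstIntegral V (P₂ ^ 3) (P₃ ^ 2) ↔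
            ∃ h : QuadCenter.Poly K, V = fun i => h * QuadCenter.inducedField P₂ P₃ i)) ∧
    -- they form the irreducible component `𝒬₄` of the center set
    (QuadCenter.specialFields = QuadCenter.logFields23 ∩ QuadCenter.fieldsOfDegreeLE ℂ 2 ∧
      QuadCenter.zariskiClosure (QuadCenter.coeffs 2 '' QuadCenter.specialFields)
        = QuadCenter.Q₄ ∧
      QuadCenter.IsIrreducibleComponent QuadCenter.Q₄ (QuadCenter.centerSet 2)) ∧
    -- the normal form, which is that of the general member of the family
    ((∀ P₂ P₃ : QuadCenter.Poly K, QuadCenter.IsSpecialPair P₂ P₃ →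
        ((∃ (α : K) (M : Matrix (Fin 2) (Fin 2) K) (t : Fin 2 → K), IsUnit M.det ∧
            QuadCenter.ratioH (QuadCenter.affineSubst M t P₂) (QuadCenter.affineSubst M t P₃) =
              QuadCenter.ratioH (QuadCenter.normalP₂ α) (QuadCenter.normalP₃ K)) ↔
          QuadCenter.AbsolutelyIrreducible P₂ ∧ QuadCenter.AbsolutelyIrreducible P₃)) ∧
      (∀ α : K, QuadCenter.IsSpecialPair (QuadCenter.normalP₂ α) (QuadCenter.normalP₃ K)) ∧
      QuadCenter.zariskiClosure (QuadCenter.coeffs 2 '' QuadCenter.generalSpecialFields)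
        = QuadCenter.Q₄) := by
  refine ⟨fun P₂ P₃ h₂ h₃ h => ?_, fun P₂ P₃ h h₂ => ?_, ?_, ?_, ?_, ?_⟩
  · have hd := QuadCenter.inducedField_mem_of_topRelations h₂ h₃ h
    exact ⟨hd, fun V hV hrel => hV.degree_le hrel hd⟩
  · exact ⟨QuadCenter.degree_inducedField_eq_two h h₂, fun h₃ V =>
      QuadCenter.hasRationalFirstIntegral_iff h h₂ h₃ V⟩
  · exact ⟨QuadCenter.specialFields_eq, QuadCenter.Q₄_eq_zariskiClosure_special.symm,
      QuadCenter.isIrreducibleComponent_Q₄⟩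
  · exact fun P₂ P₃ h => QuadCenter.exists_ratioH_affineSubst_iff QuadCenter.exists_cube_eq h
  · exact QuadCenter.isSpecialPair_normal
  · exact QuadCenter.zariskiClosure_general
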